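/- A link is understood to be a link type with at least one component, given by a diagram on the sphere $S^2$ up to isotopy of $S^2$ and the Reidemeister moves $\Omega_1,\Omega_2,\Omega_3$ (including their mirror images). Let $c(L)$ denote the crossing number of a link $L$, i.e. the least number of crossings of a diagram of $L$; a diagram of $L$ is minimal if it has $c(L)$ crossings. A diagram is reduced if it has no nugatory crossing. A hard diagram of $L$ is a reduced diagram of $L$ which has more than $c(L)$ crossings and which cannot be transformed into a minimal diagram of $L$ by a sequence of isotopies of $S^2$ and Reidemeister moves none of which increases the number of crossings. A rigid hard diagram is a hard diagram on which no $\Omega_3$-type move can be performed. A link is trivial if it is an unknot or an unlink, i.e. has a diagram without crossings, and it is split if it has a disconnected diagram. Proposition. Every link $L$ has a diagram $D$ that is a rigid hard diagram. Moreover, $D$ can be chosen such that, if $L$ is non-split and non-trivial, then $$\#\mathrm{crossings}(D)\le 8\cdot c(L).$$ -/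

import Mathlib

/-!
# Link diagrams on the 2-sphere, Reidemeister moves, rigid hard diagrams

A link diagram is recorded as a combinatorial map on the (oriented) sphere. Its vertices are the
crossings (of valence four) and finitely many auxiliary *beads* (of valence two). A bead is just a
marked point on an arc of the diagram; it is what makes it possible to record a closed curve without
crossings. Beads may be inserted and removed freely, this is part of planar isotopy.
-/

namespace KnotTheory

/-- The darts (half-edges) at a set `V` of crossings and a set `B` of beads. The four darts at a
crossing `v` are `(v, 0), (v, 1), (v, 2), (v, 3)` in counterclockwise order; the two darts at a bead
`b` are `(b, 0), (b, 1)`. The dart `d` also names the *corner* at its vertex that lies between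
`d` and the next dart in counterclockwise order, i.e. the side of the diagram to the left of `d`
when one leaves the vertex along `d`. -/
abbrev Dart (V B : Type) : Type := (V × ZMod 4) ⊕ (B × ZMod 2)

/-- The next dart, in counterclockwise order, at the same vertex. -/
def rot {V B : Type} : Dart V B → Dart V B
  | Sum.inl (v, i) => Sum.inl (v, i + 1)
  | Sum.inr (b, i) => Sum.inr (b, i + 1)

/-- At each crossing `v` the darts `(v, 1), (v, 3)` form the over-strand and the darts
`(v, 0), (v, 2)` form the under-strand. -/
def IsOver {V B : Type} : Dart V B → Prop
  | Sum.inl (_, i) => i = 1 ∨ i = 3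
  | Sum.inr _ => False

/-- Two darts are related if they lie in the same connected component of the underlying plane graph,
where `edge` exchanges the two darts of each edge. -/
def componentSetoid {V B : Type} (edge : Dart V B → Dart V B) : Setoid (Dart V B) :=
  Relation.EqvGen.setoid (fun d e => e = rot d ∨ e = edge d)

/-- A diagram, on the oriented 2-sphere, of a link with at least one component.

The relation `region c d` says that the corners `c` and `d` lie in the same region (connected
component of the complement of the diagram) of the sphere. Corners that follow each other along the
boundary of a region are in the same region (`region_face`). As the diagram may be disconnected, a
region may have several boundary curves, so the regions are part of the data. That
the surface obtained by gluing in the regions is a sphere is the last two conditions: the surface is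
connected, and Euler's formula `#vertices - #edges + #regions = 1 + #components` holds; there are
`#Crossing + #Bead` vertices and `2 * #Crossing + #Bead` edges. -/
structure LinkDiagram : Type 1 where
  Crossing : Type
  Bead : Type
  finite_crossing : Finite Crossing
  finite_bead : Finite Bead
  nonempty : Nonempty (Dart Crossing Bead)
  edge : Dart Crossing Bead → Dart Crossing Bead
  edge_edge : ∀ d, edge (edge d) = d
  edge_ne : ∀ d, edge d ≠ d
  region : Setoid (Dart Crossing Bead)
  region_face : ∀ c, region c (edge (rot c))
  sphere_connected : ∀ c d, (componentSetoid edge ⊔ region) c d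
  euler : Nat.card (Quotient region) =
    Nat.card Crossing + Nat.card (Quotient (componentSetoid edge)) + 1

namespace LinkDiagram

/-- The darts of a diagram. -/
abbrev D (X : LinkDiagram) : Type := Dart X.Crossing X.Bead

/-- The `i`-th dart at the crossing `v`. -/
def cr (X : LinkDiagram) (v : X.Crossing) (i : ZMod 4) : X.D := Sum.inl (v, i)

/-- The `i`-th dart at the bead `b`. -/
def bd (X : LinkDiagram) (b : X.Bead) (i : ZMod 2) : X.D := Sum.inr (b, i)

/-- The number of crossings of a diagram. -/
noncomputable def numCrossings (X : LinkDiagram) : ℕ := Nat.card X.Crossing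

/-- The diagram is connected as a subset of the sphere. -/
def IsConnected (X : LinkDiagram) : Prop := ∀ d e : X.D, componentSetoid X.edge d e

/-- A diagram is reduced if it has no nugatory crossing, i.e. no crossing at which two opposite
corners belong to the same region. (Adjacent corners never do.) -/
def IsReduced (X : LinkDiagram) : Prop :=
  ∀ (v : X.Crossing) (i : ZMod 4), ¬ X.region (X.cr v i) (X.cr v (i + 2))

/-! ### Isotopy and Reidemeister moves -/

/-- Two diagrams that differ by an orientation-preserving homeomorphism of the sphere. -/
def Iso (X Y : LinkDiagram) : Prop :=
  ∃ f : X.D ≃ Y.D,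
    (∀ d, f (rot d) = rot (f d)) ∧
    (∀ d, f (X.edge d) = Y.edge (f d)) ∧
    (∀ d, IsOver d ↔ IsOver (f d)) ∧
    (∀ c d, X.region c d ↔ Y.region (f c) (f d))

/-- `Y` arises from `X` by a change inside a disc. Here `I` and `J` are the sets of darts of `X` and
`Y` at the vertices inside the disc, `f` identifies the darts at vertices outside, and the edges that
cross the boundary of the disc start, inside the disc, at the darts `p k` in `X` and at the darts
`q k` in `Y`. The relation `M` identifies the darts outside and the darts `p k` with `q k`; it has to
respect edges. The corners to the left of all these darts represent all the regions that are not
contained in the disc, and two of them are in the same region of `Y` if and only if they are related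
by `R`, which is a relation on the corners of `X` (in most cases `X.region`). -/
def LocalChange (X Y : LinkDiagram) (I : Set X.D) (J : Set Y.D) {n : ℕ}
    (p : Fin n → X.D) (q : Fin n → Y.D) (R : X.D → X.D → Prop) : Prop :=
  ∃ f : {d : X.D // d ∉ I} ≃ {d : Y.D // d ∉ J},
    (∀ d e, rot d.1 = e.1 → rot (f d).1 = (f e).1) ∧
    (∀ d, IsOver d.1 ↔ IsOver (f d).1) ∧
    ∃ M : X.D → Y.D → Prop,
      (∀ d e, M d e ↔ (∃ h : d ∉ I, (f ⟨d, h⟩).1 = e) ∨ ∃ k, p k = d ∧ q k = e) ∧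
      (∀ d e, M d e → M (X.edge d) (Y.edge e)) ∧
      (∀ c c₁ d d₁, M c c₁ → M d d₁ → (R c d ↔ Y.region c₁ d₁))

/-- `Y` arises from `X` by erasing a bead `b`, which is not the only vertex on a closed curve. The two
edges at `b` become a single edge `y, Y.edge y`. -/
def EraseBead (X Y : LinkDiagram) : Prop :=
  ∃ (b : X.Bead) (y : Y.D),
    X.edge (X.bd b 0) ≠ X.bd b 1 ∧
    LocalChange X Y {d | ∃ i, d = X.bd b i} ∅
      ![X.bd b 0, X.bd b 1] ![y, Y.edge y] X.region

/-- The first Reidemeister move, in the direction that removes a crossing: the crossing `v` is a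
corner of a region with a single edge (a loop with nothing else inside). The remaining two ends at
`v` are joined by an arc, which is marked by a bead `b`. -/
def Omega1Down (X Y : LinkDiagram) : Prop :=
  ∃ (v : X.Crossing) (i : ZMod 4) (b : Y.Bead),
    X.edge (X.cr v (i + 1)) = X.cr v i ∧
    (∀ d, X.region (X.cr v i) d → d = X.cr v i) ∧
    LocalChange X Y {d | ∃ j, d = X.cr v j} {d | ∃ j, d = Y.bd b j}
      ![X.cr v (i + 2), X.cr v (i + 3)] ![Y.bd b 0, Y.bd b 1] X.region

/-- The second Reidemeister move, in the direction that removes two crossings. The crossings `v ≠ w`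
are the corners of a bigonal region, and the two edges of this region are such that one of them
belongs to the over-strand at both crossings. The two strands through the bigon are
separated; afterwards they are marked by the beads `b ≠ c`, and the two regions opposite to the bigon
at `v` and at `w` have become one region. -/
def Omega2Down (X Y : LinkDiagram) : Prop :=
  ∃ (v w : X.Crossing) (i j : ZMod 4) (b c : Y.Bead),
    v ≠ w ∧ b ≠ c ∧
    X.edge (X.cr v (i + 1)) = X.cr w j ∧
    X.edge (X.cr w (j + 1)) = X.cr v i ∧
    (IsOver (X.cr v i) ↔ IsOver (X.cr w (j + 1))) ∧
    (∀ d, X.region (X.cr v i) d → d = X.cr v i ∨ d = X.cr w j) ∧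
    LocalChange X Y {d | ∃ k, d = X.cr v k ∨ d = X.cr w k} {d | ∃ k, d = Y.bd b k ∨ d = Y.bd c k}
      ![X.cr v (i + 2), X.cr w (j + 3), X.cr v (i + 3), X.cr w (j + 2)]
      ![Y.bd b 0, Y.bd b 1, Y.bd c 0, Y.bd c 1]
      (fun x y => X.region x y ∨
        (X.region x (X.cr v (i + 2)) ∧ X.region y (X.cr w (j + 2))) ∨
        (X.region x (X.cr w (j + 2)) ∧ X.region y (X.cr v (i + 2))))

/-- The distinct crossings `v 0, v 1, v 2` are the corners, in clockwise order, of a triangular region;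
the corner at `v k` is the one named by the dart `i k`. The three edges of the triangle belong to
three strands; the strand through `v 0` and `v 1` is the over-strand at both of them. -/
def IsOmega3Triangle (X : LinkDiagram) (v : ZMod 3 → X.Crossing) (i : ZMod 3 → ZMod 4) : Prop :=
  Function.Injective v ∧
  (∀ k, X.edge (X.cr (v k) (i k + 1)) = X.cr (v (k + 1)) (i (k + 1))) ∧
  (∀ k d, X.region (X.cr (v k) (i k)) d → ∃ l, d = X.cr (v l) (i l)) ∧
  IsOver (X.cr (v 0) (i 0 + 1)) ∧ IsOver (X.cr (v 1) (i 1))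

/-- The third Reidemeister move: each of the three strands is moved across the crossing of the other
two. The crossing `u k` of `Y` is the crossing of the two strands that met at `v k`. On each strand
the order of its two crossings is reversed: the end of the strand that was attached to
`v k` is attached to the crossing `u l` with the third strand. -/
def Omega3 (X Y : LinkDiagram) : Prop :=
  ∃ (v : ZMod 3 → X.Crossing) (i : ZMod 3 → ZMod 4)
    (u : ZMod 3 → Y.Crossing) (j : ZMod 3 → ZMod 4),
    X.IsOmega3Triangle v i ∧ Y.IsOmega3Triangle u j ∧
    (∀ k, IsOver (X.cr (v k) (i k)) ↔ IsOver (Y.cr (u k) (j k))) ∧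
    LocalChange X Y {d | ∃ k l, d = X.cr (v k) l} {d | ∃ k l, d = Y.cr (u k) l}
      ![X.cr (v 0) (i 0 + 2), X.cr (v 0) (i 0 + 3), X.cr (v 1) (i 1 + 2), X.cr (v 1) (i 1 + 3),
        X.cr (v 2) (i 2 + 2), X.cr (v 2) (i 2 + 3)]
      ![Y.cr (u 2) (j 2 + 3), Y.cr (u 1) (j 1 + 2), Y.cr (u 0) (j 0 + 3), Y.cr (u 2) (j 2 + 2),
        Y.cr (u 1) (j 1 + 3), Y.cr (u 0) (j 0 + 2)]
      X.region

/-- One step of an isotopy of the sphere. -/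
def IsotopyStep (X Y : LinkDiagram) : Prop := Iso X Y ∨ EraseBead X Y ∨ EraseBead Y X

/-- The diagrams are isotopic on the sphere. -/
def Isotopic : LinkDiagram → LinkDiagram → Prop := Relation.ReflTransGen IsotopyStep

/-- A step of an isotopy, or a Reidemeister move that does not increase the number of crossings. -/
def NonincreasingStep (X Y : LinkDiagram) : Prop :=
  IsotopyStep X Y ∨ Omega1Down X Y ∨ Omega2Down X Y ∨ Omega3 X Y

/-- The equivalence relation generated by isotopies and Reidemeister moves: two diagrams are related by
a finite sequence of isotopies and Reidemeister moves of all types, in all directions. -/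
instance linkSetoid : Setoid LinkDiagram := Relation.EqvGen.setoid NonincreasingStep

end LinkDiagram

/-- A link (type): a class of diagrams modulo isotopy and Reidemeister moves. -/
def Link : Type 1 := Quotient LinkDiagram.linkSetoid

namespace LinkDiagram

/-- The link represented by a diagram. -/
def link (X : LinkDiagram) : Link := Quotient.mk linkSetoid X

end LinkDiagram

namespace Link

/-- The crossing number `c(L)`: the least number of crossings of a diagram of `L`. -/
noncomputable def crossingNumber (L : Link) : ℕ :=
  sInf {n : ℕ | ∃ X : LinkDiagram, X.link = L ∧ X.numCrossings = n}

/-- A link is trivial (an unknot or an unlink) if it has a diagram without crossings. -/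
def IsTrivial (L : Link) : Prop := ∃ X : LinkDiagram, X.link = L ∧ X.numCrossings = 0

/-- A link is split if it has a disconnected diagram. -/
def IsSplit (L : Link) : Prop := ∃ X : LinkDiagram, X.link = L ∧ ¬ X.IsConnected

end Link

namespace LinkDiagram

/-- A diagram is minimal if it has the least number of crossings among all diagrams of its link. -/
def IsMinimal (X : LinkDiagram) : Prop := X.numCrossings = X.link.crossingNumber

/-- A hard diagram: a reduced diagram with more than `c(L)` crossings which cannot be transformed into
a minimal diagram of the same link by isotopies and Reidemeister moves none of which increases the
number of crossings. -/
def IsHard (X : LinkDiagram) : Prop :=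
  X.IsReduced ∧ X.link.crossingNumber < X.numCrossings ∧
  ∀ Y : LinkDiagram, Relation.ReflTransGen NonincreasingStep X Y →
    ¬ (Y.link = X.link ∧ Y.IsMinimal)

/-- A rigid hard diagram: a hard diagram on which, up to isotopy, no third Reidemeister move can be
performed. -/
def IsRigidHard (X : LinkDiagram) : Prop :=
  X.IsHard ∧ ∀ Y Z : LinkDiagram, Isotopic X Y → ¬ Omega3 Y Z

end LinkDiagram

end KnotTheory

/-! The idea is to replace every crossing of a diagram `X` of the link by a tangle with seven
crossings that represents a single crossing, but whose simplification must first pass through a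
diagram with more crossings.

A diagram is `Stuck` if no region with a crossing on its boundary has just one corner and if, along
the boundary of each region with two or three corners, every arc is over at one end and under at the
other. A first move that removes a crossing needs a region with one corner. A second move that
removes crossings, and any third move, needs a bigon or triangle with an edge that is over at both
ends or under at both ends. So a stuck diagram admits only isotopies among the nonincreasing steps,
and isotopies keep it stuck. Every diagram reachable from it has the same number of crossings
(`Stuck.of_nonincreasing`). A stuck, reduced diagram with more than `c(L)` crossings is therefore
rigid hard.

Inside `sevenTangle` the regions are three bigons with alternating edges and three quadrilaterals.
Of the four outer regions, the one labelled `0` receives one corner, the others three each. If every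
region of `X` has at least two corners and one of them is not the weak corner `k v` of its crossing,
then every region of the new diagram that comes from a region of `X` has at least `3 + 1` corners
(`stuck_insert_seven`). The result is reduced as soon as the corners `k v + 1` and `k v + 3` lie in
different regions of `X` (`isReduced_insert_seven`).

Such rotations `k` exist. At each crossing at most one pair of opposite corners shares a region,
since two closed curves on the sphere cannot cross exactly once (`not_region_opposite`). This leaves
two admissible values of `k v`, differing by `2`, and Hall's marriage theorem selects one of them at
every crossing so that no region consists of weak corners only (`exists_choice`).

It remains to find `X` with two corners in every region. For a link that is neither split nor
trivial, a minimal diagram without beads will do: a region with one corner would be a removable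
loop. This gives `7 * c(L)` crossings. For the other links no bound is required, and two preliminary
insertions of the same tangle produce a suitable `X` (`exists_hasTwoCorners`). -/

namespace KnotTheory

/-! ### Tangles and their substitution into plane graphs -/

/-- A connected tangle with ends labelled by `ZMod k` in counterclockwise order. The two darts of an
edge are exchanged by `edge`, where the ends count as darts. Corners carry a label: `Sum.inl e`
is the outer region between the ends `e` and `e + 1`, the other labels are the inner regions. -/
structure Tangle (k : ℕ) where
  n : ℕ
  m : ℕ
  r : ℕ
  edge : ZMod k ⊕ Dart (Fin n) (Fin m) → ZMod k ⊕ Dart (Fin n) (Fin m)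
  out : ZMod k → Dart (Fin n) (Fin m)
  lab : Dart (Fin n) (Fin m) → ZMod k ⊕ Fin r
  edge_edge : ∀ x, edge (edge x) = x
  edge_ne : ∀ x, edge x ≠ x
  edge_end : ∀ e, edge (Sum.inl e) = Sum.inr (out e)
  lab_out : ∀ e, lab (out e) = Sum.inl e
  lab_face : ∀ c d, edge (Sum.inr (rot c)) = Sum.inr d → lab d = lab c
  lab_face_end : ∀ c e, edge (Sum.inr (rot c)) = Sum.inl e → lab c = Sum.inl (e - 1)
  lab_surj : ∀ j, ∃ d, lab d = Sum.inr j
  connected : ∀ c d, Relation.EqvGen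
    (fun x y => y = rot x ∨ edge (Sum.inr x) = Sum.inr y) c d
  -- Euler's formula after the outside of the disc is collapsed to one vertex of valence `k`: there
  -- are `n + m + 1` vertices, `(4 * n + 2 * m + k) / 2` edges and `r + k` faces.
  euler : 2 * r + k = 2 * n + 2

namespace Tangle

abbrev D {k : ℕ} (A : Tangle k) : Type := Dart (Fin A.n) (Fin A.m)

end Tangle

/-- A sphere decomposed by a plane graph, at whose vertices (sites) tangles can be inserted. -/
structure Host where
  S : Type
  finite_site : Finite S
  val : S → ℕ
  val_ne : ∀ s, val s ≠ 0
  nonempty : Nonempty S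
  edge : (Σ s, ZMod (val s)) → Σ s, ZMod (val s)
  edge_edge : ∀ d, edge (edge d) = d
  edge_ne : ∀ d, edge d ≠ d
  region : Setoid (Σ s, ZMod (val s))
  region_face : ∀ s e, region ⟨s, e⟩ (edge ⟨s, e + 1⟩)
  comp : Setoid (Σ s, ZMod (val s))
  comp_eq : comp = Relation.EqvGen.setoid (fun c d => c.1 = d.1 ∨ d = edge c)
  sphere_connected : ∀ c d, (comp ⊔ region) c d
  -- Euler's formula times two, so that the number of darts stands for twice the number of edges.
  euler : 2 * Nat.card (Quotient region) + 2 * Nat.card S =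
    Nat.card (Σ s, ZMod (val s)) + 2 * Nat.card (Quotient comp) + 2

namespace Host

variable (H : Host)

/-- A choice of a tangle for every site. -/
abbrev Filling : Type := ∀ s : H.S, Tangle (H.val s)

variable {H} (T : H.Filling)

/-- The darts after inserting the tangles. -/
abbrev FD : Type := Dart (Σ s, Fin (T s).n) (Σ s, Fin (T s).m)

/-- The dart `d` of the tangle at the site `s`. -/
def put (s : H.S) : (T s).D → FD T
  | Sum.inl (v, i) => Sum.inl (⟨s, v⟩, i)
  | Sum.inr (b, i) => Sum.inr (⟨s, b⟩, i)

/-- The site of a dart. -/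
def site : FD T → H.S
  | Sum.inl (v, _) => v.1
  | Sum.inr (b, _) => b.1

/-- The position of a dart in the tangle at its site. -/
def loc : (x : FD T) → (T (site T x)).D
  | Sum.inl (v, i) => Sum.inl (v.2, i)
  | Sum.inr (b, i) => Sum.inr (b.2, i)

variable {T}

@[simp] lemma put_loc (x : FD T) : put T (site T x) (loc T x) = x := by
  rcases x with ⟨⟨s, v⟩, i⟩ | ⟨⟨s, v⟩, i⟩ <;> rfl

lemma exists_put (x : FD T) : ∃ s d, put T s d = x := ⟨_, _, put_loc x⟩

@[simp] lemma site_put (s : H.S) (d : (T s).D) : site T (put T s d) = s := by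
  rcases d with ⟨v, i⟩ | ⟨v, i⟩ <;> rfl

lemma put_injective (s : H.S) : Function.Injective (put T s) := by
  rintro (⟨v, i⟩ | ⟨v, i⟩) (⟨w, j⟩ | ⟨w, j⟩) h <;> simp_all [put]

lemma put_eq_put {s t : H.S} {d : (T s).D} {e : (T t).D} (h : put T s d = put T t e) :
    s = t ∧ HEq d e := by
  have h1 : s = t := by rw [← site_put (T := T) s d, h, site_put]
  subst h1
  exact ⟨rfl, heq_of_eq (put_injective s h)⟩

@[simp] lemma rot_put (s : H.S) (d : (T s).D) : rot (put T s d) = put T s (rot d) := by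
  rcases d with ⟨v, i⟩ | ⟨v, i⟩ <;> rfl

@[simp] lemma isOver_put (s : H.S) (d : (T s).D) : IsOver (put T s d) ↔ IsOver d := by
  rcases d with ⟨v, i⟩ | ⟨v, i⟩ <;> rfl

variable (T)

/-- The first dart on the far side of the end `x.2` of the tangle at `x.1`. -/
def far (x : Σ s, ZMod (H.val s)) : FD T := put T (H.edge x).1 ((T _).out (H.edge x).2)

/-- A dart or an end of the tangle at `s`, where an end stands for the dart on its far side. -/
def real (s : H.S) : ZMod (H.val s) ⊕ (T s).D → FD T :=
  Sum.elim (fun e => far T ⟨s, e⟩) (put T s)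

/-- The edges after inserting the tangles. -/
def fedge (x : FD T) : FD T := real T (site T x) ((T _).edge (Sum.inr (loc T x)))

/-- The label of the region of a corner after inserting the tangles. -/
def flab (x : FD T) : Quotient H.region ⊕ Σ s, Fin (T s).r :=
  Sum.map (fun e => Quotient.mk H.region ⟨site T x, e⟩) (fun j => ⟨site T x, j⟩)
    ((T _).lab (loc T x))

@[simp] lemma real_inr (s : H.S) (d : (T s).D) : real T s (Sum.inr d) = put T s d := rfl

@[simp] lemma fedge_put (s : H.S) (d : (T s).D) :
    fedge T (put T s d) = real T s ((T s).edge (Sum.inr d)) := by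
  rcases d with ⟨v, i⟩ | ⟨v, i⟩ <;> rfl

@[simp] lemma flab_put (s : H.S) (d : (T s).D) : flab T (put T s d) =
    Sum.map (fun e => Quotient.mk H.region ⟨s, e⟩) (fun j => ⟨s, j⟩) ((T s).lab d) := by
  rcases d with ⟨v, i⟩ | ⟨v, i⟩ <;> rfl

lemma edge_out (s : H.S) (e : ZMod (H.val s)) :
    (T s).edge (Sum.inr ((T s).out e)) = Sum.inl e := by
  rw [← (T s).edge_end, (T s).edge_edge]

lemma fedge_far (s : H.S) (e : ZMod (H.val s)) :
    fedge T (far T ⟨s, e⟩) = put T s ((T s).out e) := by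
  rw [far, fedge_put, edge_out]
  show far T (H.edge ⟨s, e⟩) = _
  rw [far, H.edge_edge]

lemma fedge_real (s : H.S) (x : ZMod (H.val s) ⊕ (T s).D) :
    fedge T (real T s x) = real T s ((T s).edge x) := by
  rcases x with e | d
  · rw [(T s).edge_end]; exact fedge_far T s e
  · exact fedge_put T s d

/-- Two ends of a tangle never lead to the same dart, because the label of `out e` recovers `e`. A
fixed dart would therefore force a fixed dart of `H.edge` or of the edge map of the tangle. -/
lemma real_edge_ne (s : H.S) (d : (T s).D) : real T s ((T s).edge (Sum.inr d)) ≠ put T s d := by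
  intro h
  rcases h' : (T s).edge (Sum.inr d) with e | d'
  · rw [h'] at h
    have hd : d = (T s).out e := by
      have := (T s).edge_edge (Sum.inr d)
      rw [h', (T s).edge_end] at this
      exact (Sum.inr.inj this).symm
    have h3 := H.edge_ne ⟨s, e⟩
    obtain ⟨h1, h2⟩ := put_eq_put (T := T)
      (show put T _ ((T _).out (H.edge ⟨s, e⟩).2) = put T s d from h)
    apply h3
    generalize hx : H.edge ⟨s, e⟩ = x at h1 h2
    obtain ⟨t, e'⟩ := x
    obtain rfl : t = s := h1
    have h4 := eq_of_heq h2
    rw [hd] at h4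
    have h5 := congrArg (T t).lab h4
    rw [(T t).lab_out, (T t).lab_out] at h5
    exact congrArg _ (Sum.inl.inj h5)
  · rw [h'] at h
    have := put_injective s h
    rw [this] at h'
    exact (T s).edge_ne _ h'

lemma fedge_fedge (x : FD T) : fedge T (fedge T x) = x := by
  obtain ⟨s, d, rfl⟩ := exists_put x
  rw [fedge_put, fedge_real, (T s).edge_edge, real_inr]

lemma fedge_ne (x : FD T) : fedge T x ≠ x := by
  obtain ⟨s, d, rfl⟩ := exists_put x
  rw [fedge_put]; exact real_edge_ne T s d

/-- Seen from the far side, the left of the edge at the end `e` is the region preceding `e`. This is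
the reason for the shift by one here and in `xlab`. -/
lemma flab_far (s : H.S) (e : ZMod (H.val s)) :
    flab T (far T ⟨s, e⟩) = Sum.inl (Quotient.mk H.region ⟨s, e - 1⟩) := by
  rw [far, flab_put, (T _).lab_out, Sum.map_inl]
  congr 1
  have := H.region_face s (e - 1)
  rw [sub_add_cancel] at this
  exact Quotient.sound (Setoid.symm' _ this)

lemma flab_face (x : FD T) : flab T x = flab T (fedge T (rot x)) := by
  obtain ⟨s, d, rfl⟩ := exists_put x
  rw [rot_put, fedge_put, flab_put]
  rcases h : (T s).edge (Sum.inr (rot d)) with e | d'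
  · rw [(T s).lab_face_end _ _ h]
    exact (flab_far T s e).symm
  · rw [real_inr, flab_put, (T s).lab_face _ _ h]

lemma flab_surjective : Function.Surjective (flab T) := by
  rintro (q | ⟨s, j⟩)
  · induction q using Quotient.inductionOn with
    | _ x =>
      refine ⟨put T x.1 ((T x.1).out x.2), ?_⟩
      rw [flab_put, (T x.1).lab_out, Sum.map_inl]
  · obtain ⟨d, hd⟩ := (T s).lab_surj j
    exact ⟨put T s d, by rw [flab_put, hd, Sum.map_inr]⟩

lemma comp_site (s : H.S) (c d : (T s).D) : componentSetoid (fedge T) (put T s c) (put T s d) := by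
  have h := (T s).connected c d
  show Relation.EqvGen _ _ _
  induction h with
  | rel x y h =>
    apply Relation.EqvGen.rel
    rcases h with h | h
    · left; rw [h, rot_put]
    · right; rw [fedge_put, h, real_inr]
  | refl x => exact Relation.EqvGen.refl _
  | symm x y _ ih => exact ih.symm
  | trans x y z _ _ h1 h2 => exact h1.trans _ _ _ h2

lemma comp_rel (x y : Σ s, ZMod (H.val s)) (h : H.comp x y) :
    componentSetoid (fedge T) (put T x.1 ((T x.1).out x.2)) (put T y.1 ((T y.1).out y.2)) := by
  rw [H.comp_eq] at h
  replace h : Relation.EqvGen _ x y := h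
  induction h with
  | rel x y h =>
    rcases h with h | h
    · obtain ⟨s, e⟩ := x
      obtain ⟨t, e'⟩ := y
      obtain rfl : s = t := h
      exact comp_site T s _ _
    · apply Relation.EqvGen.rel
      right
      rw [fedge_put, edge_out, h]
      rfl
  | refl x => exact Relation.EqvGen.refl _
  | symm x y _ ih => exact ih.symm
  | trans x y z _ _ h1 h2 => exact h1.trans _ _ _ h2

lemma comp_site_of_comp (x y : FD T) (h : componentSetoid (fedge T) x y) :
    H.comp ⟨site T x, 0⟩ ⟨site T y, 0⟩ := by
  replace h : Relation.EqvGen _ x y := h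
  induction h with
  | rel x y h =>
    rcases h with h | h
    · obtain ⟨s, d, rfl⟩ := exists_put x
      rw [h, rot_put, site_put, site_put]
    · obtain ⟨s, d, rfl⟩ := exists_put x
      rw [h, fedge_put, site_put]
      rcases (T s).edge (Sum.inr d) with e | d'
      · show H.comp _ ⟨site T (put T _ _), 0⟩
        rw [site_put, H.comp_eq]
        refine Relation.EqvGen.trans _ (⟨s, e⟩) _ (Relation.EqvGen.rel _ _ (Or.inl rfl)) ?_
        refine Relation.EqvGen.trans _ (H.edge ⟨s, e⟩) _ (Relation.EqvGen.rel _ _ (Or.inr rfl)) ?_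
        exact Relation.EqvGen.rel _ _ (Or.inl rfl)
      · rw [real_inr, site_put]
  | refl x => exact Setoid.refl' _ _
  | symm x y _ ih => exact Setoid.symm' _ ih
  | trans x y z _ _ h1 h2 => exact Setoid.trans' _ h1 h2

/-- Since every inserted tangle is connected, the components after the insertion are those of the
host. -/
lemma card_comp : Nat.card (Quotient (componentSetoid (fedge T))) = Nat.card (Quotient H.comp) := by
  apply Nat.card_congr
  refine ⟨Quotient.map' (fun x => ⟨site T x, 0⟩) (comp_site_of_comp T),
    Quotient.map' (fun x => put T x.1 ((T x.1).out x.2)) (comp_rel T), ?_, ?_⟩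
  · intro q
    induction q using Quotient.inductionOn' with
    | _ x =>
      obtain ⟨s, d, rfl⟩ := exists_put x
      apply Quotient.sound'
      have := comp_site T s ((T s).out 0) d
      dsimp only
      rw [site_put]
      exact this
  · intro q
    induction q using Quotient.inductionOn' with
    | _ x =>
      apply Quotient.sound'
      dsimp only
      rw [site_put, H.comp_eq]
      exact Relation.EqvGen.rel _ _ (Or.inl rfl)

/-- The regions after inserting the tangles. -/
abbrev fregion : Setoid (FD T) := Setoid.ker (flab T)

/-- Euler's formula of the host is added to those of all tangles. The ends, which are the darts of
the host, cancel. -/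
lemma euler_filling [Finite H.S] : Nat.card (Quotient (fregion T)) =
    Nat.card (Σ s, Fin (T s).n) + Nat.card (Quotient (componentSetoid (fedge T))) + 1 := by
  have : Fintype H.S := Fintype.ofFinite _
  have hz (s : H.S) : NeZero (H.val s) := ⟨H.val_ne s⟩
  have : Finite (Quotient H.region) := inferInstance
  have h1 : Nat.card (Quotient (fregion T)) = Nat.card (Quotient H.region) + ∑ s, (T s).r := by
    rw [Nat.card_congr (Setoid.quotientKerEquivOfSurjective _ (flab_surjective T)), Nat.card_sum,
      Nat.card_sigma]
    simp
  have h2 := H.euler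
  rw [h1, card_comp, Nat.card_sigma]
  rw [Nat.card_sigma] at h2
  simp only [Nat.card_eq_fintype_card, Fintype.card_fin, ZMod.card] at h2 ⊢
  have h3 : ∑ s, (2 * (T s).r + H.val s) = ∑ s, (2 * (T s).n + 2) :=
    Finset.sum_congr rfl fun s _ => (T s).euler
  simp only [Finset.sum_add_distrib, ← Finset.mul_sum, Finset.sum_const, Finset.card_univ,
    smul_eq_mul] at h3
  omega

lemma sphere_connected_filling (c d : FD T) : (componentSetoid (fedge T) ⊔ fregion T) c d := by
  obtain ⟨s, c, rfl⟩ := exists_put c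
  obtain ⟨t, d, rfl⟩ := exists_put d
  set G := componentSetoid (fedge T) ⊔ fregion T with hG
  have h1 : componentSetoid (fedge T) ≤ G := le_sup_left
  have h2 : fregion T ≤ G := le_sup_right
  have key : H.comp ⊔ H.region ≤ Setoid.comap (fun x => put T x.1 ((T x.1).out x.2)) G := by
    apply sup_le
    · intro x y h
      exact h1 (comp_rel T x y h)
    · intro x y h
      apply h2
      show flab T _ = flab T _
      rw [flab_put, flab_put, (T _).lab_out, (T _).lab_out, Sum.map_inl, Sum.map_inl]
      congr 1
      exact Quotient.sound h
  have h3 := key (H.sphere_connected ⟨s, 0⟩ ⟨t, 0⟩)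
  exact Setoid.trans' _ (h1 (comp_site T s c _)) (Setoid.trans' _ h3 (h1 (comp_site T t _ d)))

/-- The diagram that arises by inserting tangles at all sites. -/
def diagram : LinkDiagram where
  Crossing := Σ s, Fin (T s).n
  Bead := Σ s, Fin (T s).m
  finite_crossing := by have := H.finite_site; infer_instance
  finite_bead := by have := H.finite_site; infer_instance
  nonempty := H.nonempty.map fun s => put T s ((T s).out 0)
  edge := fedge T
  edge_edge := fedge_fedge T
  edge_ne := fedge_ne T
  region := fregion T
  region_face := flab_face T
  sphere_connected := sphere_connected_filling T
  euler := by have := H.finite_site; exact euler_filling T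

end Host


/-! ### Local changes of tangles and the local changes of diagrams that they induce -/

namespace Tangle

variable {k : ℕ}

/-- The label of the corner at a dart, or at the dart on the far side of an end. -/
def xlab (A : Tangle k) : ZMod k ⊕ A.D → ZMod k ⊕ Fin A.r :=
  Sum.elim (fun e => Sum.inl (e - 1)) A.lab

/-- A local change of tangles, where `mu` and `g` relate the darts outside `I` and `J` to each other
and `mu` is also defined at the darts of `I` where the interior is attached. -/
structure Change (A B : Tangle k) (I : A.D → Prop) (J : B.D → Prop)
    (mu : A.D → Option (ZMod k ⊕ B.D)) (g : B.D → Option A.D) : Prop where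
  out : ∀ d, ¬ I d → ∃ e, ¬ J e ∧ mu d = some (Sum.inr e) ∧ g e = some d
  inn : ∀ e, ¬ J e → ∃ d, ¬ I d ∧ mu d = some (Sum.inr e) ∧ g e = some d
  rot : ∀ d e, ¬ I d → mu d = some (Sum.inr e) → mu (rot d) = some (Sum.inr (rot e))
  isOver : ∀ d e, ¬ I d → mu d = some (Sum.inr e) → (IsOver d ↔ IsOver e)
  edge : ∀ d d' x, mu d = some x → A.edge (Sum.inr d) = Sum.inr d' → mu d' = some (B.edge x)
  edge_inl : ∀ d e x, mu d = some x → A.edge (Sum.inr d) = Sum.inl e → B.edge x = Sum.inl e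
  -- The first dart behind each end is preserved, so edges that join this tangle to another one, or
  -- to itself, are respected. The values of `mu` include ends because an erased bead may be
  -- adjacent to an end; its inward dart then corresponds to whatever lies on the far side.
  far : ∀ e, mu (A.out e) = some (Sum.inr (B.out e))

lemma Change.of_eq {A B : Tangle k} (h : A = B) : Change A B (fun _ => False) (fun _ => False)
    (fun d => some (Sum.inr (h ▸ d))) (fun d => some (h ▸ d)) := by
  subst h
  constructor
  case edge =>
    rintro d d' x h1 h2
    obtain rfl := Option.some.inj h1
    rw [h2]
  all_goals simp

/-- The labels are carried injectively along the change `mu`. -/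
def LabelEq (A B : Tangle k) (mu : A.D → Option (ZMod k ⊕ B.D)) (psi : Fin B.r → Fin A.r) : Prop :=
  Function.Injective psi ∧ ∀ d x, mu d = some x → A.lab d = Sum.map id psi (B.xlab x)

/-- The label `j` disappears, as its region is merged with the region labelled `a`; otherwise the
labels are carried injectively. -/
def LabelMerge (A B : Tangle k) (mu : A.D → Option (ZMod k ⊕ B.D)) (psi : Fin B.r → Fin A.r)
    (a : ZMod k ⊕ Fin A.r) (j : Fin A.r) : Prop :=
  Function.Injective psi ∧ a ≠ Sum.inr j ∧ ∀ d x, mu d = some x →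
    (A.lab d ≠ Sum.inr j ∧ A.lab d = Sum.map id psi (B.xlab x)) ∨
    (A.lab d = Sum.inr j ∧ Sum.map id psi (B.xlab x) = a)

lemma LabelEq.of_eq {A B : Tangle k} (h : A = B) :
    ∃ psi, LabelEq A B (fun d => some (Sum.inr (h ▸ d))) psi := by
  subst h
  exact ⟨id, Function.injective_id, by simp [xlab]⟩

end Tangle

lemma exists_equiv_of_partial {α β : Type*} {I : α → Prop} {J : β → Prop} {f : α → Option β}
    {g : β → Option α} (h1 : ∀ x, ¬ I x → ∃ y, ¬ J y ∧ f x = some y ∧ g y = some x)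
    (h2 : ∀ y, ¬ J y → ∃ x, ¬ I x ∧ f x = some y ∧ g y = some x) :
    ∃ e : {x // ¬ I x} ≃ {y // ¬ J y}, ∀ x, f x.1 = some (e x).1 := by
  choose u hu using h1
  choose v hv using h2
  refine ⟨⟨fun x => ⟨u x.1 x.2, (hu _ _).1⟩, fun y => ⟨v y.1 y.2, (hv _ _).1⟩, ?_, ?_⟩,
    fun x => (hu _ _).2.1⟩
  · intro x
    have a1 := (hu x.1 x.2).2.2
    have a2 := (hv _ (hu x.1 x.2).1).2.2
    exact Subtype.ext (Option.some.inj (a2.symm.trans a1))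
  · intro y
    have a1 := (hv y.1 y.2).2.1
    have a2 := (hu _ (hv y.1 y.2).1).2.1
    exact Subtype.ext (Option.some.inj (a2.symm.trans a1))

namespace Host

variable {H : Host} {T T' : H.Filling}

lemma flab_real (s : H.S) (x : ZMod (H.val s) ⊕ (T s).D) : flab T (real T s x) =
    Sum.map (fun e => Quotient.mk H.region ⟨s, e⟩) (fun j => ⟨s, j⟩) ((T s).xlab x) := by
  rcases x with e | d
  · exact flab_far T s e
  · exact flab_put T s d

section Family

variable {I : ∀ s, (T s).D → Prop} {J : ∀ s, (T' s).D → Prop}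
  {mu : ∀ s, (T s).D → Option (ZMod (H.val s) ⊕ (T' s).D)} {g : ∀ s, (T' s).D → Option (T s).D}

/-- The local changes at all sites, taken together. -/
def fmu (mu : ∀ s, (T s).D → Option (ZMod (H.val s) ⊕ (T' s).D)) (x : FD T) : Option (FD T') :=
  (mu (site T x) (loc T x)).map (real T' (site T x))

lemma fmu_put (s : H.S) (d : (T s).D) : fmu mu (put T s d) = (mu s d).map (real T' s) := by
  rcases d with ⟨v, i⟩ | ⟨v, i⟩ <;> rfl

/-- The inverses of the local changes at all sites, taken together. -/
def fg (g : ∀ s, (T' s).D → Option (T s).D) (y : FD T') : Option (FD T) :=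
  (g (site T' y) (loc T' y)).map (put T (site T' y))

lemma fg_put (s : H.S) (d : (T' s).D) : fg g (put T' s d) = (g s d).map (put T s) := by
  rcases d with ⟨v, i⟩ | ⟨v, i⟩ <;> rfl

/-- The interiors of the local changes at all sites, taken together. -/
def fset {T : H.Filling} (I : ∀ s, (T s).D → Prop) (x : FD T) : Prop := I (site T x) (loc T x)

/-- An edge inside a tangle is covered by the field `edge`. An edge that leaves its tangle runs
along a host edge common to both fillings, and the field `far` of the tangle at its other end
applies. -/
lemma fmu_edge (h : ∀ s, (T s).Change (T' s) (I s) (J s) (mu s) (g s)) (x : FD T) (y : FD T')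
    (hxy : fmu mu x = some y) : fmu mu (fedge T x) = some (fedge T' y) := by
  obtain ⟨s, d, rfl⟩ := exists_put x
  rw [fmu_put, Option.map_eq_some_iff] at hxy
  obtain ⟨z, hz, rfl⟩ := hxy
  rw [fedge_put, fedge_real]
  rcases hd : (T s).edge (Sum.inr d) with e | d'
  · rw [(h s).edge_inl d e z hz hd]
    show fmu mu (put T _ _) = some (put T' _ _)
    rw [fmu_put, (h _).far]
    rfl
  · rw [real_inr, fmu_put, (h s).edge d d' z hz hd]
    rfl

/-- The relation `M` of a local change is taken to be the graph of `fmu mu`. The hypotheses `hpq`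
and `hdom` say that, inside the disc, this graph consists exactly of the pairs of attaching darts.
-/
lemma localChange_of_family (h : ∀ s, (T s).Change (T' s) (I s) (J s) (mu s) (g s))
    {n : ℕ} {I' : Set (FD T)} {J' : Set (FD T')}
    {p : Fin n → FD T} {q : Fin n → FD T'} {R : FD T → FD T → Prop}
    (hI : ∀ s d, put T s d ∈ I' ↔ I s d) (hJ : ∀ s d, put T' s d ∈ J' ↔ J s d)
    (hpq : ∀ k, fmu mu (p k) = some (q k))
    (hdom : ∀ s d, mu s d ≠ none → ¬ I s d ∨ ∃ k, p k = put T s d)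
    (hR : ∀ c c₁ d d₁, fmu mu c = some c₁ → fmu mu d = some d₁ →
      (R c d ↔ flab T' c₁ = flab T' d₁)) :
    LinkDiagram.LocalChange (diagram T) (diagram T') I' J' p q R := by
  have h1 : ∀ x, ¬ x ∈ I' → ∃ y, ¬ y ∈ J' ∧ fmu mu x = some y ∧ fg g y = some x := by
    intro x hx
    obtain ⟨s, d, rfl⟩ := exists_put x
    rw [hI] at hx
    obtain ⟨e, he, h1, h2⟩ := (h s).out d hx
    exact ⟨put T' s e, by rwa [hJ], by rw [fmu_put, h1]; rfl, by rw [fg_put, h2]; rfl⟩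
  have h2 : ∀ y, ¬ y ∈ J' → ∃ x, ¬ x ∈ I' ∧ fmu mu x = some y ∧ fg g y = some x := by
    intro y hy
    obtain ⟨s, e, rfl⟩ := exists_put y
    rw [hJ] at hy
    obtain ⟨d, hd, h1, h2⟩ := (h s).inn e hy
    exact ⟨put T s d, by rwa [hI], by rw [fmu_put, h1]; rfl, by rw [fg_put, h2]; rfl⟩
  obtain ⟨f, hf⟩ := exists_equiv_of_partial h1 h2
  have hf' : ∀ s d (hd : ¬ put T s d ∈ I'), ∃ e, mu s d = some (Sum.inr e) ∧
      (f ⟨put T s d, hd⟩).1 = put T' s e := by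
    intro s d hd
    have h3 := hf ⟨put T s d, hd⟩
    rw [hI] at hd
    obtain ⟨e, he, h4, h5⟩ := (h s).out d hd
    refine ⟨e, h4, ?_⟩
    rw [fmu_put, h4] at h3
    exact (Option.some.inj h3).symm
  refine ⟨f, ?_, ?_, fun x y => fmu mu x = some y, ?_, ?_, ?_⟩
  · rintro ⟨x, hx⟩ ⟨y, hy⟩ hxy
    obtain ⟨s, d, rfl⟩ := exists_put x
    obtain ⟨e, he, h3⟩ := hf' s d hx
    refine (congrArg rot h3).trans ?_
    have h4 := (h s).rot d e (by rwa [← hI]) he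
    have h5 := hf ⟨y, hy⟩
    have h6 : y = put T s (rot d) := by rw [← rot_put]; exact hxy.symm
    have h7 : fmu mu y = some (put T' s (rot e)) := by
      rw [h6, fmu_put, h4]; rfl
    rw [rot_put]
    exact Option.some.inj (h7.symm.trans h5)
  · rintro ⟨x, hx⟩
    obtain ⟨s, d, rfl⟩ := exists_put x
    obtain ⟨e, he, h3⟩ := hf' s d hx
    refine Iff.trans ?_ (iff_of_eq (congrArg IsOver h3)).symm
    refine (isOver_put s d).trans (Iff.trans ?_ (isOver_put s e).symm)
    exact (h s).isOver d e (by rwa [← hI]) he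
  · intro x y
    constructor
    · intro hxy
      by_cases hx : x ∈ I'
      · right
        obtain ⟨s, d, rfl⟩ := exists_put x
        have h3 : mu s d ≠ none := by
          rw [fmu_put] at hxy
          intro h4
          rw [h4] at hxy
          cases hxy
        rcases hdom s d h3 with h4 | ⟨k, hk⟩
        · exact absurd ((hI s d).1 hx) h4
        · refine ⟨k, hk, ?_⟩
          have := hpq k
          rw [hk, hxy] at this
          exact (Option.some.inj this).symm
      · left
        exact ⟨hx, Option.some.inj ((hf ⟨x, hx⟩).symm.trans hxy)⟩
    · rintro (⟨hx, rfl⟩ | ⟨k, rfl, rfl⟩)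
      · exact hf ⟨x, hx⟩
      · exact hpq k
  · exact fmu_edge h
  · exact hR

/-- The maps `psi s` combine to an injection `P` from the region labels of the new filling to those
of the old one, and `P` carries the label of a corner to that of the corresponding corner. -/
lemma region_of_labelEq {psi : ∀ s, Fin (T' s).r → Fin (T s).r}
    (hl : ∀ s, (T s).LabelEq (T' s) (mu s) (psi s)) (c d : FD T) (c₁ d₁ : FD T')
    (hc : fmu mu c = some c₁) (hd : fmu mu d = some d₁) :
    flab T c = flab T d ↔ flab T' c₁ = flab T' d₁ := by
  let P : Quotient H.region ⊕ (Σ s, Fin (T' s).r) → Quotient H.region ⊕ (Σ s, Fin (T s).r) :=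
    Sum.map id (fun j => ⟨j.1, psi _ j.2⟩)
  have hP : Function.Injective P := by
    apply Sum.map_injective.2 ⟨Function.injective_id, ?_⟩
    rintro ⟨s, i⟩ ⟨t, j⟩ hij
    obtain rfl : s = t := congrArg Sigma.fst hij
    have := eq_of_heq (Sigma.mk.inj hij).2
    exact congrArg (Sigma.mk s) ((hl s).1 this)
  have key : ∀ x x₁, fmu mu x = some x₁ → flab T x = P (flab T' x₁) := by
    intro x x₁ hx
    obtain ⟨s, a, rfl⟩ := exists_put x
    rw [fmu_put, Option.map_eq_some_iff] at hx
    obtain ⟨z, hz, rfl⟩ := hx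
    rw [flab_put, flab_real, (hl s).2 a z hz]
    rcases (T' s).xlab z with e | j <;> rfl
  rw [key c c₁ hc, key d d₁ hd, hP.eq_iff]

end Family

section SingleSite

variable {s₀ : H.S} {I : (T s₀).D → Prop} {J : (T' s₀).D → Prop}
  {mu : (T s₀).D → Option (ZMod (H.val s₀) ⊕ (T' s₀).D)} {g : (T' s₀).D → Option (T s₀).D}

open Classical in
/-- The identity at all sites where two fillings agree. -/
noncomputable def idMu (T T' : H.Filling) (s : H.S) (d : (T s).D) :
    Option (ZMod (H.val s) ⊕ (T' s).D) :=
  if h : T s = T' s then some (Sum.inr (h ▸ d)) else none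

open Classical in
/-- The identity at all sites where two fillings agree. -/
noncomputable def idG (T T' : H.Filling) (s : H.S) (d : (T' s).D) : Option (T s).D :=
  if h : T s = T' s then some (h ▸ d) else none

open Classical in
lemma change_update (h : ∀ s ≠ s₀, T s = T' s) (h₀ : (T s₀).Change (T' s₀) I J mu g) (s : H.S) :
    (T s).Change (T' s) (Function.update (β := fun s => (T s).D → Prop) (fun _ _ => False) s₀ I s)
      (Function.update (β := fun s => (T' s).D → Prop) (fun _ _ => False) s₀ J s)
      (Function.update (idMu T T') s₀ mu s) (Function.update (idG T T') s₀ g s) := by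
  by_cases hs : s = s₀
  · subst hs
    simpa only [Function.update_self] using h₀
  · simp only [Function.update_of_ne hs]
    have h1 : idMu T T' s = fun d => some (Sum.inr (h s hs ▸ d)) := by
      funext d; rw [idMu, dif_pos (h s hs)]
    have h2 : idG T T' s = fun d => some (h s hs ▸ d) := by
      funext d; rw [idG, dif_pos (h s hs)]
    rw [h1, h2]
    exact Tangle.Change.of_eq (h s hs)

open Classical in
lemma labelEq_update (h : ∀ s ≠ s₀, T s = T' s) (s : H.S) (hs : s ≠ s₀) :
    ∃ psi, (T s).LabelEq (T' s) (Function.update (idMu T T') s₀ mu s) psi := by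
  have h1 : idMu T T' s = fun d => some (Sum.inr (h s hs ▸ d)) := by
    funext d; rw [idMu, dif_pos (h s hs)]
  rw [Function.update_of_ne hs, h1]
  exact Tangle.LabelEq.of_eq (h s hs)

open Classical in
/-- A local change of the tangle at a single site that does not merge regions. -/
lemma localChange_of_labelEq (h : ∀ s ≠ s₀, T s = T' s) (h₀ : (T s₀).Change (T' s₀) I J mu g)
    {psi} (hl : (T s₀).LabelEq (T' s₀) mu psi) {n : ℕ} {I' : Set (FD T)} {J' : Set (FD T')}
    {p : Fin n → (T s₀).D} {q : Fin n → ZMod (H.val s₀) ⊕ (T' s₀).D}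
    {p' : Fin n → FD T} {q' : Fin n → FD T'}
    (hp : ∀ k, p' k = put T s₀ (p k)) (hq : ∀ k, q' k = real T' s₀ (q k))
    (hI : ∀ x, x ∈ I' ↔ ∃ d, I d ∧ x = put T s₀ d) (hJ : ∀ x, x ∈ J' ↔ ∃ d, J d ∧ x = put T' s₀ d)
    (hpq : ∀ k, mu (p k) = some (q k))
    (hdom : ∀ d, mu d ≠ none → ¬ I d ∨ ∃ k, p k = d) :
    LinkDiagram.LocalChange (diagram T) (diagram T') I' J' p' q' (fun x y => fregion T x y) := by
  have hl' : ∀ s, ∃ psi, (T s).LabelEq (T' s) (Function.update (idMu T T') s₀ mu s) psi := by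
    intro s
    by_cases hs : s = s₀
    · subst hs
      exact ⟨psi, by simpa only [Function.update_self] using hl⟩
    · exact labelEq_update h s hs
  choose psi' hpsi using hl'
  refine localChange_of_family (fun s => change_update h h₀ s) ?_ ?_ ?_ ?_ ?_
  · intro s d
    rw [hI]
    by_cases hs : s = s₀
    · subst hs
      rw [Function.update_self]
      exact ⟨fun ⟨d', h1, h2⟩ => by rwa [put_injective s h2], fun h => ⟨d, h, rfl⟩⟩
    · rw [Function.update_of_ne hs]
      exact ⟨fun ⟨d', h1, h2⟩ => hs (put_eq_put h2).1, False.elim⟩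
  · intro s d
    rw [hJ]
    by_cases hs : s = s₀
    · subst hs
      rw [Function.update_self]
      exact ⟨fun ⟨d', h1, h2⟩ => by rwa [put_injective s h2], fun h => ⟨d, h, rfl⟩⟩
    · rw [Function.update_of_ne hs]
      exact ⟨fun ⟨d', h1, h2⟩ => hs (put_eq_put h2).1, False.elim⟩
  · intro k
    rw [hp, hq, fmu_put, Function.update_self, hpq]
    rfl
  · intro s d hd
    by_cases hs : s = s₀
    · subst hs
      rw [Function.update_self] at hd ⊢
      refine (hdom d hd).imp id ?_
      rintro ⟨k, rfl⟩
      exact ⟨k, hp k⟩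
    · left
      rw [Function.update_of_ne hs]
      exact not_false
  · exact fun c c₁ d d₁ => region_of_labelEq hpsi c d c₁ d₁

open Classical in
/-- A local change of the tangle at a single site that merges two regions. -/
lemma localChange_of_labelMerge (h : ∀ s ≠ s₀, T s = T' s) (h₀ : (T s₀).Change (T' s₀) I J mu g)
    {psi a j} (hl : (T s₀).LabelMerge (T' s₀) mu psi a j) {n : ℕ}
    {I' : Set (FD T)} {J' : Set (FD T')}
    {p : Fin n → (T s₀).D} {q : Fin n → ZMod (H.val s₀) ⊕ (T' s₀).D}
    {p' : Fin n → FD T} {q' : Fin n → FD T'}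
    (hp : ∀ k, p' k = put T s₀ (p k)) (hq : ∀ k, q' k = real T' s₀ (q k))
    (hI : ∀ x, x ∈ I' ↔ ∃ d, I d ∧ x = put T s₀ d) (hJ : ∀ x, x ∈ J' ↔ ∃ d, J d ∧ x = put T' s₀ d)
    (hpq : ∀ k, mu (p k) = some (q k))
    (hdom : ∀ d, mu d ≠ none → ¬ I d ∨ ∃ k, p k = d) {ca cj : (T s₀).D}
    (hca : (T s₀).lab ca = a) (hcj : (T s₀).lab cj = Sum.inr j) :
    LinkDiagram.LocalChange (diagram T) (diagram T') I' J' p' q' (fun x y => fregion T x y ∨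
      (fregion T x (put T s₀ ca) ∧ fregion T y (put T s₀ cj)) ∨
      (fregion T x (put T s₀ cj) ∧ fregion T y (put T s₀ ca))) := by
  have hl' : ∀ s, ∃ psi : Fin (T' s).r → Fin (T s).r, Function.Injective psi ∧
      ∀ d x, Function.update (idMu T T') s₀ mu s d = some x →
        let y := Sum.map (fun e => Quotient.mk H.region ⟨s, e⟩)
          (fun i => (⟨s, psi i⟩ : Σ s, Fin (T s).r)) ((T' s).xlab x)
        (flab T (put T s d) ≠ flab T (put T s₀ cj) ∧ flab T (put T s d) = y) ∨
        (flab T (put T s d) = flab T (put T s₀ cj) ∧ y = flab T (put T s₀ ca)) := by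
    intro s
    by_cases hs : s = s₀
    · subst hs
      refine ⟨psi, hl.1, ?_⟩
      intro d x hd
      rw [Function.update_self] at hd
      simp only [flab_put, hca, hcj]
      rcases hl.2.2 d x hd with ⟨h1, h2⟩ | ⟨h1, h2⟩
      · left
        constructor
        · intro h3
          apply h1
          rcases h4 : (T s).lab d with e | i
          · rw [h4] at h3; cases h3
          · rw [h4] at h3
            have := eq_of_heq (Sigma.mk.inj (Sum.inr.inj h3)).2
            rw [this]
        · rw [h2]
          rcases (T' s).xlab x with e | i <;> rfl
      · right
        rw [h1, ← h2]
        refine ⟨rfl, ?_⟩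
        rcases (T' s).xlab x with e | i <;> rfl
    · obtain ⟨psi, h1, h2⟩ := labelEq_update (mu := mu) h s hs
      refine ⟨psi, h1, ?_⟩
      intro d x hd
      left
      rw [flab_put, h2 d x hd, flab_put, hcj]
      rcases (T' s).xlab x with e | i
      · exact ⟨by rintro ⟨⟩, rfl⟩
      · exact ⟨fun h3 => hs (Sigma.mk.inj (Sum.inr.inj h3)).1, rfl⟩
  choose psi' hinj hpsi using hl'
  refine localChange_of_family (fun s => change_update h h₀ s) ?_ ?_ ?_ ?_ ?_
  · intro s d
    rw [hI]
    by_cases hs : s = s₀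
    · subst hs
      rw [Function.update_self]
      exact ⟨fun ⟨d', h1, h2⟩ => by rwa [put_injective s h2], fun h => ⟨d, h, rfl⟩⟩
    · rw [Function.update_of_ne hs]
      exact ⟨fun ⟨d', h1, h2⟩ => hs (put_eq_put h2).1, False.elim⟩
  · intro s d
    rw [hJ]
    by_cases hs : s = s₀
    · subst hs
      rw [Function.update_self]
      exact ⟨fun ⟨d', h1, h2⟩ => by rwa [put_injective s h2], fun h => ⟨d, h, rfl⟩⟩
    · rw [Function.update_of_ne hs]
      exact ⟨fun ⟨d', h1, h2⟩ => hs (put_eq_put h2).1, False.elim⟩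
  · intro k
    rw [hp, hq, fmu_put, Function.update_self, hpq]
    rfl
  · intro s d hd
    by_cases hs : s = s₀
    · subst hs
      rw [Function.update_self] at hd ⊢
      refine (hdom d hd).imp id ?_
      rintro ⟨k, rfl⟩
      exact ⟨k, hp k⟩
    · left
      rw [Function.update_of_ne hs]
      exact not_false
  · let P : Quotient H.region ⊕ (Σ s, Fin (T' s).r) → Quotient H.region ⊕ (Σ s, Fin (T s).r) :=
      Sum.map id (fun j => ⟨j.1, psi' _ j.2⟩)
    have hP : Function.Injective P := by
      apply Sum.map_injective.2 ⟨Function.injective_id, ?_⟩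
      rintro ⟨s, i⟩ ⟨t, j⟩ hij
      obtain rfl : s = t := congrArg Sigma.fst hij
      have := eq_of_heq (Sigma.mk.inj hij).2
      exact congrArg (Sigma.mk s) (hinj s this)
    have key : ∀ x x₁, fmu (Function.update (idMu T T') s₀ mu) x = some x₁ →
        (flab T x ≠ flab T (put T s₀ cj) ∧ flab T x = P (flab T' x₁)) ∨
        (flab T x = flab T (put T s₀ cj) ∧ P (flab T' x₁) = flab T (put T s₀ ca)) := by
      intro x x₁ hx
      obtain ⟨s, b, rfl⟩ := exists_put x
      rw [fmu_put, Option.map_eq_some_iff] at hx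
      obtain ⟨z, hz, rfl⟩ := hx
      have h1 : P (flab T' (real T' s z)) = Sum.map (fun e => Quotient.mk H.region ⟨s, e⟩)
          (fun i => (⟨s, psi' s i⟩ : Σ s, Fin (T s).r)) ((T' s).xlab z) := by
        rw [flab_real]
        rcases (T' s).xlab z with e | i <;> rfl
      rw [h1]
      exact hpsi s b z hz
    intro c c₁ d d₁ hc hd
    simp only [Setoid.ker_def]
    rw [← hP.eq_iff]
    -- Four cases, according to which of the two corners lie in the region of `cj`; after the change
    -- such corners belong to the region of `ca`.
    rcases key c c₁ hc with ⟨h1, h2⟩ | ⟨h1, h2⟩ <;> rcases key d d₁ hd with ⟨h3, h4⟩ | ⟨h3, h4⟩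
    · rw [← h2, ← h4]; tauto
    · rw [h4, ← h2, h3]; tauto
    · rw [h2, ← h4, h1]
      constructor
      · rintro (h5 | ⟨h5, h6⟩ | ⟨-, h6⟩)
        · exact absurd h5.symm h3
        · exact absurd h6 h3
        · exact h6.symm
      · intro h5
        exact Or.inr (Or.inr ⟨rfl, h5.symm⟩)
    · rw [h2, h4, h1, h3]; tauto

end SingleSite

end Host


/-! ### Reidemeister moves of tangles and invariance of the link under them -/

namespace Tangle

variable {k : ℕ}

/-- The dart at the `i`-th position of the crossing `v`. -/
def cr (A : Tangle k) (v : Fin A.n) (i : ZMod 4) : A.D := Sum.inl (v, i)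

/-- The `i`-th dart at the bead `b`. -/
def bd (A : Tangle k) (b : Fin A.m) (i : ZMod 2) : A.D := Sum.inr (b, i)

/-- Erasing a bead of a tangle. -/
def EraseBead (A B : Tangle k) : Prop :=
  ∃ (b : Fin A.m) (i : ZMod 2) (mu : A.D → Option (ZMod k ⊕ B.D))
    (g : B.D → Option A.D) (psi : Fin B.r → Fin A.r),
    (A.edge (Sum.inr (A.bd b i))).isRight = true ∧
    A.edge (Sum.inr (A.bd b i)) ≠ Sum.inr (A.bd b (i + 1)) ∧
    Change A B (fun d => ∃ i, d = A.bd b i) (fun _ => False) mu g ∧ LabelEq A B mu psi ∧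
    mu (A.bd b 0) ≠ none ∧ mu (A.bd b 1) = (mu (A.bd b 0)).map B.edge

/-- The first Reidemeister move of a tangle. -/
def Omega1 (A B : Tangle k) : Prop :=
  ∃ (v : Fin A.n) (i : ZMod 4) (b : Fin B.m) (mu : A.D → Option (ZMod k ⊕ B.D))
    (g : B.D → Option A.D) (psi : Fin B.r → Fin A.r) (l : Fin A.r),
    A.edge (Sum.inr (A.cr v (i + 1))) = Sum.inr (A.cr v i) ∧
    A.lab (A.cr v i) = Sum.inr l ∧ (∀ d, A.lab d = Sum.inr l → d = A.cr v i) ∧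
    Change A B (fun d => ∃ j, d = A.cr v j) (fun d => ∃ j, d = B.bd b j) mu g ∧
    LabelEq A B mu psi ∧
    mu (A.cr v i) = none ∧ mu (A.cr v (i + 1)) = none ∧
    mu (A.cr v (i + 2)) = some (Sum.inr (B.bd b 0)) ∧
    mu (A.cr v (i + 3)) = some (Sum.inr (B.bd b 1))

/-- The second Reidemeister move of a tangle. -/
def Omega2 (A B : Tangle k) : Prop :=
  ∃ (v w : Fin A.n) (i j : ZMod 4) (b c : Fin B.m) (mu : A.D → Option (ZMod k ⊕ B.D))
    (g : B.D → Option A.D) (psi : Fin B.r → Fin A.r) (l l' : Fin A.r),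
    v ≠ w ∧ b ≠ c ∧
    A.edge (Sum.inr (A.cr v (i + 1))) = Sum.inr (A.cr w j) ∧
    A.edge (Sum.inr (A.cr w (j + 1))) = Sum.inr (A.cr v i) ∧
    (IsOver (A.cr v i) ↔ IsOver (A.cr w (j + 1))) ∧
    A.lab (A.cr v i) = Sum.inr l ∧ (∀ d, A.lab d = Sum.inr l → d = A.cr v i ∨ d = A.cr w j) ∧
    A.lab (A.cr w (j + 2)) = Sum.inr l' ∧
    Change A B (fun d => ∃ k, d = A.cr v k ∨ d = A.cr w k)
      (fun d => ∃ k, d = B.bd b k ∨ d = B.bd c k) mu g ∧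
    LabelMerge A B mu psi (A.lab (A.cr v (i + 2))) l' ∧
    mu (A.cr v i) = none ∧ mu (A.cr v (i + 1)) = none ∧
    mu (A.cr w j) = none ∧ mu (A.cr w (j + 1)) = none ∧
    mu (A.cr v (i + 2)) = some (Sum.inr (B.bd b 0)) ∧
    mu (A.cr w (j + 3)) = some (Sum.inr (B.bd b 1)) ∧
    mu (A.cr v (i + 3)) = some (Sum.inr (B.bd c 0)) ∧
    mu (A.cr w (j + 2)) = some (Sum.inr (B.bd c 1))

/-- A triangle at which a third Reidemeister move can be performed. -/
def Triangle (A : Tangle k) (v : ZMod 3 → Fin A.n) (i : ZMod 3 → ZMod 4) (l : Fin A.r) : Prop :=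
  Function.Injective v ∧
  (∀ k, A.edge (Sum.inr (A.cr (v k) (i k + 1))) = Sum.inr (A.cr (v (k + 1)) (i (k + 1)))) ∧
  (∀ k, A.lab (A.cr (v k) (i k)) = Sum.inr l) ∧
  (∀ d, A.lab d = Sum.inr l → ∃ k, d = A.cr (v k) (i k)) ∧
  IsOver (A.cr (v 0) (i 0 + 1)) ∧ IsOver (A.cr (v 1) (i 1))

/-- The third Reidemeister move of a tangle. -/
def Omega3 (A B : Tangle k) : Prop :=
  ∃ (v : ZMod 3 → Fin A.n) (i : ZMod 3 → ZMod 4) (u : ZMod 3 → Fin B.n) (j : ZMod 3 → ZMod 4)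
    (mu : A.D → Option (ZMod k ⊕ B.D)) (g : B.D → Option A.D) (psi : Fin B.r → Fin A.r)
    (l : Fin A.r) (l' : Fin B.r),
    A.Triangle v i l ∧ B.Triangle u j l' ∧
    (∀ k, IsOver (A.cr (v k) (i k)) ↔ IsOver (B.cr (u k) (j k))) ∧
    Change A B (fun d => ∃ k l, d = A.cr (v k) l) (fun d => ∃ k l, d = B.cr (u k) l) mu g ∧
    LabelEq A B mu psi ∧
    (∀ k, mu (A.cr (v k) (i k)) = none ∧ mu (A.cr (v k) (i k + 1)) = none) ∧
    mu (A.cr (v 0) (i 0 + 2)) = some (Sum.inr (B.cr (u 2) (j 2 + 3))) ∧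
    mu (A.cr (v 0) (i 0 + 3)) = some (Sum.inr (B.cr (u 1) (j 1 + 2))) ∧
    mu (A.cr (v 1) (i 1 + 2)) = some (Sum.inr (B.cr (u 0) (j 0 + 3))) ∧
    mu (A.cr (v 1) (i 1 + 3)) = some (Sum.inr (B.cr (u 2) (j 2 + 2))) ∧
    mu (A.cr (v 2) (i 2 + 2)) = some (Sum.inr (B.cr (u 1) (j 1 + 3))) ∧
    mu (A.cr (v 2) (i 2 + 3)) = some (Sum.inr (B.cr (u 0) (j 0 + 2)))

/-- A move of a tangle that corresponds to a nonincreasing move of diagrams. -/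
def Move (A B : Tangle k) : Prop := EraseBead A B ∨ Omega1 A B ∨ Omega2 A B ∨ Omega3 A B

/-- The equivalence relation generated by the moves. -/
def Equivalent : Tangle k → Tangle k → Prop := Relation.EqvGen Move

end Tangle

lemma zmod_four_eq (i j : ZMod 4) : j = i ∨ j = i + 1 ∨ j = i + 2 ∨ j = i + 3 := by
  revert i j; decide

lemma zmod_three_eq (i : ZMod 3) : i = 0 ∨ i = 1 ∨ i = 2 := by revert i; decide

lemma zmod_two_eq (i : ZMod 2) : i = 0 ∨ i = 1 := by revert i; decide

lemma zmod_two_eq' (i j : ZMod 2) : j = i ∨ j = i + 1 := by revert i j; decide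

namespace Host

variable {H : Host} {T T' : H.Filling} {s₀ : H.S}

/-- An inner region never leaves its tangle. Hence the requirement of a move that a region has no
further corners can be checked inside the tangle. -/
lemma flab_eq_inr {s : H.S} {d : (T s).D} {l : Fin (T s).r} (h : (T s).lab d = Sum.inr l)
    {x : FD T} (hx : flab T (put T s d) = flab T x) :
    ∃ d', (T s).lab d' = Sum.inr l ∧ x = put T s d' := by
  obtain ⟨t, d', rfl⟩ := exists_put x
  rw [flab_put, flab_put, h] at hx
  rcases h' : (T t).lab d' with e | j
  · rw [h'] at hx; cases hx
  · rw [h'] at hx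
    have h1 := Sum.inr.inj hx
    obtain rfl : s = t := congrArg Sigma.fst h1
    exact ⟨d', by rw [h', eq_of_heq (Sigma.mk.inj h1).2], rfl⟩

lemma flab_put_eq {s : H.S} {d e : (T s).D} (h : (T s).lab d = (T s).lab e) :
    flab T (put T s d) = flab T (put T s e) := by
  rw [flab_put, flab_put, h]

lemma fedge_put_inr {s : H.S} {d e : (T s).D} (h : (T s).edge (Sum.inr d) = Sum.inr e) :
    fedge T (put T s d) = put T s e := by
  rw [fedge_put, h, real_inr]

/-- One of the two edges at the bead has to stay inside the tangle and avoid the bead. If both led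
to ends, the arc could close up outside with the bead as its only vertex. -/
lemma eraseBead_filling (h : ∀ s ≠ s₀, T s = T' s) (h₀ : (T s₀).EraseBead (T' s₀)) :
    LinkDiagram.EraseBead (diagram T) (diagram T') := by
  obtain ⟨b, i, mu, g, psi, h1, h2, hc, hl, h3, h4⟩ := h₀
  obtain ⟨d, h1⟩ := Sum.isRight_iff.1 h1
  obtain ⟨y, h3⟩ := Option.ne_none_iff_exists'.1 h3
  rw [h3, Option.map_some] at h4
  refine ⟨⟨s₀, b⟩, real T' s₀ y, ?_, ?_⟩
  · intro h5
    have h6 : ∀ j : ZMod 2,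
        fedge T (put T s₀ (Sum.inr (b, j))) = put T s₀ (Sum.inr (b, j + 1)) := by
      intro j
      rcases zmod_two_eq j with rfl | rfl
      · exact h5
      · exact (congrArg (fedge T) h5).symm.trans (fedge_fedge T _)
    have h7 := h6 i
    rw [show (Sum.inr (b, i) : (T s₀).D) = (T s₀).bd b i from rfl, fedge_put_inr h1] at h7
    exact h2 (h1.trans (congrArg Sum.inr (put_injective s₀ h7)))
  · refine localChange_of_labelEq h hc hl (p := ![(T s₀).bd b 0, (T s₀).bd b 1])
      (q := ![y, (T' s₀).edge y]) ?_ ?_ ?_ ?_ ?_ ?_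
    · intro k; fin_cases k <;> rfl
    · intro k; fin_cases k
      · rfl
      · exact fedge_real T' s₀ y
    · intro x
      constructor
      · rintro ⟨j, rfl⟩; exact ⟨_, ⟨j, rfl⟩, rfl⟩
      · rintro ⟨_, ⟨j, rfl⟩, rfl⟩; exact ⟨j, rfl⟩
    · intro x
      constructor
      · exact False.elim
      · rintro ⟨_, h, -⟩; exact h
    · intro k; fin_cases k
      · exact h3
      · exact h4
    · intro d _
      by_cases hd : ∃ i, d = (T s₀).bd b i
      · right
        obtain ⟨j, rfl⟩ := hd
        rcases zmod_two_eq j with rfl | rfl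
        · exact ⟨0, rfl⟩
        · exact ⟨1, rfl⟩
      · exact Or.inl hd

lemma omega1_filling (h : ∀ s ≠ s₀, T s = T' s) (h₀ : (T s₀).Omega1 (T' s₀)) :
    LinkDiagram.Omega1Down (diagram T) (diagram T') := by
  obtain ⟨v, i, b, mu, g, psi, l, h1, h2, h3, hc, hl, h4, h5, h6, h7⟩ := h₀
  refine ⟨⟨s₀, v⟩, i, ⟨s₀, b⟩, fedge_put_inr h1, ?_, ?_⟩
  · intro d hd
    obtain ⟨d', h8, rfl⟩ := flab_eq_inr h2 hd
    rw [h3 d' h8]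
    rfl
  · refine localChange_of_labelEq h hc hl (p := ![(T s₀).cr v (i + 2), (T s₀).cr v (i + 3)])
      (q := ![Sum.inr ((T' s₀).bd b 0), Sum.inr ((T' s₀).bd b 1)]) ?_ ?_ ?_ ?_ ?_ ?_
    · intro k; fin_cases k <;> rfl
    · intro k; fin_cases k <;> rfl
    · intro x
      constructor
      · rintro ⟨j, rfl⟩; exact ⟨_, ⟨j, rfl⟩, rfl⟩
      · rintro ⟨_, ⟨j, rfl⟩, rfl⟩; exact ⟨j, rfl⟩
    · intro x
      constructor
      · rintro ⟨j, rfl⟩; exact ⟨_, ⟨j, rfl⟩, rfl⟩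
      · rintro ⟨_, ⟨j, rfl⟩, rfl⟩; exact ⟨j, rfl⟩
    · intro k; fin_cases k
      · exact h6
      · exact h7
    · intro d hd0
      by_cases hd : ∃ j, d = (T s₀).cr v j
      · right
        obtain ⟨j, rfl⟩ := hd
        rcases zmod_four_eq i j with rfl | rfl | rfl | rfl
        · exact absurd h4 hd0
        · exact absurd h5 hd0
        · exact ⟨0, rfl⟩
        · exact ⟨1, rfl⟩
      · exact Or.inl hd

lemma omega2_filling (h : ∀ s ≠ s₀, T s = T' s) (h₀ : (T s₀).Omega2 (T' s₀)) :
    LinkDiagram.Omega2Down (diagram T) (diagram T') := by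
  obtain ⟨v, w, i, j, b, c, mu, g, psi, l, l', hvw, hbc, h1, h2, h3, h4, h5, h6, hc, hl,
    n1, n2, n3, n4, m1, m2, m3, m4⟩ := h₀
  refine ⟨⟨s₀, v⟩, ⟨s₀, w⟩, i, j, ⟨s₀, b⟩, ⟨s₀, c⟩, ?_, ?_, fedge_put_inr h1, fedge_put_inr h2,
    h3, ?_, ?_⟩
  · intro h; exact hvw (eq_of_heq (Sigma.mk.inj h).2)
  · intro h; exact hbc (eq_of_heq (Sigma.mk.inj h).2)
  · intro d hd
    obtain ⟨d', h8, rfl⟩ := flab_eq_inr h4 hd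
    exact (h5 d' h8).imp (fun h => by rw [h]; rfl) (fun h => by rw [h]; rfl)
  · refine localChange_of_labelMerge h hc hl
      (p := ![(T s₀).cr v (i + 2), (T s₀).cr w (j + 3), (T s₀).cr v (i + 3), (T s₀).cr w (j + 2)])
      (q := ![Sum.inr ((T' s₀).bd b 0), Sum.inr ((T' s₀).bd b 1), Sum.inr ((T' s₀).bd c 0),
        Sum.inr ((T' s₀).bd c 1)]) ?_ ?_ ?_ ?_ ?_ ?_ rfl h6
    · intro k; fin_cases k <;> rfl
    · intro k; fin_cases k <;> rfl
    · intro x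
      constructor
      · rintro ⟨j, rfl | rfl⟩
        · exact ⟨_, ⟨j, Or.inl rfl⟩, rfl⟩
        · exact ⟨_, ⟨j, Or.inr rfl⟩, rfl⟩
      · rintro ⟨_, ⟨j, rfl | rfl⟩, rfl⟩
        · exact ⟨j, Or.inl rfl⟩
        · exact ⟨j, Or.inr rfl⟩
    · intro x
      constructor
      · rintro ⟨j, rfl | rfl⟩
        · exact ⟨_, ⟨j, Or.inl rfl⟩, rfl⟩
        · exact ⟨_, ⟨j, Or.inr rfl⟩, rfl⟩
      · rintro ⟨_, ⟨j, rfl | rfl⟩, rfl⟩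
        · exact ⟨j, Or.inl rfl⟩
        · exact ⟨j, Or.inr rfl⟩
    · intro k; fin_cases k
      · exact m1
      · exact m2
      · exact m3
      · exact m4
    · intro d hd0
      by_cases hd : ∃ k, d = (T s₀).cr v k ∨ d = (T s₀).cr w k
      · right
        obtain ⟨x, rfl | rfl⟩ := hd
        · rcases zmod_four_eq i x with rfl | rfl | rfl | rfl
          · exact absurd n1 hd0
          · exact absurd n2 hd0
          · exact ⟨0, rfl⟩
          · exact ⟨2, rfl⟩
        · rcases zmod_four_eq j x with rfl | rfl | rfl | rfl
          · exact absurd n3 hd0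
          · exact absurd n4 hd0
          · exact ⟨3, rfl⟩
          · exact ⟨1, rfl⟩
      · exact Or.inl hd

lemma triangle_filling {s : H.S} {v : ZMod 3 → Fin (T s).n} {i : ZMod 3 → ZMod 4} {l : Fin (T s).r}
    (h : (T s).Triangle v i l) : (diagram T).IsOmega3Triangle (fun k => ⟨s, v k⟩) i := by
  obtain ⟨h1, h2, h3, h4, h5, h6⟩ := h
  refine ⟨fun a b hab => h1 (eq_of_heq (Sigma.mk.inj hab).2), fun k => fedge_put_inr (h2 k), ?_,
    h5, h6⟩
  intro k d hd
  obtain ⟨d', h8, rfl⟩ := flab_eq_inr (h3 k) hd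
  obtain ⟨m, rfl⟩ := h4 d' h8
  exact ⟨m, rfl⟩

lemma omega3_filling (h : ∀ s ≠ s₀, T s = T' s) (h₀ : (T s₀).Omega3 (T' s₀)) :
    LinkDiagram.Omega3 (diagram T) (diagram T') := by
  obtain ⟨v, i, u, j, mu, g, psi, l, l', t1, t2, ho, hc, hl, hn, m1, m2, m3, m4, m5, m6⟩ := h₀
  refine ⟨fun k => ⟨s₀, v k⟩, i, fun k => ⟨s₀, u k⟩, j, triangle_filling t1, triangle_filling t2,
    ho, ?_⟩
  refine localChange_of_labelEq h hc hl
      (p := ![(T s₀).cr (v 0) (i 0 + 2), (T s₀).cr (v 0) (i 0 + 3), (T s₀).cr (v 1) (i 1 + 2),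
        (T s₀).cr (v 1) (i 1 + 3), (T s₀).cr (v 2) (i 2 + 2), (T s₀).cr (v 2) (i 2 + 3)])
      (q := ![Sum.inr ((T' s₀).cr (u 2) (j 2 + 3)), Sum.inr ((T' s₀).cr (u 1) (j 1 + 2)),
        Sum.inr ((T' s₀).cr (u 0) (j 0 + 3)), Sum.inr ((T' s₀).cr (u 2) (j 2 + 2)),
        Sum.inr ((T' s₀).cr (u 1) (j 1 + 3)), Sum.inr ((T' s₀).cr (u 0) (j 0 + 2))])
      ?_ ?_ ?_ ?_ ?_ ?_
  · intro k; fin_cases k <;> rfl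
  · intro k; fin_cases k <;> rfl
  · intro x
    constructor
    · rintro ⟨a, b, rfl⟩; exact ⟨_, ⟨a, b, rfl⟩, rfl⟩
    · rintro ⟨_, ⟨a, b, rfl⟩, rfl⟩; exact ⟨a, b, rfl⟩
  · intro x
    constructor
    · rintro ⟨a, b, rfl⟩; exact ⟨_, ⟨a, b, rfl⟩, rfl⟩
    · rintro ⟨_, ⟨a, b, rfl⟩, rfl⟩; exact ⟨a, b, rfl⟩
  · intro k; fin_cases k <;> assumption
  · intro d hd0
    by_cases hd : ∃ k l, d = (T s₀).cr (v k) l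
    · right
      obtain ⟨a, b, rfl⟩ := hd
      rcases zmod_four_eq (i a) b with rfl | rfl | rfl | rfl
      · exact absurd (hn a).1 hd0
      · exact absurd (hn a).2 hd0
      · have := zmod_three_eq a
        rcases this with rfl | rfl | rfl
        exacts [⟨0, rfl⟩, ⟨2, rfl⟩, ⟨4, rfl⟩]
      · have := zmod_three_eq a
        rcases this with rfl | rfl | rfl
        exacts [⟨1, rfl⟩, ⟨3, rfl⟩, ⟨5, rfl⟩]
    · exact Or.inl hd

lemma link_eq_of_move (h : ∀ s ≠ s₀, T s = T' s) (h₀ : (T s₀).Move (T' s₀)) :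
    (diagram T).link = (diagram T').link := by
  apply Quotient.sound
  apply Relation.EqvGen.rel
  rcases h₀ with h₀ | h₀ | h₀ | h₀
  · exact Or.inl (Or.inr (Or.inl (eraseBead_filling h h₀)))
  · exact Or.inr (Or.inl (omega1_filling h h₀))
  · exact Or.inr (Or.inr (Or.inl (omega2_filling h h₀)))
  · exact Or.inr (Or.inr (Or.inr (omega3_filling h h₀)))

open Classical in
lemma link_eq_update (T : H.Filling) {A B : Tangle (H.val s₀)} (h : A.Equivalent B) :
    (diagram (Function.update T s₀ A)).link = (diagram (Function.update T s₀ B)).link := by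
  induction h with
  | rel A B h =>
    apply link_eq_of_move (s₀ := s₀)
    · intro s hs
      rw [Function.update_of_ne hs, Function.update_of_ne hs]
    · rwa [Function.update_self, Function.update_self]
  | refl A => rfl
  | symm A B _ ih => exact ih.symm
  | trans A B C _ _ h1 h2 => exact h1.trans h2

open Classical in
/-- Replacing tangles by equivalent tangles does not change the link. -/
theorem link_eq_of_equivalent (h : ∀ s, (T s).Equivalent (T' s)) :
    (diagram T).link = (diagram T').link := by
  have := H.finite_site
  have : Fintype H.S := Fintype.ofFinite _
  -- The tangles are exchanged one site at a time.
  have key : ∀ F : Finset H.S,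
      (diagram (fun s => if s ∈ F then T' s else T s)).link = (diagram T).link := by
    intro F
    induction F using Finset.induction_on with
    | empty => simp
    | insert a F ha ih =>
      rw [← ih]
      have h1 : (fun s => if s ∈ insert a F then T' s else T s) =
          Function.update (fun s => if s ∈ F then T' s else T s) a (T' a) := by
        funext s
        by_cases hs : s = a
        · subst hs; simp
        · simp [hs]
      have h2 : (fun s => if s ∈ F then T' s else T s) =
          Function.update (fun s => if s ∈ F then T' s else T s) a (T a) := by
        funext s
        by_cases hs : s = a
        · subst hs; simp [ha]
        · simp [hs]
      rw [h1]
      conv_rhs => rw [h2]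
      exact (link_eq_update _ (h a)).symm
  have h1 := key Finset.univ
  simp only [Finset.mem_univ, if_true] at h1
  exact h1.symm

end Host


instance {V B : Type} : DecidablePred (IsOver (V := V) (B := B))
  | Sum.inl (_, i) => inferInstanceAs (Decidable (i = 1 ∨ i = 3))
  | Sum.inr _ => inferInstanceAs (Decidable False)

/-! ### Tangles given by tables -/

/-- A table of a tangle. The dart `i` of the crossing `v` has the code `4 * v + i`, the dart `i` of
the bead `b` has the code `4 * n + 2 * b + i` and the end `e` has the code `4 * n + 2 * m + e`. The
inner regions have the codes below `r`, the outer region `e` has the code `r + e`. The list `rank`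
contains a number for every vertex; each vertex, except for the first one, has a neighbour of
smaller rank. -/
structure TangleTable where
  n : ℕ
  m : ℕ
  r : ℕ
  edge : List ℕ
  lab : List ℕ
  rank : List ℕ

namespace TangleTable

variable (R : TangleTable) (k : ℕ) (o : ZMod 4)

abbrev D : Type := Dart (Fin R.n) (Fin R.m)

/-- The dart with a given code, after the darts at the crossings have been rotated by `o`. -/
def dart (c : ℕ) : ZMod k ⊕ R.D :=
  if h : c / 4 < R.n then Sum.inr (Sum.inl (⟨c / 4, h⟩, (c : ZMod 4) + o))
  else if h : (c - 4 * R.n) / 2 < R.m then Sum.inr (Sum.inr (⟨(c - 4 * R.n) / 2, h⟩, (c : ZMod 2)))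
  else Sum.inl ((c - 4 * R.n - 2 * R.m : ℕ) : ZMod k)

/-- The code of a dart of the tangle. -/
def code : R.D → ℕ
  | Sum.inl (v, i) => 4 * v + (i - o).val
  | Sum.inr (b, i) => 4 * R.n + 2 * b + i.val

/-- The edges of the tangle. -/
def edgeFun : ZMod k ⊕ R.D → ZMod k ⊕ R.D
  | Sum.inl e => R.dart k o (R.edge.getD (4 * R.n + 2 * R.m + e.val) 0)
  | Sum.inr d => R.dart k o (R.edge.getD (R.code o d) 0)

/-- The labels of the corners of the tangle. -/
def labFun (d : R.D) : ZMod k ⊕ Fin R.r :=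
  let c := R.lab.getD (R.code o d) 0
  if h : c < R.r then Sum.inr ⟨c, h⟩ else Sum.inl ((c - R.r : ℕ) : ZMod k)

/-- The number of the vertex at which a dart starts. -/
def vertex : R.D → ℕ
  | Sum.inl (v, _) => v
  | Sum.inr (b, _) => R.n + b

/-- The rank of the vertex at which a dart starts. -/
def rk (d : R.D) : ℕ := R.rank.getD (R.vertex d) 0

/-- The label of the corner at the far side of a dart or end. -/
def faceOk (c : R.D) : Bool :=
  match R.edgeFun k o (Sum.inr (rot c)) with
  | Sum.inl e => decide (R.labFun k o c = Sum.inl (e - 1))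
  | Sum.inr d => decide (R.labFun k o d = R.labFun k o c)

/-- The edge `edge d` leads to a vertex of smaller rank. -/
def descends (d : R.D) : Bool :=
  match R.edgeFun k o (Sum.inr d) with
  | Sum.inl _ => false
  | Sum.inr d' => decide (R.rk d' < R.rk d)

/-- At the end `e` a corner with label `e` is attached. -/
def endOk (e : ZMod k) : Bool :=
  match R.edgeFun k o (Sum.inl e) with
  | Sum.inl _ => false
  | Sum.inr d => decide (R.labFun k o d = Sum.inl e)

/-- The vertex at which `d` starts is the first one or has a neighbour of smaller rank. -/
def rankOk (d : R.D) : Prop :=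
  R.vertex d = 0 ∨ R.descends k o d = true ∨ R.descends k o (rot d) = true ∨
    R.descends k o (rot (rot d)) = true ∨ R.descends k o (rot (rot (rot d))) = true

instance (d : R.D) : Decidable (R.rankOk k o d) := by unfold rankOk; infer_instance

/-- The table describes a tangle. -/
def Ok [NeZero k] : Prop :=
  (∀ x, R.edgeFun k o (R.edgeFun k o x) = x) ∧ (∀ x, R.edgeFun k o x ≠ x) ∧
  (∀ e, R.endOk k o e = true) ∧ (∀ c, R.faceOk k o c = true) ∧
  (∀ j, ∃ d, R.labFun k o d = Sum.inr j) ∧ (∀ d, R.rankOk k o d) ∧ 2 * R.r + k = 2 * R.n + 2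

set_option synthInstance.maxSize 1000 in
instance [NeZero k] : Decidable (R.Ok k o) := by unfold Ok; infer_instance

variable {R k o}

lemma rk_rot (d : R.D) : R.rk (rot d) = R.rk d := by
  rcases d with ⟨v, i⟩ | ⟨v, i⟩ <;> rfl

lemma rot_connected {r : R.D → R.D → Prop} (hr : ∀ d, r d (rot d)) (c d : R.D)
    (h : R.vertex c = R.vertex d) : Relation.EqvGen r c d := by
  have h1 : ∀ d, Relation.EqvGen r d (rot d) := fun d => Relation.EqvGen.rel _ _ (hr d)
  have h2 : ∀ d, Relation.EqvGen r d (rot (rot d)) := fun d => (h1 d).trans _ _ _ (h1 _)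
  have h3 : ∀ d, Relation.EqvGen r d (rot (rot (rot d))) := fun d => (h2 d).trans _ _ _ (h1 _)
  rcases c with ⟨v, i⟩ | ⟨v, i⟩ <;> rcases d with ⟨w, j⟩ | ⟨w, j⟩
  · obtain rfl : v = w := Fin.ext h
    rcases zmod_four_eq i j with rfl | rfl | rfl | rfl
    · exact Relation.EqvGen.refl _
    · exact h1 _
    · have := h2 (Sum.inl (v, i))
      rwa [show rot (rot (Sum.inl (v, i) : R.D)) = Sum.inl (v, i + 2) by
        simp only [rot, add_assoc]; rfl] at this
    · have := h3 (Sum.inl (v, i))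
      rwa [show rot (rot (rot (Sum.inl (v, i) : R.D))) = Sum.inl (v, i + 3) by
        simp only [rot, add_assoc]; rfl] at this
  · have h4 : (v : ℕ) = R.n + w := h
    omega
  · have h4 : R.n + (v : ℕ) = w := h
    omega
  · have h4 : R.n + (v : ℕ) = R.n + w := h
    obtain rfl : v = w := Fin.ext (by omega)
    rcases zmod_two_eq' i j with rfl | rfl
    · exact Relation.EqvGen.refl _
    · exact h1 _

/-- Descent along the ranks joins every dart to the vertex number `0`. This replaces an expensive
search for paths by a check at each dart. -/
lemma connected_of_rank (h : ∀ d, R.rankOk k o d) (c d : R.D) :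
    Relation.EqvGen (fun x y => y = rot x ∨ R.edgeFun k o (Sum.inr x) = Sum.inr y) c d := by
  set r := fun x y : R.D => y = rot x ∨ R.edgeFun k o (Sum.inr x) = Sum.inr y with hr
  have hr1 : ∀ d, r d (rot d) := fun d => Or.inl rfl
  have g1 : ∀ d, Relation.EqvGen r d (rot d) := fun d => Relation.EqvGen.rel _ _ (hr1 d)
  have step : ∀ d, R.descends k o d = true → ∃ d', r d d' ∧ R.rk d' < R.rk d := by
    intro d hd
    unfold descends at hd
    split at hd
    · cases hd
    · rename_i d' h'
      exact ⟨d', Or.inr h', of_decide_eq_true hd⟩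
  have key : ∀ N, ∀ d, R.rk d ≤ N → ∃ d₀, R.vertex d₀ = 0 ∧ Relation.EqvGen r d d₀ := by
    intro N
    induction N with
    | zero =>
      intro d hd
      rcases h d with h0 | h0 | h0 | h0 | h0
      · exact ⟨d, h0, Relation.EqvGen.refl _⟩
      all_goals
        obtain ⟨d', -, h2⟩ := step _ h0
        try simp only [rk_rot] at h2
        omega
    | succ N ih =>
      intro d hd
      have aux : ∀ x, Relation.EqvGen r d x → R.rk x = R.rk d → R.descends k o x = true →
          ∃ d₀, R.vertex d₀ = 0 ∧ Relation.EqvGen r d d₀ := by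
        intro x hx hrk hdx
        obtain ⟨d', h1, h2⟩ := step _ hdx
        obtain ⟨d₀, h3, h4⟩ := ih d' (by omega)
        exact ⟨d₀, h3, hx.trans _ _ _ ((Relation.EqvGen.rel _ _ h1).trans _ _ _ h4)⟩
      rcases h d with h0 | h0 | h0 | h0 | h0
      · exact ⟨d, h0, Relation.EqvGen.refl _⟩
      · exact aux d (Relation.EqvGen.refl _) rfl h0
      · exact aux _ (g1 d) (by simp only [rk_rot]) h0
      · exact aux _ ((g1 d).trans _ _ _ (g1 _)) (by simp only [rk_rot]) h0
      · exact aux _ (((g1 d).trans _ _ _ (g1 _)).trans _ _ _ (g1 _)) (by simp only [rk_rot]) h0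
  obtain ⟨c₀, h1, h2⟩ := key _ c le_rfl
  obtain ⟨d₀, h3, h4⟩ := key _ d le_rfl
  exact h2.trans _ _ _ ((rot_connected hr1 c₀ d₀ (by rw [h1, h3])).trans _ _ _ h4.symm)

lemma endOk_iff {e : ZMod k} (h : R.endOk k o e = true) :
    ∃ d, R.edgeFun k o (Sum.inl e) = Sum.inr d ∧ R.labFun k o d = Sum.inl e := by
  unfold endOk at h
  split at h
  · cases h
  · rename_i d h'
    exact ⟨d, h', of_decide_eq_true h⟩

end TangleTable

/-- The tangle described by a table, with the darts at the crossings rotated by `o`. -/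
abbrev Tangle.ofTable (R : TangleTable) (k : ℕ) [NeZero k] (o : ZMod 4) (h : R.Ok k o) :
    Tangle k where
  n := R.n
  m := R.m
  r := R.r
  edge := R.edgeFun k o
  out e := (R.edgeFun k o (Sum.inl e)).getRight
    (by obtain ⟨d, h, -⟩ := TangleTable.endOk_iff (h.2.2.1 e); rw [h]; rfl)
  lab := R.labFun k o
  edge_edge := h.1
  edge_ne := h.2.1
  edge_end e := by simp
  lab_out e := by
    obtain ⟨d, h1, h2⟩ := TangleTable.endOk_iff (h.2.2.1 e)
    simp only [h1, Sum.getRight_inr, h2]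
  lab_face c d hd := by
    have := h.2.2.2.1 c
    unfold TangleTable.faceOk at this
    rw [hd] at this
    exact of_decide_eq_true this
  lab_face_end c e he := by
    have := h.2.2.2.1 c
    unfold TangleTable.faceOk at this
    rw [he] at this
    exact of_decide_eq_true this
  lab_surj := h.2.2.2.2.1
  connected := TangleTable.connected_of_rank h.2.2.2.2.2.1
  euler := h.2.2.2.2.2.2

namespace TangleTable

/-- The map between the darts of two tangles that is given by a table of codes; it is not defined
where the code is too large. -/
def muFun (A B : TangleTable) (k : ℕ) (o : ZMod 4) (t : List ℕ) (d : A.D) : Option (ZMod k ⊕ B.D) :=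
  let c := t.getD (A.code o d) 0
  if c < 4 * B.n + 2 * B.m + k then some (B.dart k o c) else none

/-- The inverse map between the darts of two tangles that is given by a table of codes. -/
def gFun (A B : TangleTable) (k : ℕ) (o : ZMod 4) (t : List ℕ) (e : B.D) : Option A.D :=
  (A.dart k o (t.getD (B.code o e) 0)).getRight?

/-- The map of labels that is given by a table. -/
def psiFun (A B : TangleTable) (h : B.r ≤ A.r) (t : List ℕ) (j : Fin B.r) : Fin A.r :=
  -- The truncation only provides membership in `Fin A.r`.
  ⟨min (t.getD j 0) (A.r - 1), by have := j.2; omega⟩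

end TangleTable

/-! ### Decidable forms of the tangle moves -/

namespace Tangle

variable {k : ℕ}

section

variable (A B : Tangle k) (I : A.D → Prop) (J : B.D → Prop) [DecidablePred I] [DecidablePred J]
  (mu : A.D → Option (ZMod k ⊕ B.D)) (g : B.D → Option A.D)

/-- The conditions on `mu` at a dart outside `I`. -/
def outOk (d : A.D) : Bool :=
  decide (I d) || match mu d with
  | some (Sum.inr e) => decide (¬ J e) && decide (g e = some d) &&
      decide (mu (KnotTheory.rot d) = some (Sum.inr (KnotTheory.rot e))) &&
      decide (IsOver d ↔ IsOver e)
  | _ => false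

/-- The conditions on `g` at a dart outside `J`. -/
def innOk (e : B.D) : Bool :=
  decide (J e) || match g e with
  | some d => decide (¬ I d) && decide (mu d = some (Sum.inr e))
  | none => false

/-- The compatibility of `mu` with an edge. -/
def edgeOk (d : A.D) : Bool :=
  match mu d, A.edge (Sum.inr d) with
  | none, _ => true
  | some x, Sum.inr d' => decide (mu d' = some (B.edge x))
  | some x, Sum.inl e => decide (B.edge x = Sum.inl e)

/-- A decidable version of `Tangle.Change`. -/
def ChangeOk : Prop :=
  (∀ d, outOk A B I J mu g d = true) ∧ (∀ e, innOk A B I J mu g e = true) ∧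
  (∀ d, edgeOk A B mu d = true) ∧ (∀ e, mu (A.out e) = some (Sum.inr (B.out e)))

instance [NeZero k] : Decidable (ChangeOk A B I J mu g) := by
  unfold ChangeOk
  refine @instDecidableAnd _ _ inferInstance (@instDecidableAnd _ _ inferInstance
    (@instDecidableAnd _ _ inferInstance ?_))
  infer_instance

variable {A B I J mu g}

lemma ChangeOk.change (h : ChangeOk A B I J mu g) : Change A B I J mu g := by
  obtain ⟨h1, h2, h3, h4⟩ := h
  have h1' : ∀ d, ¬ I d → ∃ e, mu d = some (Sum.inr e) ∧ ¬ J e ∧ g e = some d ∧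
      mu (KnotTheory.rot d) = some (Sum.inr (KnotTheory.rot e)) ∧ (IsOver d ↔ IsOver e) := by
    intro d hd
    have := h1 d
    unfold outOk at this
    rw [decide_eq_false hd, Bool.false_or] at this
    split at this
    · rename_i e he
      simp only [Bool.and_eq_true, decide_eq_true_eq] at this
      exact ⟨e, he, this.1.1.1, this.1.1.2, this.1.2, this.2⟩
    · cases this
  constructor
  · intro d hd
    obtain ⟨e, a1, a2, a3, -⟩ := h1' d hd
    exact ⟨e, a2, a1, a3⟩
  · intro e he
    have := h2 e
    unfold innOk at this
    rw [decide_eq_false he, Bool.false_or] at this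
    split at this
    · rename_i d hd
      simp only [Bool.and_eq_true, decide_eq_true_eq] at this
      exact ⟨d, this.1, this.2, hd⟩
    · cases this
  · intro d e hd he
    obtain ⟨e', a1, -, -, a4, -⟩ := h1' d hd
    rw [a1] at he
    obtain rfl := Sum.inr.inj (Option.some.inj he)
    exact a4
  · intro d e hd he
    obtain ⟨e', a1, -, -, -, a5⟩ := h1' d hd
    rw [a1] at he
    obtain rfl := Sum.inr.inj (Option.some.inj he)
    exact a5
  · intro d d' x hx hd
    have := h3 d
    unfold edgeOk at this
    rw [hx, hd] at this
    exact of_decide_eq_true this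
  · intro d e x hx hd
    have := h3 d
    unfold edgeOk at this
    rw [hx, hd] at this
    exact of_decide_eq_true this
  · exact h4

variable (A B mu) (psi : Fin B.r → Fin A.r)

/-- The compatibility of `mu` and `psi` with the label of a corner. -/
def labOk (d : A.D) : Bool :=
  match mu d with
  | none => true
  | some x => decide (A.lab d = Sum.map id psi (B.xlab x))

/-- A decidable version of `Tangle.LabelEq`. -/
def LabelEqOk : Prop := Function.Injective psi ∧ ∀ d, labOk A B mu psi d = true

instance : Decidable (LabelEqOk A B mu psi) := by unfold LabelEqOk; infer_instance

/-- The compatibility of `mu` and `psi` with the label of a corner, if `j` is merged with `a`. -/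
def labMergeOk (a : ZMod k ⊕ Fin A.r) (j : Fin A.r) (d : A.D) : Bool :=
  match mu d with
  | none => true
  | some x => if A.lab d = Sum.inr j then decide (Sum.map id psi (B.xlab x) = a)
      else decide (A.lab d = Sum.map id psi (B.xlab x))

/-- A decidable version of `Tangle.LabelMerge`. -/
def LabelMergeOk (a : ZMod k ⊕ Fin A.r) (j : Fin A.r) : Prop :=
  Function.Injective psi ∧ a ≠ Sum.inr j ∧ ∀ d, labMergeOk A B mu psi a j d = true

instance (a : ZMod k ⊕ Fin A.r) (j : Fin A.r) : Decidable (LabelMergeOk A B mu psi a j) := by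
  unfold LabelMergeOk; infer_instance

variable {A B mu psi}

lemma LabelEqOk.labelEq (h : LabelEqOk A B mu psi) : LabelEq A B mu psi := by
  refine ⟨h.1, fun d x hx => ?_⟩
  have := h.2 d
  unfold labOk at this
  rw [hx] at this
  exact of_decide_eq_true this

lemma LabelMergeOk.labelMerge {a : ZMod k ⊕ Fin A.r} {j : Fin A.r}
    (h : LabelMergeOk A B mu psi a j) : LabelMerge A B mu psi a j := by
  refine ⟨h.1, h.2.1, fun d x hx => ?_⟩
  have := h.2.2 d
  unfold labMergeOk at this
  rw [hx] at this
  dsimp only at this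
  split at this
  · exact Or.inr ⟨by assumption, of_decide_eq_true this⟩
  · exact Or.inl ⟨by assumption, of_decide_eq_true this⟩

end

section

variable [NeZero k]

/-- A decidable version of `Tangle.EraseBead`. -/
def EraseBeadOk (A B : Tangle k) (b : Fin A.m) (i : ZMod 2) (mu : A.D → Option (ZMod k ⊕ B.D))
    (g : B.D → Option A.D) (psi : Fin B.r → Fin A.r) : Prop :=
  ((A.edge (Sum.inr (A.bd b i))).isRight = true ∧
    A.edge (Sum.inr (A.bd b i)) ≠ Sum.inr (A.bd b (i + 1))) ∧
  ChangeOk A B (fun d => ∃ i, d = A.bd b i) (fun _ => False) mu g ∧ LabelEqOk A B mu psi ∧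
  mu (A.bd b 0) ≠ none ∧ mu (A.bd b 1) = (mu (A.bd b 0)).map B.edge

/-- A decidable version of `Tangle.Omega1`. -/
def Omega1Ok (A B : Tangle k) (v : Fin A.n) (i : ZMod 4) (b : Fin B.m) (l : Fin A.r)
    (mu : A.D → Option (ZMod k ⊕ B.D)) (g : B.D → Option A.D) (psi : Fin B.r → Fin A.r) : Prop :=
  (A.edge (Sum.inr (A.cr v (i + 1))) = Sum.inr (A.cr v i) ∧
    A.lab (A.cr v i) = Sum.inr l ∧ (∀ d, A.lab d = Sum.inr l → d = A.cr v i)) ∧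
  ChangeOk A B (fun d => ∃ j, d = A.cr v j) (fun d => ∃ j, d = B.bd b j) mu g ∧
  LabelEqOk A B mu psi ∧
  mu (A.cr v i) = none ∧ mu (A.cr v (i + 1)) = none ∧
  mu (A.cr v (i + 2)) = some (Sum.inr (B.bd b 0)) ∧
  mu (A.cr v (i + 3)) = some (Sum.inr (B.bd b 1))

/-- A decidable version of `Tangle.Omega2`. -/
def Omega2Ok (A B : Tangle k) (v w : Fin A.n) (i j : ZMod 4) (b c : Fin B.m) (l l' : Fin A.r)
    (mu : A.D → Option (ZMod k ⊕ B.D)) (g : B.D → Option A.D) (psi : Fin B.r → Fin A.r) : Prop :=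
  (v ≠ w ∧ b ≠ c ∧
    A.edge (Sum.inr (A.cr v (i + 1))) = Sum.inr (A.cr w j) ∧
    A.edge (Sum.inr (A.cr w (j + 1))) = Sum.inr (A.cr v i) ∧
    (IsOver (A.cr v i) ↔ IsOver (A.cr w (j + 1))) ∧
    A.lab (A.cr v i) = Sum.inr l ∧ (∀ d, A.lab d = Sum.inr l → d = A.cr v i ∨ d = A.cr w j) ∧
    A.lab (A.cr w (j + 2)) = Sum.inr l') ∧
  ChangeOk A B (fun d => ∃ k, d = A.cr v k ∨ d = A.cr w k)
    (fun d => ∃ k, d = B.bd b k ∨ d = B.bd c k) mu g ∧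
  LabelMergeOk A B mu psi (A.lab (A.cr v (i + 2))) l' ∧
  (mu (A.cr v i) = none ∧ mu (A.cr v (i + 1)) = none ∧
    mu (A.cr w j) = none ∧ mu (A.cr w (j + 1)) = none) ∧
  mu (A.cr v (i + 2)) = some (Sum.inr (B.bd b 0)) ∧
  mu (A.cr w (j + 3)) = some (Sum.inr (B.bd b 1)) ∧
  mu (A.cr v (i + 3)) = some (Sum.inr (B.bd c 0)) ∧
  mu (A.cr w (j + 2)) = some (Sum.inr (B.bd c 1))

/-- A decidable version of `Tangle.Omega3`. -/
def Omega3Ok (A B : Tangle k) (v : ZMod 3 → Fin A.n) (i : ZMod 3 → ZMod 4) (u : ZMod 3 → Fin B.n)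
    (j : ZMod 3 → ZMod 4) (l : Fin A.r) (l' : Fin B.r)
    (mu : A.D → Option (ZMod k ⊕ B.D)) (g : B.D → Option A.D) (psi : Fin B.r → Fin A.r) : Prop :=
  (A.Triangle v i l ∧ B.Triangle u j l' ∧
    (∀ k, IsOver (A.cr (v k) (i k)) ↔ IsOver (B.cr (u k) (j k)))) ∧
  ChangeOk A B (fun d => ∃ k l, d = A.cr (v k) l) (fun d => ∃ k l, d = B.cr (u k) l) mu g ∧
  LabelEqOk A B mu psi ∧
  (∀ k, mu (A.cr (v k) (i k)) = none ∧ mu (A.cr (v k) (i k + 1)) = none) ∧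
  mu (A.cr (v 0) (i 0 + 2)) = some (Sum.inr (B.cr (u 2) (j 2 + 3))) ∧
  mu (A.cr (v 0) (i 0 + 3)) = some (Sum.inr (B.cr (u 1) (j 1 + 2))) ∧
  mu (A.cr (v 1) (i 1 + 2)) = some (Sum.inr (B.cr (u 0) (j 0 + 3))) ∧
  mu (A.cr (v 1) (i 1 + 3)) = some (Sum.inr (B.cr (u 2) (j 2 + 2))) ∧
  mu (A.cr (v 2) (i 2 + 2)) = some (Sum.inr (B.cr (u 1) (j 1 + 3))) ∧
  mu (A.cr (v 2) (i 2 + 3)) = some (Sum.inr (B.cr (u 0) (j 0 + 2)))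

set_option synthInstance.maxSize 1000

instance (A B : Tangle k) (b i mu g psi) : Decidable (EraseBeadOk A B b i mu g psi) := by
  unfold EraseBeadOk; infer_instance

instance (A B : Tangle k) (v i b l mu g psi) : Decidable (Omega1Ok A B v i b l mu g psi) := by
  unfold Omega1Ok; infer_instance

instance (A B : Tangle k) (v w i j b c l l' mu g psi) :
    Decidable (Omega2Ok A B v w i j b c l l' mu g psi) := by
  unfold Omega2Ok; infer_instance

instance (A : Tangle k) (v i l) : Decidable (A.Triangle v i l) := by
  unfold Triangle; infer_instance

instance (A B : Tangle k) (v i u j l l' mu g psi) :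
    Decidable (Omega3Ok A B v i u j l l' mu g psi) := by
  unfold Omega3Ok; infer_instance

end

lemma EraseBeadOk.equivalent {A B : Tangle k} {b i mu g psi} (h : EraseBeadOk A B b i mu g psi) :
    A.Equivalent B :=
  Relation.EqvGen.rel _ _ (Or.inl
    ⟨b, i, mu, g, psi, h.1.1, h.1.2, h.2.1.change, h.2.2.1.labelEq, h.2.2.2⟩)

lemma Omega1Ok.equivalent {A B : Tangle k} {v i b l mu g psi}
    (h : Omega1Ok A B v i b l mu g psi) : A.Equivalent B :=
  Relation.EqvGen.rel _ _ (Or.inr (Or.inl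
    ⟨v, i, b, mu, g, psi, l, h.1.1, h.1.2.1, h.1.2.2, h.2.1.change, h.2.2.1.labelEq, h.2.2.2⟩))

lemma Omega2Ok.equivalent {A B : Tangle k} {v w i j b c l l' mu g psi}
    (h : Omega2Ok A B v w i j b c l l' mu g psi) : A.Equivalent B := by
  obtain ⟨⟨h1, h2, h3, h4, h5, h6, h7, h8⟩, hc, hl, ⟨n1, n2, n3, n4⟩, h9⟩ := h
  exact Relation.EqvGen.rel _ _ (Or.inr (Or.inr (Or.inl
    ⟨v, w, i, j, b, c, mu, g, psi, l, l', h1, h2, h3, h4, h5, h6, h7, h8, hc.change, hl.labelMerge,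
      n1, n2, n3, n4, h9⟩)))

lemma Omega3Ok.equivalent {A B : Tangle k} {v i u j l l' mu g psi}
    (h : Omega3Ok A B v i u j l l' mu g psi) : A.Equivalent B := by
  obtain ⟨⟨h1, h2, h3⟩, hc, hl, h4⟩ := h
  exact Relation.EqvGen.rel _ _ (Or.inr (Or.inr (Or.inr
    ⟨v, i, u, j, mu, g, psi, l, l', h1, h2, h3, hc.change, hl.labelEq, h4⟩)))

end Tangle


open TangleTable

/-! ### A tangle with seven crossings that is equivalent to a single crossing -/

/-- The table of a tangle with 7 crossings and 0 beads that is equivalent to a single crossing. -/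
abbrev sevenTangleTable : TangleTable where
  n := 7
  m := 0
  r := 6
  edge := [13, 28, 29, 14, 18, 21, 31, 12, 19, 15, 30, 20, 7, 0, 3, 9, 25, 24, 4, 8, 11, 5, 27,
    26, 17, 16, 23, 22, 1, 2, 10, 6]
  lab := [9, 6, 7, 0, 2, 8, 9, 1, 1, 7, 8, 3, 9, 0, 7, 1, 4, 2, 1, 3, 8, 2, 5, 3, 4, 3, 5, 2]
  rank := [0, 2, 2, 1, 3, 3, 4]

lemma sevenTangleTable_ok : ∀ o, sevenTangleTable.Ok 4 o := by decide +kernel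

/-- The tangle of this table. -/
abbrev sevenTangle (o : ZMod 4) : Tangle 4 :=
  Tangle.ofTable sevenTangleTable 4 o (sevenTangleTable_ok o)

/-- The table of a tangle with 7 crossings and 1 bead that is equivalent to a single crossing. -/
abbrev sevenTangleBeadTable : TangleTable where
  n := 7
  m := 1
  r := 6
  edge := [13, 30, 31, 14, 18, 21, 33, 12, 19, 15, 32, 20, 7, 0, 3, 9, 25, 24, 4, 8, 11, 5, 27,
    28, 17, 16, 29, 22, 23, 26, 1, 2, 10, 6]
  lab := [9, 6, 7, 0, 2, 8, 9, 1, 1, 7, 8, 3, 9, 0, 7, 1, 4, 2, 1, 3, 8, 2, 5, 3, 4, 3, 5, 2, 5,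
    3]
  rank := [0, 2, 2, 1, 3, 3, 4, 4]

lemma sevenTangleBeadTable_ok : ∀ o, sevenTangleBeadTable.Ok 4 o := by decide +kernel

/-- The tangle of this table. -/
abbrev sevenTangleBead (o : ZMod 4) : Tangle 4 :=
  Tangle.ofTable sevenTangleBeadTable 4 o (sevenTangleBeadTable_ok o)

/-- The table of a tangle with 8 crossings and 0 beads that is equivalent to a single crossing. -/
abbrev eightTangleTable : TangleTable where
  n := 8
  m := 0
  r := 7
  edge := [13, 32, 33, 14, 18, 21, 35, 12, 19, 15, 34, 20, 7, 0, 3, 9, 25, 24, 4, 8, 11, 5, 27,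
    31, 17, 16, 28, 22, 26, 30, 29, 23, 1, 2, 10, 6]
  lab := [10, 7, 8, 0, 2, 9, 10, 1, 1, 8, 9, 3, 10, 0, 8, 1, 4, 2, 1, 3, 9, 2, 5, 3, 4, 3, 5, 2,
    3, 6, 3, 5]
  rank := [0, 2, 2, 1, 3, 3, 4, 4]

lemma eightTangleTable_ok : ∀ o, eightTangleTable.Ok 4 o := by decide +kernel

/-- The tangle of this table. -/
abbrev eightTangle (o : ZMod 4) : Tangle 4 :=
  Tangle.ofTable eightTangleTable 4 o (eightTangleTable_ok o)

/-- The table of a tangle with 8 crossings and 0 beads that is equivalent to a single crossing. -/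
abbrev eightTangleSlidTable : TangleTable where
  n := 8
  m := 0
  r := 7
  edge := [13, 32, 33, 14, 18, 29, 35, 12, 19, 15, 34, 25, 7, 0, 3, 9, 20, 30, 4, 8, 16, 24, 27,
    31, 21, 11, 28, 22, 26, 5, 17, 23, 1, 2, 10, 6]
  lab := [10, 7, 8, 0, 2, 9, 10, 1, 1, 8, 9, 3, 10, 0, 8, 1, 4, 2, 1, 3, 3, 6, 5, 4, 3, 9, 5, 6,
    9, 2, 4, 5]
  rank := [0, 2, 2, 1, 3, 4, 3, 3]

lemma eightTangleSlidTable_ok : ∀ o, eightTangleSlidTable.Ok 4 o := by decide +kernel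

/-- The tangle of this table. -/
abbrev eightTangleSlid (o : ZMod 4) : Tangle 4 :=
  Tangle.ofTable eightTangleSlidTable 4 o (eightTangleSlidTable_ok o)

/-- The table of a tangle with 8 crossings and 0 beads that is equivalent to a single crossing. -/
abbrev eightTangleClaspedTable : TangleTable where
  n := 8
  m := 0
  r := 7
  edge := [13, 32, 33, 14, 18, 29, 20, 23, 28, 15, 34, 25, 31, 0, 3, 9, 35, 30, 4, 26, 6, 24, 27,
    7, 21, 11, 19, 22, 8, 5, 17, 12, 1, 2, 10, 16]
  lab := [10, 7, 8, 0, 3, 1, 5, 4, 2, 8, 9, 1, 10, 0, 8, 2, 10, 3, 4, 9, 1, 6, 4, 5, 1, 9, 4, 6,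
    1, 3, 10, 2]
  rank := [0, 3, 2, 1, 3, 4, 3, 2]

lemma eightTangleClaspedTable_ok : ∀ o, eightTangleClaspedTable.Ok 4 o := by decide +kernel

/-- The tangle of this table. -/
abbrev eightTangleClasped (o : ZMod 4) : Tangle 4 :=
  Tangle.ofTable eightTangleClaspedTable 4 o (eightTangleClaspedTable_ok o)

/-- The table of a tangle with 6 crossings and 2 beads that is equivalent to a single crossing. -/
abbrev sixTangleBeadsTable : TangleTable where
  n := 6
  m := 2
  r := 5
  edge := [9, 28, 29, 10, 20, 11, 30, 17, 23, 0, 3, 5, 31, 22, 24, 18, 27, 7, 15, 25, 4, 26, 13,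
    8, 14, 19, 21, 16, 1, 2, 6, 12]
  lab := [8, 5, 6, 0, 1, 6, 7, 2, 8, 0, 6, 1, 8, 3, 4, 7, 2, 7, 4, 3, 2, 3, 8, 1, 3, 4, 2, 3]
  rank := [0, 2, 1, 3, 3, 2, 4, 3]

lemma sixTangleBeadsTable_ok : ∀ o, sixTangleBeadsTable.Ok 4 o := by decide +kernel

/-- The tangle of this table. -/
abbrev sixTangleBeads (o : ZMod 4) : Tangle 4 :=
  Tangle.ofTable sixTangleBeadsTable 4 o (sixTangleBeadsTable_ok o)

/-- The table of a tangle with 6 crossings and 1 bead that is equivalent to a single crossing. -/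
abbrev sixTangleBeadTable : TangleTable where
  n := 6
  m := 1
  r := 5
  edge := [9, 26, 27, 10, 20, 11, 28, 17, 23, 0, 3, 5, 29, 22, 24, 18, 21, 7, 15, 25, 4, 16, 13,
    8, 14, 19, 1, 2, 6, 12]
  lab := [8, 5, 6, 0, 1, 6, 7, 2, 8, 0, 6, 1, 8, 3, 4, 7, 2, 7, 4, 3, 2, 3, 8, 1, 3, 4]
  rank := [0, 2, 1, 3, 3, 2, 4]

lemma sixTangleBeadTable_ok : ∀ o, sixTangleBeadTable.Ok 4 o := by decide +kernel

/-- The tangle of this table. -/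
abbrev sixTangleBead (o : ZMod 4) : Tangle 4 :=
  Tangle.ofTable sixTangleBeadTable 4 o (sixTangleBeadTable_ok o)

/-- The table of a tangle with 6 crossings and 0 beads that is equivalent to a single crossing. -/
abbrev sixTangleTable : TangleTable where
  n := 6
  m := 0
  r := 5
  edge := [9, 24, 25, 10, 20, 11, 26, 17, 23, 0, 3, 5, 27, 22, 19, 18, 21, 7, 15, 14, 4, 16, 13,
    8, 1, 2, 6, 12]
  lab := [8, 5, 6, 0, 1, 6, 7, 2, 8, 0, 6, 1, 8, 3, 4, 7, 2, 7, 4, 3, 2, 3, 8, 1]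
  rank := [0, 2, 1, 3, 3, 2]

lemma sixTangleTable_ok : ∀ o, sixTangleTable.Ok 4 o := by decide +kernel

/-- The tangle of this table. -/
abbrev sixTangle (o : ZMod 4) : Tangle 4 :=
  Tangle.ofTable sixTangleTable 4 o (sixTangleTable_ok o)

/-- The table of a tangle with 6 crossings and 0 beads that is equivalent to a single crossing. -/
abbrev sixTangleSlidTable : TangleTable where
  n := 6
  m := 0
  r := 5
  edge := [9, 24, 25, 10, 20, 14, 13, 17, 18, 0, 3, 19, 27, 6, 5, 23, 21, 7, 8, 11, 4, 16, 26, 15,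
    1, 2, 22, 12]
  lab := [8, 5, 6, 0, 3, 4, 8, 2, 8, 0, 6, 1, 8, 4, 3, 7, 2, 8, 1, 6, 2, 6, 7, 3]
  rank := [0, 3, 1, 4, 2, 3]

lemma sixTangleSlidTable_ok : ∀ o, sixTangleSlidTable.Ok 4 o := by decide +kernel

/-- The tangle of this table. -/
abbrev sixTangleSlid (o : ZMod 4) : Tangle 4 :=
  Tangle.ofTable sixTangleSlidTable 4 o (sixTangleSlidTable_ok o)

/-- The table of a tangle with 4 crossings and 2 beads that is equivalent to a single crossing. -/
abbrev fourTangleBeadsTable : TangleTable where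
  n := 4
  m := 2
  r := 3
  edge := [19, 20, 21, 17, 12, 10, 9, 18, 23, 6, 5, 15, 4, 16, 22, 11, 13, 3, 7, 0, 1, 2, 14, 8]
  lab := [6, 3, 4, 0, 1, 2, 6, 0, 6, 2, 1, 5, 0, 4, 5, 1, 0, 4, 6, 0]
  rank := [0, 2, 3, 2, 1, 1]

lemma fourTangleBeadsTable_ok : ∀ o, fourTangleBeadsTable.Ok 4 o := by decide +kernel

/-- The tangle of this table. -/
abbrev fourTangleBeads (o : ZMod 4) : Tangle 4 :=
  Tangle.ofTable fourTangleBeadsTable 4 o (fourTangleBeadsTable_ok o)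

/-- The table of a tangle with 4 crossings and 1 bead that is equivalent to a single crossing. -/
abbrev fourTangleBeadTable : TangleTable where
  n := 4
  m := 1
  r := 3
  edge := [7, 18, 19, 17, 12, 10, 9, 0, 21, 6, 5, 15, 4, 16, 20, 11, 13, 3, 1, 2, 14, 8]
  lab := [6, 3, 4, 0, 1, 2, 6, 0, 6, 2, 1, 5, 0, 4, 5, 1, 0, 4]
  rank := [0, 1, 2, 2, 1]

lemma fourTangleBeadTable_ok : ∀ o, fourTangleBeadTable.Ok 4 o := by decide +kernel

/-- The tangle of this table. -/
abbrev fourTangleBead (o : ZMod 4) : Tangle 4 :=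
  Tangle.ofTable fourTangleBeadTable 4 o (fourTangleBeadTable_ok o)

/-- The table of a tangle with 4 crossings and 0 beads that is equivalent to a single crossing. -/
abbrev fourTangleTable : TangleTable where
  n := 4
  m := 0
  r := 3
  edge := [7, 16, 17, 13, 12, 10, 9, 0, 19, 6, 5, 15, 4, 3, 18, 11, 1, 2, 14, 8]
  lab := [6, 3, 4, 0, 1, 2, 6, 0, 6, 2, 1, 5, 0, 4, 5, 1]
  rank := [0, 1, 2, 1]

lemma fourTangleTable_ok : ∀ o, fourTangleTable.Ok 4 o := by decide +kernel

/-- The tangle of this table. -/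
abbrev fourTangle (o : ZMod 4) : Tangle 4 :=
  Tangle.ofTable fourTangleTable 4 o (fourTangleTable_ok o)

/-- The table of a tangle with 4 crossings and 0 beads that is equivalent to a single crossing. -/
abbrev fourTangleSlidTable : TangleTable where
  n := 4
  m := 0
  r := 3
  edge := [7, 11, 10, 13, 12, 17, 18, 0, 19, 14, 2, 1, 4, 3, 9, 16, 15, 5, 6, 8]
  lab := [5, 2, 1, 0, 3, 4, 5, 0, 6, 1, 2, 5, 0, 1, 6, 3]
  rank := [0, 1, 1, 1]

lemma fourTangleSlidTable_ok : ∀ o, fourTangleSlidTable.Ok 4 o := by decide +kernel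

/-- The tangle of this table. -/
abbrev fourTangleSlid (o : ZMod 4) : Tangle 4 :=
  Tangle.ofTable fourTangleSlidTable 4 o (fourTangleSlidTable_ok o)

/-- The table of a tangle with 2 crossings and 2 beads that is equivalent to a single crossing. -/
abbrev twoTangleBeadsTable : TangleTable where
  n := 2
  m := 2
  r := 1
  edge := [4, 13, 14, 9, 0, 11, 10, 12, 15, 3, 6, 5, 7, 1, 2, 8]
  lab := [1, 2, 3, 4, 4, 0, 4, 1, 4, 3, 0, 4]
  rank := [0, 1, 1, 2]

lemma twoTangleBeadsTable_ok : ∀ o, twoTangleBeadsTable.Ok 4 o := by decide +kernel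

/-- The tangle of this table. -/
abbrev twoTangleBeads (o : ZMod 4) : Tangle 4 :=
  Tangle.ofTable twoTangleBeadsTable 4 o (twoTangleBeadsTable_ok o)

/-- The table of a tangle with 2 crossings and 1 bead that is equivalent to a single crossing. -/
abbrev twoTangleBeadTable : TangleTable where
  n := 2
  m := 1
  r := 1
  edge := [4, 11, 12, 9, 0, 6, 5, 10, 13, 3, 7, 1, 2, 8]
  lab := [1, 2, 3, 4, 4, 0, 4, 1, 4, 3]
  rank := [0, 1, 1]

lemma twoTangleBeadTable_ok : ∀ o, twoTangleBeadTable.Ok 4 o := by decide +kernel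

/-- The tangle of this table. -/
abbrev twoTangleBead (o : ZMod 4) : Tangle 4 :=
  Tangle.ofTable twoTangleBeadTable 4 o (twoTangleBeadTable_ok o)

/-- The table of a tangle with 2 crossings and 0 beads that is equivalent to a single crossing. -/
abbrev twoTangleTable : TangleTable where
  n := 2
  m := 0
  r := 1
  edge := [4, 9, 10, 11, 0, 6, 5, 8, 7, 1, 2, 3]
  lab := [1, 2, 3, 4, 4, 0, 4, 1]
  rank := [0, 1]

lemma twoTangleTable_ok : ∀ o, twoTangleTable.Ok 4 o := by decide +kernel

/-- The tangle of this table. -/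
abbrev twoTangle (o : ZMod 4) : Tangle 4 :=
  Tangle.ofTable twoTangleTable 4 o (twoTangleTable_ok o)

/-- The table of a tangle with 1 crossing and 1 bead that is equivalent to a single crossing. -/
abbrev crossingTangleBeadTable : TangleTable where
  n := 1
  m := 1
  r := 0
  edge := [5, 7, 8, 9, 6, 0, 4, 1, 2, 3]
  lab := [0, 1, 2, 3, 0, 3]
  rank := [0, 1]

lemma crossingTangleBeadTable_ok : ∀ o, crossingTangleBeadTable.Ok 4 o := by decide +kernel

/-- The tangle of this table. -/
abbrev crossingTangleBead (o : ZMod 4) : Tangle 4 :=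
  Tangle.ofTable crossingTangleBeadTable 4 o (crossingTangleBeadTable_ok o)

/-- The table of a tangle with 1 crossing and 0 beads that is equivalent to a single crossing. -/
abbrev crossingTangleTable : TangleTable where
  n := 1
  m := 0
  r := 0
  edge := [4, 5, 6, 7, 0, 1, 2, 3]
  lab := [0, 1, 2, 3]
  rank := [0]

lemma crossingTangleTable_ok : ∀ o, crossingTangleTable.Ok 4 o := by decide +kernel

/-- The tangle of this table. -/
abbrev crossingTangle (o : ZMod 4) : Tangle 4 :=
  Tangle.ofTable crossingTangleTable 4 o (crossingTangleTable_ok o)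

lemma sevenTangleBead_equivalent_sevenTangle (o : ZMod 4) :
    (sevenTangleBead o).Equivalent (sevenTangle o) :=
  Tangle.EraseBeadOk.equivalent (show Tangle.EraseBeadOk
    (sevenTangleBead o) (sevenTangle o)
    (0 : Fin 1) 0
    (muFun sevenTangleBeadTable sevenTangleTable 4 o
      [0, 1, 2, 3, 4, 5, 6, 7, 8, 9, 10, 11, 12, 13, 14, 15, 16, 17, 18, 19, 20, 21, 22, 23, 24,
       25, 26, 27, 26, 23])
    (gFun sevenTangleBeadTable sevenTangleTable 4 o
      [0, 1, 2, 3, 4, 5, 6, 7, 8, 9, 10, 11, 12, 13, 14, 15, 16, 17, 18, 19, 20, 21, 22, 23, 24,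
       25, 26, 27])
    (psiFun sevenTangleBeadTable sevenTangleTable (by decide) [0, 1, 2, 3, 4, 5]) from by
      revert o; decide +kernel)

/-- Read backwards, this move adds a kink to `sevenTangle`; the additional crossing opens up the
third move that comes next. The code `999` is out of range and stands for an undefined value of
`muFun` or `gFun`. -/
lemma eightTangle_equivalent_sevenTangleBead (o : ZMod 4) :
    (eightTangle o).Equivalent (sevenTangleBead o) :=
  Tangle.Omega1Ok.equivalent (show Tangle.Omega1Ok
    (eightTangle o) (sevenTangleBead o)
    (7 : Fin 8) (1 + o) (0 : Fin 1) (6 : Fin 7)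
    (muFun eightTangleTable sevenTangleBeadTable 4 o
      [0, 1, 2, 3, 4, 5, 6, 7, 8, 9, 10, 11, 12, 13, 14, 15, 16, 17, 18, 19, 20, 21, 22, 23, 24,
       25, 26, 27, 29, 999, 999, 28])
    (gFun eightTangleTable sevenTangleBeadTable 4 o
      [0, 1, 2, 3, 4, 5, 6, 7, 8, 9, 10, 11, 12, 13, 14, 15, 16, 17, 18, 19, 20, 21, 22, 23, 24,
       25, 26, 27, 999, 999])
    (psiFun eightTangleTable sevenTangleBeadTable (by decide) [0, 1, 2, 3, 4, 5]) from by
      revert o; decide +kernel)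

/-- For odd `o` the over-strands and under-strands are exchanged, so the lowest strand of the
triangle becomes the highest. The corners are then renumbered cyclically so that the over-strand
again runs through the corners `0` and `1`. The other third moves are treated in the same way. -/
lemma eightTangle_equivalent_eightTangleSlid (o : ZMod 4) :
    (eightTangle o).Equivalent (eightTangleSlid o) :=
  Tangle.Omega3Ok.equivalent (show Tangle.Omega3Ok
    (eightTangle o) (eightTangleSlid o)
    (fun k => (![5, 7, 6] : ZMod 3 → Fin 8) (if o.val % 2 = 0 then k else k + (1 : ZMod 3)))
    (fun k => (![2, 3, 2] : ZMod 3 → ZMod 4) (if o.val % 2 = 0 then k else k + (1 : ZMod 3)) + o)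
    (fun k => (![5, 7, 6] : ZMod 3 → Fin 8) (if o.val % 2 = 0 then k else k + (1 : ZMod 3)))
    (fun k => (![2, 3, 2] : ZMod 3 → ZMod 4) (if o.val % 2 = 0 then k else k + (1 : ZMod 3)) + o)
    (5 : Fin 7) (5 : Fin 7)
    (muFun eightTangleTable eightTangleSlidTable 4 o
      [0, 1, 2, 3, 4, 5, 6, 7, 8, 9, 10, 11, 12, 13, 14, 15, 16, 17, 18, 19, 25, 29, 999, 999, 30,
       20, 999, 999, 999, 21, 24, 999])
    (gFun eightTangleTable eightTangleSlidTable 4 o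
      [0, 1, 2, 3, 4, 5, 6, 7, 8, 9, 10, 11, 12, 13, 14, 15, 16, 17, 18, 19, 999, 999, 999, 999,
       999, 999, 999, 999, 999, 999, 999, 999])
    (psiFun eightTangleTable eightTangleSlidTable (by decide) [0, 1, 2, 3, 4, 5, 6]) from by
      revert o; decide +kernel)

lemma eightTangleSlid_equivalent_eightTangleClasped (o : ZMod 4) :
    (eightTangleSlid o).Equivalent (eightTangleClasped o) :=
  Tangle.Omega3Ok.equivalent (show Tangle.Omega3Ok
    (eightTangleSlid o) (eightTangleClasped o)
    (fun k => (![1, 7, 4] : ZMod 3 → Fin 8) (if o.val % 2 = 0 then k else k + (2 : ZMod 3)))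
    (fun k => (![0, 1, 1] : ZMod 3 → ZMod 4) (if o.val % 2 = 0 then k else k + (2 : ZMod 3)) + o)
    (fun k => (![1, 7, 4] : ZMod 3 → Fin 8) (if o.val % 2 = 0 then k else k + (2 : ZMod 3)))
    (fun k => (![0, 1, 1] : ZMod 3 → ZMod 4) (if o.val % 2 = 0 then k else k + (2 : ZMod 3)) + o)
    (2 : Fin 7) (3 : Fin 7)
    (muFun eightTangleSlidTable eightTangleClaspedTable 4 o
      [0, 1, 2, 3, 999, 999, 16, 31, 8, 9, 10, 11, 12, 13, 14, 15, 6, 999, 999, 28, 20, 21, 22,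
       23, 24, 25, 26, 27, 19, 999, 999, 7])
    (gFun eightTangleSlidTable eightTangleClaspedTable 4 o
      [0, 1, 2, 3, 999, 999, 999, 999, 8, 9, 10, 11, 12, 13, 14, 15, 999, 999, 999, 999, 20, 21,
       22, 23, 24, 25, 26, 27, 999, 999, 999, 999])
    (psiFun eightTangleSlidTable eightTangleClaspedTable (by decide) [0, 3, 1, 2, 5, 4, 6]) from by
      revert o; decide +kernel)

lemma eightTangleClasped_equivalent_sixTangleBeads (o : ZMod 4) :
    (eightTangleClasped o).Equivalent (sixTangleBeads o) :=
  Tangle.Omega2Ok.equivalent (show Tangle.Omega2Ok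
    (eightTangleClasped o) (sixTangleBeads o)
    (1 : Fin 8) (5 : Fin 8) (2 + o) (3 + o) (0 : Fin 2) (1 : Fin 2) (5 : Fin 7) (6 : Fin 7)
    (muFun eightTangleClaspedTable sixTangleBeadsTable 4 o
      [0, 1, 2, 3, 24, 26, 999, 999, 4, 5, 6, 7, 8, 9, 10, 11, 12, 13, 14, 15, 999, 27, 25, 999,
       16, 17, 18, 19, 20, 21, 22, 23])
    (gFun eightTangleClaspedTable sixTangleBeadsTable 4 o
      [0, 1, 2, 3, 8, 9, 10, 11, 12, 13, 14, 15, 16, 17, 18, 19, 24, 25, 26, 27, 28, 29, 30, 31,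
       999, 999, 999, 999])
    (psiFun eightTangleClaspedTable sixTangleBeadsTable (by decide) [0, 2, 1, 3, 4]) from by
      revert o; decide +kernel)

lemma sixTangleBeads_equivalent_sixTangleBead (o : ZMod 4) :
    (sixTangleBeads o).Equivalent (sixTangleBead o) :=
  Tangle.EraseBeadOk.equivalent (show Tangle.EraseBeadOk
    (sixTangleBeads o) (sixTangleBead o)
    (1 : Fin 2) 0
    (muFun sixTangleBeadsTable sixTangleBeadTable 4 o
      [0, 1, 2, 3, 4, 5, 6, 7, 8, 9, 10, 11, 12, 13, 14, 15, 16, 17, 18, 19, 20, 21, 22, 23, 24,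
       25, 16, 21])
    (gFun sixTangleBeadsTable sixTangleBeadTable 4 o
      [0, 1, 2, 3, 4, 5, 6, 7, 8, 9, 10, 11, 12, 13, 14, 15, 16, 17, 18, 19, 20, 21, 22, 23, 24,
       25])
    (psiFun sixTangleBeadsTable sixTangleBeadTable (by decide) [0, 1, 2, 3, 4]) from by
      revert o; decide +kernel)

lemma sixTangleBead_equivalent_sixTangle (o : ZMod 4) :
    (sixTangleBead o).Equivalent (sixTangle o) :=
  Tangle.EraseBeadOk.equivalent (show Tangle.EraseBeadOk
    (sixTangleBead o) (sixTangle o)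
    (0 : Fin 1) 0
    (muFun sixTangleBeadTable sixTangleTable 4 o
      [0, 1, 2, 3, 4, 5, 6, 7, 8, 9, 10, 11, 12, 13, 14, 15, 16, 17, 18, 19, 20, 21, 22, 23, 19,
       14])
    (gFun sixTangleBeadTable sixTangleTable 4 o
      [0, 1, 2, 3, 4, 5, 6, 7, 8, 9, 10, 11, 12, 13, 14, 15, 16, 17, 18, 19, 20, 21, 22, 23])
    (psiFun sixTangleBeadTable sixTangleTable (by decide) [0, 1, 2, 3, 4]) from by
      revert o; decide +kernel)

lemma sixTangle_equivalent_sixTangleSlid (o : ZMod 4) :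
    (sixTangle o).Equivalent (sixTangleSlid o) :=
  Tangle.Omega3Ok.equivalent (show Tangle.Omega3Ok
    (sixTangle o) (sixTangleSlid o)
    (fun k => (![4, 1, 5] : ZMod 3 → Fin 6) (if o.val % 2 = 0 then k else k + (1 : ZMod 3)))
    (fun k => (![0, 3, 0] : ZMod 3 → ZMod 4) (if o.val % 2 = 0 then k else k + (1 : ZMod 3)) + o)
    (fun k => (![4, 1, 5] : ZMod 3 → Fin 6) (if o.val % 2 = 0 then k else k + (1 : ZMod 3)))
    (fun k => (![0, 3, 0] : ZMod 3 → ZMod 4) (if o.val % 2 = 0 then k else k + (1 : ZMod 3)) + o)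
    (2 : Fin 5) (2 : Fin 5)
    (muFun sixTangleTable sixTangleSlidTable 4 o
      [0, 1, 2, 3, 999, 19, 22, 999, 8, 9, 10, 11, 12, 13, 14, 15, 999, 999, 23, 5, 999, 999, 6,
       18])
    (gFun sixTangleTable sixTangleSlidTable 4 o
      [0, 1, 2, 3, 999, 999, 999, 999, 8, 9, 10, 11, 12, 13, 14, 15, 999, 999, 999, 999, 999, 999,
       999, 999])
    (psiFun sixTangleTable sixTangleSlidTable (by decide) [0, 1, 2, 4, 3]) from by
      revert o; decide +kernel)

lemma sixTangleSlid_equivalent_fourTangleBeads (o : ZMod 4) :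
    (sixTangleSlid o).Equivalent (fourTangleBeads o) :=
  Tangle.Omega2Ok.equivalent (show Tangle.Omega2Ok
    (sixTangleSlid o) (fourTangleBeads o)
    (4 : Fin 6) (2 : Fin 6) (2 + o) (3 + o) (0 : Fin 2) (1 : Fin 2) (1 : Fin 5) (0 : Fin 5)
    (muFun sixTangleSlidTable fourTangleBeadsTable 4 o
      [0, 1, 2, 3, 4, 5, 6, 7, 999, 19, 17, 999, 8, 9, 10, 11, 16, 18, 999, 999, 12, 13, 14, 15])
    (gFun sixTangleSlidTable fourTangleBeadsTable 4 o
      [0, 1, 2, 3, 4, 5, 6, 7, 12, 13, 14, 15, 20, 21, 22, 23, 999, 999, 999, 999])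
    (psiFun sixTangleSlidTable fourTangleBeadsTable (by decide) [2, 3, 4]) from by
      revert o; decide +kernel)

lemma fourTangleBeads_equivalent_fourTangleBead (o : ZMod 4) :
    (fourTangleBeads o).Equivalent (fourTangleBead o) :=
  Tangle.EraseBeadOk.equivalent (show Tangle.EraseBeadOk
    (fourTangleBeads o) (fourTangleBead o)
    (1 : Fin 2) 0
    (muFun fourTangleBeadsTable fourTangleBeadTable 4 o
      [0, 1, 2, 3, 4, 5, 6, 7, 8, 9, 10, 11, 12, 13, 14, 15, 16, 17, 0, 7])
    (gFun fourTangleBeadsTable fourTangleBeadTable 4 o [0, 1, 2, 3, 4, 5, 6, 7, 8, 9, 10, 11, 12, 13, 14, 15, 16, 17])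
    (psiFun fourTangleBeadsTable fourTangleBeadTable (by decide) [0, 1, 2]) from by
      revert o; decide +kernel)

lemma fourTangleBead_equivalent_fourTangle (o : ZMod 4) :
    (fourTangleBead o).Equivalent (fourTangle o) :=
  Tangle.EraseBeadOk.equivalent (show Tangle.EraseBeadOk
    (fourTangleBead o) (fourTangle o)
    (0 : Fin 1) 0
    (muFun fourTangleBeadTable fourTangleTable 4 o [0, 1, 2, 3, 4, 5, 6, 7, 8, 9, 10, 11, 12, 13, 14, 15, 3, 13])
    (gFun fourTangleBeadTable fourTangleTable 4 o [0, 1, 2, 3, 4, 5, 6, 7, 8, 9, 10, 11, 12, 13, 14, 15])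
    (psiFun fourTangleBeadTable fourTangleTable (by decide) [0, 1, 2]) from by
      revert o; decide +kernel)

lemma fourTangle_equivalent_fourTangleSlid (o : ZMod 4) :
    (fourTangle o).Equivalent (fourTangleSlid o) :=
  Tangle.Omega3Ok.equivalent (show Tangle.Omega3Ok
    (fourTangle o) (fourTangleSlid o)
    (fun k => (![3, 0, 1] : ZMod 3 → Fin 4) (if o.val % 2 = 0 then k else k + (2 : ZMod 3)))
    (fun k => (![0, 3, 3] : ZMod 3 → ZMod 4) (if o.val % 2 = 0 then k else k + (2 : ZMod 3)) + o)
    (fun k => (![3, 0, 1] : ZMod 3 → Fin 4) (if o.val % 2 = 0 then k else k + (2 : ZMod 3)))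
    (fun k => (![0, 3, 3] : ZMod 3 → ZMod 4) (if o.val % 2 = 0 then k else k + (2 : ZMod 3)) + o)
    (0 : Fin 3) (0 : Fin 3)
    (muFun fourTangleTable fourTangleSlidTable 4 o
      [999, 15, 5, 999, 999, 2, 14, 999, 8, 9, 10, 11, 999, 999, 6, 1])
    (gFun fourTangleTable fourTangleSlidTable 4 o
      [999, 999, 999, 999, 999, 999, 999, 999, 8, 9, 10, 11, 999, 999, 999, 999])
    (psiFun fourTangleTable fourTangleSlidTable (by decide) [0, 2, 1]) from by
      revert o; decide +kernel)

lemma fourTangleSlid_equivalent_twoTangleBeads (o : ZMod 4) :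
    (fourTangleSlid o).Equivalent (twoTangleBeads o) :=
  Tangle.Omega2Ok.equivalent (show Tangle.Omega2Ok
    (fourTangleSlid o) (twoTangleBeads o)
    (2 : Fin 4) (0 : Fin 4) (2 + o) (1 + o) (0 : Fin 2) (1 : Fin 2) (2 : Fin 3) (0 : Fin 3)
    (muFun fourTangleSlidTable twoTangleBeadsTable 4 o [9, 999, 999, 11, 0, 1, 2, 3, 8, 10, 999, 999, 4, 5, 6, 7])
    (gFun fourTangleSlidTable twoTangleBeadsTable 4 o [4, 5, 6, 7, 12, 13, 14, 15, 999, 999, 999, 999])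
    (psiFun fourTangleSlidTable twoTangleBeadsTable (by decide) [1]) from by
      revert o; decide +kernel)

lemma twoTangleBeads_equivalent_twoTangleBead (o : ZMod 4) :
    (twoTangleBeads o).Equivalent (twoTangleBead o) :=
  Tangle.EraseBeadOk.equivalent (show Tangle.EraseBeadOk
    (twoTangleBeads o) (twoTangleBead o)
    (1 : Fin 2) 0
    (muFun twoTangleBeadsTable twoTangleBeadTable 4 o [0, 1, 2, 3, 4, 5, 6, 7, 8, 9, 5, 6])
    (gFun twoTangleBeadsTable twoTangleBeadTable 4 o [0, 1, 2, 3, 4, 5, 6, 7, 8, 9])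
    (psiFun twoTangleBeadsTable twoTangleBeadTable (by decide) [0]) from by
      revert o; decide +kernel)

lemma twoTangleBead_equivalent_twoTangle (o : ZMod 4) :
    (twoTangleBead o).Equivalent (twoTangle o) :=
  Tangle.EraseBeadOk.equivalent (show Tangle.EraseBeadOk
    (twoTangleBead o) (twoTangle o)
    (0 : Fin 1) 1
    (muFun twoTangleBeadTable twoTangleTable 4 o [0, 1, 2, 3, 4, 5, 6, 7, 3, 11])
    (gFun twoTangleBeadTable twoTangleTable 4 o [0, 1, 2, 3, 4, 5, 6, 7])
    (psiFun twoTangleBeadTable twoTangleTable (by decide) [0]) from by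
      revert o; decide +kernel)

lemma twoTangle_equivalent_crossingTangleBead (o : ZMod 4) :
    (twoTangle o).Equivalent (crossingTangleBead o) :=
  Tangle.Omega1Ok.equivalent (show Tangle.Omega1Ok
    (twoTangle o) (crossingTangleBead o)
    (1 : Fin 2) (1 + o) (0 : Fin 1) (0 : Fin 1)
    (muFun twoTangleTable crossingTangleBeadTable 4 o [0, 1, 2, 3, 5, 999, 999, 4])
    (gFun twoTangleTable crossingTangleBeadTable 4 o [0, 1, 2, 3, 999, 999])
    (psiFun twoTangleTable crossingTangleBeadTable (by decide) []) from by
      revert o; decide +kernel)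

lemma crossingTangleBead_equivalent_crossingTangle (o : ZMod 4) :
    (crossingTangleBead o).Equivalent (crossingTangle o) :=
  Tangle.EraseBeadOk.equivalent (show Tangle.EraseBeadOk
    (crossingTangleBead o) (crossingTangle o)
    (0 : Fin 1) 1
    (muFun crossingTangleBeadTable crossingTangleTable 4 o [0, 1, 2, 3, 0, 4])
    (gFun crossingTangleBeadTable crossingTangleTable 4 o [0, 1, 2, 3])
    (psiFun crossingTangleBeadTable crossingTangleTable (by decide) []) from by
      revert o; decide +kernel)

/-- The number of crossings runs through 7, 8, 6, 4, 2, 1. The initial increase is the obstacle that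
nonincreasing moves cannot overcome. -/
lemma crossingTangle_equivalent_sevenTangle (o : ZMod 4) :
    (crossingTangle o).Equivalent (sevenTangle o) := by
  refine Relation.EqvGen.symm _ _ ?_
  refine Relation.EqvGen.trans _ _ _ ((sevenTangleBead_equivalent_sevenTangle o).symm) ?_
  refine Relation.EqvGen.trans _ _ _ ((eightTangle_equivalent_sevenTangleBead o).symm) ?_
  refine Relation.EqvGen.trans _ _ _ (eightTangle_equivalent_eightTangleSlid o) ?_
  refine Relation.EqvGen.trans _ _ _ (eightTangleSlid_equivalent_eightTangleClasped o) ?_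
  refine Relation.EqvGen.trans _ _ _ (eightTangleClasped_equivalent_sixTangleBeads o) ?_
  refine Relation.EqvGen.trans _ _ _ (sixTangleBeads_equivalent_sixTangleBead o) ?_
  refine Relation.EqvGen.trans _ _ _ (sixTangleBead_equivalent_sixTangle o) ?_
  refine Relation.EqvGen.trans _ _ _ (sixTangle_equivalent_sixTangleSlid o) ?_
  refine Relation.EqvGen.trans _ _ _ (sixTangleSlid_equivalent_fourTangleBeads o) ?_
  refine Relation.EqvGen.trans _ _ _ (fourTangleBeads_equivalent_fourTangleBead o) ?_
  refine Relation.EqvGen.trans _ _ _ (fourTangleBead_equivalent_fourTangle o) ?_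
  refine Relation.EqvGen.trans _ _ _ (fourTangle_equivalent_fourTangleSlid o) ?_
  refine Relation.EqvGen.trans _ _ _ (fourTangleSlid_equivalent_twoTangleBeads o) ?_
  refine Relation.EqvGen.trans _ _ _ (twoTangleBeads_equivalent_twoTangleBead o) ?_
  refine Relation.EqvGen.trans _ _ _ (twoTangleBead_equivalent_twoTangle o) ?_
  refine Relation.EqvGen.trans _ _ _ (twoTangle_equivalent_crossingTangleBead o) ?_
  exact crossingTangleBead_equivalent_crossingTangle o


open TangleTable

/-! ### The bead and the kink as tangles with two ends -/

/-- The table of a single bead. -/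
abbrev beadTable : TangleTable where
  n := 0
  m := 1
  r := 0
  edge := [2, 3, 0, 1]
  lab := [0, 1]
  rank := [0]

lemma beadTable_ok : beadTable.Ok 2 0 := by decide +kernel

/-- A single bead. -/
abbrev beadTangle : Tangle 2 := Tangle.ofTable beadTable 2 0 beadTable_ok

/-- The table of an arc with one kink. -/
abbrev kinkTable : TangleTable where
  n := 1
  m := 0
  r := 1
  edge := [1, 0, 4, 5, 2, 3]
  lab := [0, 2, 1, 2]
  rank := [0]

lemma kinkTable_ok : kinkTable.Ok 2 0 := by decide +kernel

/-- An arc with one kink. -/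
abbrev kinkTangle : Tangle 2 := Tangle.ofTable kinkTable 2 0 kinkTable_ok

lemma beadTangle_equivalent_kinkTangle : beadTangle.Equivalent kinkTangle :=
  Relation.EqvGen.symm _ _ (Tangle.Omega1Ok.equivalent
    (show Tangle.Omega1Ok kinkTangle beadTangle (0 : Fin 1) 0 (0 : Fin 1) (0 : Fin 1)
      (muFun kinkTable beadTable 2 0 [999, 999, 0, 1]) (gFun kinkTable beadTable 2 0 [999, 999])
      (psiFun kinkTable beadTable (by decide) []) from by decide +kernel))

/-- The end `e` leads to the dart `e + o`, in agreement with `endsEquiv`. Together these make the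
insertion of single crossings trivial for every rotation. -/
lemma crossing_edge (o : ZMod 4) (e : ZMod 4) :
    (crossingTangle o).edge (Sum.inl e) = Sum.inr (Sum.inl ((0 : Fin 1), e + o)) := by
  revert o e; decide +kernel

lemma bead_edge (e : ZMod 2) :
    beadTangle.edge (Sum.inl e) = Sum.inr (Sum.inr ((0 : Fin 1), e)) := by
  revert e; decide +kernel

/-! ### Inserting tangles at the crossings and beads of a diagram -/

namespace LinkDiagram

variable (X : LinkDiagram) (k : X.Crossing → ZMod 4)

/-- The number of darts at a vertex. -/
def valence : X.Crossing ⊕ X.Bead → ℕ := Sum.elim (fun _ => 4) (fun _ => 2)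

/-- The darts of a diagram as ends of the vertices, where the ends at a crossing `v` are rotated by
`k v`. -/
def endsEquiv : (Σ s, ZMod (X.valence s)) ≃ X.D where
  toFun
    | ⟨Sum.inl v, e⟩ => X.cr v ((show ZMod 4 from e) + k v)
    | ⟨Sum.inr b, e⟩ => X.bd b (show ZMod 2 from e)
  invFun
    | Sum.inl (v, i) => ⟨Sum.inl v, (i - k v : ZMod 4)⟩
    | Sum.inr (b, i) => ⟨Sum.inr b, i⟩
  left_inv := by
    rintro ⟨v | b, e⟩
    · exact congrArg (Sigma.mk (Sum.inl v)) (add_sub_cancel_right (show ZMod 4 from e) (k v))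
    · rfl
  right_inv := by
    rintro (⟨v, i⟩ | ⟨b, i⟩)
    · exact congrArg (X.cr v) (sub_add_cancel i (k v))
    · rfl

lemma endsEquiv_add_one (s : X.Crossing ⊕ X.Bead) (e : ZMod (X.valence s)) :
    X.endsEquiv k ⟨s, e + 1⟩ = rot (X.endsEquiv k ⟨s, e⟩) := by
  rcases s with v | b
  · exact congrArg (X.cr v) (add_right_comm (show ZMod 4 from e) 1 (k v))
  · rfl

lemma componentSetoid_of_rot {V B : Type} {edge : Dart V B → Dart V B} (c : Dart V B) :
    componentSetoid edge c (rot c) := Relation.EqvGen.rel _ _ (Or.inl rfl)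

lemma componentSetoid_cr (v : X.Crossing) (i j : ZMod 4) :
    componentSetoid X.edge (X.cr v i) (X.cr v j) := by
  have h : ∀ i : ZMod 4, componentSetoid X.edge (X.cr v i) (X.cr v (i + 1)) :=
    fun i => componentSetoid_of_rot (X.cr v i)
  have h2 : ∀ i : ZMod 4, componentSetoid X.edge (X.cr v i) (X.cr v (i + 2)) := by
    intro i
    have := Setoid.trans' _ (h i) (h (i + 1))
    rwa [add_assoc] at this
  have h3 : ∀ i : ZMod 4, componentSetoid X.edge (X.cr v i) (X.cr v (i + 3)) := by
    intro i
    have := Setoid.trans' _ (h2 i) (h (i + 2))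
    rwa [add_assoc] at this
  rcases zmod_four_eq i j with rfl | rfl | rfl | rfl
  exacts [Setoid.refl' _ _, h _, h2 _, h3 _]

lemma componentSetoid_bd (b : X.Bead) (i j : ZMod 2) :
    componentSetoid X.edge (X.bd b i) (X.bd b j) := by
  rcases zmod_two_eq' i j with rfl | rfl
  exacts [Setoid.refl' _ _, componentSetoid_of_rot _]

lemma comap_componentSetoid : Setoid.comap (X.endsEquiv k) (componentSetoid X.edge) =
    Relation.EqvGen.setoid
      (fun c d => c.1 = d.1 ∨ d = (X.endsEquiv k).symm (X.edge (X.endsEquiv k c))) := by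
  apply le_antisymm
  · have key : ∀ c d, componentSetoid X.edge c d → Relation.EqvGen
        (fun c d => c.1 = d.1 ∨ d = (X.endsEquiv k).symm (X.edge (X.endsEquiv k c)))
        ((X.endsEquiv k).symm c) ((X.endsEquiv k).symm d) := by
      intro c d h
      replace h : Relation.EqvGen _ c d := h
      induction h with
      | rel c d h =>
        apply Relation.EqvGen.rel
        rcases h with rfl | rfl
        · left
          rcases c with ⟨v, i⟩ | ⟨b, i⟩ <;> rfl
        · right
          rw [Equiv.apply_symm_apply]
      | refl x => exact Relation.EqvGen.refl _
      | symm x y _ ih => exact ih.symm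
      | trans x y z _ _ h1 h2 => exact h1.trans _ _ _ h2
    intro c d h
    have := key _ _ h
    rwa [Equiv.symm_apply_apply, Equiv.symm_apply_apply] at this
  · apply Setoid.eqvGen_le
    rintro ⟨s, e⟩ ⟨t, e'⟩ (h | h)
    · obtain rfl : s = t := h
      rcases s with v | b
      · exact X.componentSetoid_cr v _ _
      · exact X.componentSetoid_bd b _ _
    · rw [h]
      show componentSetoid X.edge _ (X.endsEquiv k _)
      rw [Equiv.apply_symm_apply]
      exact Relation.EqvGen.rel _ _ (Or.inr rfl)

/-- The plane graph underlying a diagram. -/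
def host : Host where
  S := X.Crossing ⊕ X.Bead
  finite_site := by have := X.finite_crossing; have := X.finite_bead; infer_instance
  val := X.valence
  val_ne := by rintro (v | b) <;> simp [valence]
  nonempty := X.nonempty.map (Sum.elim (fun x => Sum.inl x.1) (fun x => Sum.inr x.1))
  edge d := (X.endsEquiv k).symm (X.edge (X.endsEquiv k d))
  edge_edge d := by simp [X.edge_edge]
  edge_ne d h := X.edge_ne (X.endsEquiv k d) ((X.endsEquiv k).symm_apply_eq.1 h)
  region := Setoid.comap (X.endsEquiv k) X.region
  region_face s e := by
    show X.region _ (X.endsEquiv k ((X.endsEquiv k).symm _))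
    rw [Equiv.apply_symm_apply, endsEquiv_add_one]
    exact X.region_face _
  comp := Setoid.comap (X.endsEquiv k) (componentSetoid X.edge)
  comp_eq := X.comap_componentSetoid k
  sphere_connected c d := by
    have h := X.sphere_connected (X.endsEquiv k c) (X.endsEquiv k d)
    set f := X.endsEquiv k
    have h' : componentSetoid X.edge ⊔ X.region ≤ Setoid.comap f.symm
        (Setoid.comap f (componentSetoid X.edge) ⊔ Setoid.comap f X.region) := by
      apply sup_le
      · intro a b hab
        apply (le_sup_left : Setoid.comap f (componentSetoid X.edge) ≤ _)
        show componentSetoid X.edge (f (f.symm a)) (f (f.symm b))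
        rwa [f.apply_symm_apply, f.apply_symm_apply]
      · intro a b hab
        apply (le_sup_right : Setoid.comap f X.region ≤ _)
        show X.region (f (f.symm a)) (f (f.symm b))
        rwa [f.apply_symm_apply, f.apply_symm_apply]
    have h2 := h' h
    change (Setoid.comap f (componentSetoid X.edge) ⊔ Setoid.comap f X.region)
      (f.symm (f c)) (f.symm (f d)) at h2
    rwa [f.symm_apply_apply, f.symm_apply_apply] at h2
  euler := by
    have := X.finite_crossing
    have := X.finite_bead
    have e1 : ∀ s : Setoid X.D, Nat.card (Quotient (Setoid.comap (X.endsEquiv k) s)) =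
        Nat.card (Quotient s) := by
      intro s
      refine Nat.card_congr (Quotient.congr (X.endsEquiv k) ?_)
      intro a b
      rfl
    rw [e1, e1, Nat.card_congr (X.endsEquiv k), X.euler, Nat.card_sum, Nat.card_sum, Nat.card_prod,
      Nat.card_prod, Nat.card_zmod, Nat.card_zmod]
    ring

variable {X k}

/-- A choice of tangles for the crossings and for the beads of a diagram. -/
def filling (A : X.Crossing → Tangle 4) (B : Tangle 2) : (X.host k).Filling
  | Sum.inl v => A v
  | Sum.inr _ => B

/-- The diagram that arises by inserting the tangles `A v` at the crossings and `B` at the beads;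
the end `0` of `A v` is attached to the dart `k v` at the crossing `v`. -/
def insert (X : LinkDiagram) (k : X.Crossing → ZMod 4) (A : X.Crossing → Tangle 4)
    (B : Tangle 2) : LinkDiagram :=
  Host.diagram (filling (X := X) (k := k) A B)

lemma insert_link_eq {A A' : X.Crossing → Tangle 4} {B B' : Tangle 2}
    (h : ∀ v, (A v).Equivalent (A' v)) (h' : B.Equivalent B') :
    (X.insert k A B).link = (X.insert k A' B').link := by
  apply Host.link_eq_of_equivalent
  rintro (v | b)
  · exact h v
  · exact h'

lemma numCrossings_insert (A : X.Crossing → Tangle 4) (B : Tangle 2) (n : ℕ)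
    (h : ∀ v, (A v).n = n) :
    (X.insert k A B).numCrossings = n * Nat.card X.Crossing + B.n * Nat.card X.Bead := by
  have := X.finite_crossing
  have := X.finite_bead
  have : Fintype X.Crossing := Fintype.ofFinite _
  have : Fintype X.Bead := Fintype.ofFinite _
  show Nat.card (Σ s : X.Crossing ⊕ X.Bead, Fin (filling (X := X) (k := k) A B s).n) = _
  rw [Nat.card_sigma, Fintype.sum_sum_type]
  simp only [filling, Nat.card_eq_fintype_card, Fintype.card_fin, h, Finset.sum_const,
    Finset.card_univ, smul_eq_mul]
  ring

/-- Inserting single crossings and beads does not change a diagram. -/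
lemma iso_insert : Iso X (X.insert k (fun v => crossingTangle (k v)) beadTangle) := by
  set T : (X.host k).Filling := filling (X := X) (k := k) (fun v => crossingTangle (k v)) beadTangle
  let psi : X.D → Host.FD T := fun d => match d with
    | Sum.inl (v, i) => Host.put T (Sum.inl v) (Sum.inl ((0 : Fin 1), i))
    | Sum.inr (b, i) => Host.put T (Sum.inr b) (Sum.inr ((0 : Fin 1), i))
  have hinj : Function.Bijective psi := by
    constructor
    · rintro (⟨v, i⟩ | ⟨v, i⟩) (⟨w, j⟩ | ⟨w, j⟩) h
      · have h1 := (Host.put_eq_put h)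
        obtain rfl := Sum.inl.inj h1.1
        have h2 := eq_of_heq h1.2
        rw [(Prod.mk.inj (Sum.inl.inj h2)).2]
      · cases (Host.put_eq_put h).1
      · cases (Host.put_eq_put h).1
      · have h1 := (Host.put_eq_put h)
        obtain rfl := Sum.inr.inj h1.1
        have h2 := eq_of_heq h1.2
        rw [(Prod.mk.inj (Sum.inr.inj h2)).2]
    · intro x
      obtain ⟨s, d, rfl⟩ := Host.exists_put x
      rcases s with v | b
      · rcases d with ⟨w, i⟩ | ⟨w, i⟩
        · obtain rfl : w = (0 : Fin 1) := Subsingleton.elim (α := Fin 1) _ _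
          exact ⟨X.cr v i, rfl⟩
        · exact (Fin.elim0 (show Fin 0 from w))
      · rcases d with ⟨w, i⟩ | ⟨w, i⟩
        · exact (Fin.elim0 (show Fin 0 from w))
        · obtain rfl : w = (0 : Fin 1) := Subsingleton.elim (α := Fin 1) _ _
          exact ⟨X.bd b i, rfl⟩
  -- The rotation of the tangle by `k v` cancels the rotation of the host, so the ends land on the
  -- original darts.
  have hout : ∀ x : (Σ s : (X.host k).S, ZMod ((X.host k).val s)),
      Host.put T x.1 ((T x.1).out x.2) = psi (X.endsEquiv k x) := by
    rintro ⟨v | b, e⟩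
    · have h1 := ((crossingTangle (k v)).edge_end e).symm.trans (crossing_edge (k v) e)
      exact congrArg (Host.put T (Sum.inl v)) (Sum.inr.inj h1)
    · have h1 := (beadTangle.edge_end e).symm.trans (bead_edge e)
      exact congrArg (Host.put T (Sum.inr b)) (Sum.inr.inj h1)
  have hedge : ∀ d, psi (X.edge d) = Host.fedge T (psi d) := by
    intro d
    obtain ⟨x, rfl⟩ := (X.endsEquiv k).surjective d
    change (Σ s : (X.host k).S, ZMod ((X.host k).val s)) at x
    rw [← hout x, Host.fedge_put, Host.edge_out]
    refine Eq.trans ?_ (hout ((X.host k).edge x)).symm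
    exact congrArg psi ((X.endsEquiv k).apply_symm_apply _).symm
  have hlab : ∀ x : (Σ s : (X.host k).S, ZMod ((X.host k).val s)),
      Host.flab T (psi (X.endsEquiv k x)) = Sum.inl (Quotient.mk (X.host k).region x) := by
    intro x
    rw [← hout x, Host.flab_put, (T x.1).lab_out]
    rfl
  refine ⟨Equiv.ofBijective psi hinj, ?_, hedge, ?_, ?_⟩
  · rintro (⟨v, i⟩ | ⟨v, i⟩) <;> rfl
  · rintro (⟨v, i⟩ | ⟨v, i⟩) <;> rfl
  · intro c d
    obtain ⟨x, rfl⟩ := (X.endsEquiv k).surjective c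
    obtain ⟨y, rfl⟩ := (X.endsEquiv k).surjective d
    show _ ↔ Host.flab T (psi _) = Host.flab T (psi _)
    rw [show Host.flab T (psi (X.endsEquiv k x)) = _ from hlab x,
      show Host.flab T (psi (X.endsEquiv k y)) = _ from hlab y]
    constructor
    · intro h
      have h' : (X.host k).region x y := h
      exact congrArg Sum.inl (Quotient.sound h')
    · intro h
      exact Quotient.exact (s := (X.host k).region) (Sum.inl.inj h)

lemma Iso.link_eq {X Y : LinkDiagram} (h : Iso X Y) : X.link = Y.link :=
  Quotient.sound (Relation.EqvGen.rel _ _ (Or.inl (Or.inl h)))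

/-- Replacing every crossing by the tangle with seven crossings does not change the link. -/
lemma link_insert_seven : (X.insert k (fun v => sevenTangle (k v)) beadTangle).link = X.link := by
  rw [(iso_insert (X := X) (k := k)).link_eq]
  exact insert_link_eq (fun v => (crossingTangle_equivalent_sevenTangle (k v)).symm)
    (Relation.EqvGen.refl _)

/-- Inserting a kink at every bead does not change the link. -/
lemma link_insert_kink :
    (X.insert k (fun v => crossingTangle (k v)) kinkTangle).link = X.link := by
  rw [(iso_insert (X := X) (k := k)).link_eq]
  exact insert_link_eq (fun v => Relation.EqvGen.refl _) beadTangle_equivalent_kinkTangle.symm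

end LinkDiagram


/-! ### Diagrams that admit no simplifying move -/

/-- The dart starts at a crossing. -/
def IsCrossingDart {V B : Type} (d : Dart V B) : Prop := rot (rot d) ≠ d

lemma isCrossingDart_inl {V B : Type} (v : V) (i : ZMod 4) :
    IsCrossingDart (Sum.inl (v, i) : Dart V B) := by
  intro h
  have h1 : i + 1 + 1 = i := (Prod.mk.inj (Sum.inl.inj h)).2
  exact absurd h1 (by clear h h1; revert i; decide)

lemma rot_rot_inr {V B : Type} (b : B) (i : ZMod 2) :
    rot (rot (Sum.inr (b, i) : Dart V B)) = Sum.inr (b, i) :=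
  congrArg (fun j => Sum.inr (b, j)) (show i + 1 + 1 = i by revert i; decide)

lemma IsCrossingDart.exists_inl {V B : Type} {d : Dart V B} (h : IsCrossingDart d) :
    ∃ v i, d = Sum.inl (v, i) := by
  rcases d with ⟨v, i⟩ | ⟨b, i⟩
  · exact ⟨v, i, rfl⟩
  · exact absurd (rot_rot_inr b i) h

lemma IsCrossingDart.rot {V B : Type} {d : Dart V B} (h : IsCrossingDart d) :
    IsCrossingDart (rot d) := by
  obtain ⟨v, i, rfl⟩ := h.exists_inl
  exact isCrossingDart_inl _ _

namespace LinkDiagram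

/-- The dart `y` is one of the darts at which the arc that starts with the dart `x` arrives, if one
walks through beads. -/
inductive Arc (X : LinkDiagram) (x : X.D) : X.D → Prop
  | base : Arc X x (X.edge x)
  | step {y : X.D} : Arc X x y → rot (rot y) = y → Arc X x (X.edge (rot y))

/-- The number of corners of crossings in the region of `c`. -/
noncomputable def corners (X : LinkDiagram) (c : X.D) : ℕ :=
  Set.ncard {d : X.D | IsCrossingDart d ∧ X.region c d}

/-- Every region with a crossing on its boundary has at least two corners, and if it has at most
three corners, then the strands along its boundary alternate. -/
def Stuck (X : LinkDiagram) : Prop :=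
  ∀ c, IsCrossingDart c → 2 ≤ X.corners c ∧
    (X.corners c ≤ 3 → ∀ e, IsCrossingDart e → X.Arc (rot c) e → ¬ (IsOver (rot c) ↔ IsOver e))

/-- The relation `r` identifies the crossings of two diagrams that differ only in their beads. -/
structure Similar (X Y : LinkDiagram) (r : X.D → Y.D → Prop) : Prop where
  total : ∀ c, IsCrossingDart c → ∃ d, r c d
  surj : ∀ d, IsCrossingDart d → ∃ c, r c d
  dom : ∀ c d, r c d → IsCrossingDart c
  cod : ∀ c d, r c d → IsCrossingDart d
  right_unique : ∀ c d d', r c d → r c d' → d = d'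
  left_unique : ∀ c c' d, r c d → r c' d → c = c'
  rot : ∀ c d, r c d → r (rot c) (rot d)
  isOver : ∀ c d, r c d → (IsOver c ↔ IsOver d)
  region : ∀ c d c' d', r c d → r c' d' → (X.region c c' ↔ Y.region d d')
  arc : ∀ c d c' d', r c d → r c' d' → (X.Arc c c' ↔ Y.Arc d d')

namespace Similar

variable {X Y : LinkDiagram} {r : X.D → Y.D → Prop}

lemma symm (h : Similar X Y r) : Similar Y X (fun d c => r c d) where
  total := h.surj
  surj := h.total
  dom d c := h.cod c d
  cod d c := h.dom c d
  right_unique d c c' := h.left_unique c c' d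
  left_unique d d' c := h.right_unique c d d'
  rot d c := h.rot c d
  isOver d c hr := (h.isOver c d hr).symm
  region d c d' c' h1 h2 := (h.region c d c' d' h1 h2).symm
  arc d c d' c' h1 h2 := (h.arc c d c' d' h1 h2).symm

lemma ncard_eq (h : Similar X Y r) (p : X.D → Prop) (q : Y.D → Prop)
    (hpq : ∀ c d, r c d → (p c ↔ q d)) :
    Set.ncard {c : X.D | IsCrossingDart c ∧ p c} =
      Set.ncard {d : Y.D | IsCrossingDart d ∧ q d} := by
  choose f hf using h.total
  refine Set.ncard_congr (fun c hc => f c hc.1) ?_ ?_ ?_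
  · intro c hc
    exact ⟨h.cod _ _ (hf c hc.1), (hpq _ _ (hf c hc.1)).1 hc.2⟩
  · intro c c' hc hc' he
    have h1 := hf c hc.1
    rw [show f c hc.1 = _ from he] at h1
    exact h.left_unique _ _ _ h1 (hf c' hc'.1)
  · intro d hd
    obtain ⟨c, hc⟩ := h.surj d hd.1
    have hc' := h.dom _ _ hc
    exact ⟨c, ⟨hc', (hpq _ _ hc).2 hd.2⟩, h.right_unique _ _ _ (hf c hc') hc⟩

lemma corners_eq (h : Similar X Y r) {c : X.D} {d : Y.D} (hr : r c d) :
    X.corners c = Y.corners d :=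
  h.ncard_eq _ _ fun _ _ hr' => h.region _ _ _ _ hr hr'

/-- Being stuck is expressed through crossing darts, regions, arcs and over-strands only, and
`Similar` preserves all of these while ignoring beads. -/
lemma stuck (h : Similar X Y r) (hX : X.Stuck) : Y.Stuck := by
  intro d hd
  obtain ⟨c, hc⟩ := h.surj d hd
  obtain ⟨h1, h2⟩ := hX c (h.dom _ _ hc)
  rw [h.corners_eq hc] at h1 h2
  refine ⟨h1, fun h3 e he ha => ?_⟩
  obtain ⟨e', he'⟩ := h.surj e he
  rw [← h.isOver _ _ he', ← h.isOver _ _ (h.rot _ _ hc)]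
  exact h2 h3 e' (h.dom _ _ he') ((h.arc _ _ _ _ (h.rot _ _ hc) he').2 ha)

end Similar

lemma four_mul_numCrossings (X : LinkDiagram) :
    4 * X.numCrossings = Set.ncard {c : X.D | IsCrossingDart c ∧ True} := by
  have h : {c : X.D | IsCrossingDart c ∧ True} =
      Set.range (Sum.inl : X.Crossing × ZMod 4 → X.D) := by
    ext c
    constructor
    · rintro ⟨h, -⟩
      obtain ⟨v, i, rfl⟩ := h.exists_inl
      exact ⟨(v, i), rfl⟩
    · rintro ⟨⟨v, i⟩, rfl⟩
      exact ⟨isCrossingDart_inl v i, trivial⟩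
  rw [h, ← Nat.card_coe_set_eq,
    ← Nat.card_congr (Equiv.ofInjective _ (Sum.inl_injective (α := X.Crossing × ZMod 4))),
    Nat.card_prod, Nat.card_zmod, numCrossings, mul_comm]

lemma Similar.numCrossings_eq {X Y : LinkDiagram} {r : X.D → Y.D → Prop} (h : Similar X Y r) :
    X.numCrossings = Y.numCrossings := by
  have h1 := X.four_mul_numCrossings
  rw [h.ncard_eq _ (fun _ => True) (fun _ _ _ => Iff.rfl), ← Y.four_mul_numCrossings] at h1
  omega

/-- An isotopy is given as a bijection of darts, not of crossings, but it commutes with `rot`. The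
order of a dart under `rot` distinguishes crossings from beads. -/
lemma isCrossingDart_iff_of_equiv {V B V' B' : Type} (f : Dart V B ≃ Dart V' B')
    (h : ∀ d, f (rot d) = rot (f d)) (d : Dart V B) : IsCrossingDart d ↔ IsCrossingDart (f d) := by
  unfold IsCrossingDart
  rw [← h, ← h, Ne, Ne, f.apply_eq_iff_eq]

lemma Iso.similar {X Y : LinkDiagram} (h : Iso X Y) : ∃ r, Similar X Y r := by
  obtain ⟨f, h1, h2, h3, h4⟩ := h
  have h5 := isCrossingDart_iff_of_equiv f h1
  refine ⟨fun c d => IsCrossingDart c ∧ f c = d, ?_⟩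
  constructor
  · intro c hc; exact ⟨f c, hc, rfl⟩
  · intro d hd; exact ⟨f.symm d, by rw [h5, f.apply_symm_apply]; exact hd, f.apply_symm_apply d⟩
  · rintro c d ⟨h, -⟩; exact h
  · rintro c d ⟨h, rfl⟩; exact (h5 c).1 h
  · rintro c d d' ⟨-, rfl⟩ ⟨-, rfl⟩; rfl
  · rintro c c' d ⟨-, rfl⟩ ⟨-, h⟩; exact (f.injective h).symm
  · rintro c d ⟨h, rfl⟩; exact ⟨h.rot, h1 c⟩
  · rintro c d ⟨-, rfl⟩; exact h3 c
  · rintro c d c' d' ⟨-, rfl⟩ ⟨-, rfl⟩; exact h4 c c'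
  · rintro c d c' d' ⟨-, rfl⟩ ⟨-, rfl⟩
    constructor
    · intro h
      induction h with
      | base => rw [h2]; exact Arc.base
      | step _ hy ih => rw [h2, h1]; exact Arc.step ih (by rw [← h1, ← h1, hy])
    · intro h
      have key : ∀ y, Y.Arc (f c) y → X.Arc c (f.symm y) := by
        intro y hy
        induction hy with
        | base => rw [← h2, f.symm_apply_apply]; exact Arc.base
        | @step y _ hy ih =>
          obtain ⟨z, rfl⟩ := f.surjective y
          rw [f.symm_apply_apply] at ih
          rw [← h1, ← h2, f.symm_apply_apply]
          exact Arc.step ih (f.injective (by rw [h1, h1, hy]))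
      have := key _ h
      rwa [f.symm_apply_apply] at this

/-- Crossings, corners and regions are carried over by `M`. Only arcs need care, since a walk in `X`
makes one more stop, at the erased bead. -/
lemma EraseBead.similar {X Y : LinkDiagram} (h : EraseBead X Y) : ∃ r, Similar X Y r := by
  obtain ⟨b, y, hb, h⟩ := h
  obtain ⟨I, hI⟩ : ∃ I : Set X.D, I = {d | ∃ i, d = X.bd b i} := ⟨_, rfl⟩
  rw [← hI] at h
  obtain ⟨f, hrot, hover, M, hM, hMe, hMr⟩ := h
  have hmem : ∀ d, d ∈ I ↔ ∃ i, d = X.bd b i := fun d => by rw [hI]; rfl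
  have hM0 : M (X.bd b 0) y := (hM _ _).2 (Or.inr ⟨0, rfl, rfl⟩)
  have hM1 : M (X.bd b 1) (Y.edge y) := (hM _ _).2 (Or.inr ⟨1, rfl, rfl⟩)
  have hne : X.bd b 0 ≠ X.bd b 1 := by
    intro h
    have := (Prod.mk.inj (Sum.inr.inj h)).2
    exact absurd this (by decide)
  have hpI : ∀ k, (![X.bd b 0, X.bd b 1] : Fin 2 → X.D) k ∈ I := by
    intro k; fin_cases k
    exacts [(hmem _).2 ⟨0, rfl⟩, (hmem _).2 ⟨1, rfl⟩]
  have hMf : ∀ d (hd : d ∉ I) e, M d e ↔ (f ⟨d, hd⟩).1 = e := by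
    intro d hd e
    rw [hM]
    constructor
    · rintro (⟨_, h⟩ | ⟨k, h, -⟩)
      · exact h
      · exact absurd (h ▸ hpI k) hd
    · intro h; exact Or.inl ⟨hd, h⟩
  have hM0' : ∀ e, M (X.bd b 0) e → e = y := by
    intro e he
    rcases (hM _ _).1 he with ⟨h, -⟩ | ⟨k, h, h'⟩
    · exact absurd (hpI 0) h
    · fin_cases k
      · exact h'.symm
      · exact absurd h.symm hne
  have hM1' : ∀ e, M (X.bd b 1) e → e = Y.edge y := by
    intro e he
    rcases (hM _ _).1 he with ⟨h, -⟩ | ⟨k, h, h'⟩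
    · exact absurd (hpI 1) h
    · fin_cases k
      · exact absurd h hne
      · exact h'.symm
  have hIrot : ∀ d, d ∉ I → rot d ∉ I := by
    intro d hd hi
    rw [hmem] at hi hd
    obtain ⟨i, hi⟩ := hi
    apply hd
    rcases d with ⟨v, j⟩ | ⟨b', j⟩
    · cases hi
    · have := (Prod.mk.inj (Sum.inr.inj hi)).1
      exact ⟨j, by rw [← this]; rfl⟩
  have hMrot : ∀ d e, d ∉ I → M d e → M (rot d) (rot e) := by
    intro d e hd he
    rw [hMf d hd] at he
    rw [hMf _ (hIrot d hd), ← he]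
    exact (hrot ⟨d, hd⟩ ⟨rot d, hIrot d hd⟩ rfl).symm
  have hMinj : ∀ d d' e, d ∉ I → d' ∉ I → M d e → M d' e → d = d' := by
    intro d d' e hd hd' h h'
    rw [hMf _ hd] at h
    rw [hMf _ hd'] at h'
    exact congrArg Subtype.val (f.injective (Subtype.ext (h.trans h'.symm)))
  have hsurj : ∀ e, ∃ d, d ∉ I ∧ M d e := by
    intro e
    have := f.apply_symm_apply ⟨e, id⟩
    exact ⟨(f.symm ⟨e, id⟩).1, (f.symm ⟨e, id⟩).2, (hMf _ (f.symm ⟨e, id⟩).2 _).2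
      (congrArg Subtype.val this)⟩
  have hcI : ∀ d : X.D, IsCrossingDart d → d ∉ I := by
    intro d hd h
    obtain ⟨i, rfl⟩ := (hmem d).1 h
    exact hd (rot_rot_inr b i)
  have hcr : ∀ d e, d ∉ I → M d e → (IsCrossingDart d ↔ IsCrossingDart e) := by
    intro d e hd h
    have h2 := hMrot _ _ (hIrot _ hd) (hMrot _ _ hd h)
    unfold IsCrossingDart
    refine not_congr ⟨fun h3 => ?_, fun h3 => ?_⟩
    · rw [h3] at h2
      rw [hMf _ hd] at h2 h
      exact h2.symm.trans h
    · rw [h3] at h2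
      exact hMinj _ _ _ (hIrot _ (hIrot _ hd)) hd h2 h
  have he0 : X.edge (X.bd b 0) ∉ I := by
    intro h
    obtain ⟨i, hi⟩ := (hmem _).1 h
    rcases zmod_two_eq i with rfl | rfl
    · exact X.edge_ne _ hi
    · exact hb hi
  have he1 : X.edge (X.bd b 1) ∉ I := by
    intro h
    obtain ⟨i, hi⟩ := (hmem _).1 h
    rcases zmod_two_eq i with rfl | rfl
    · exact hb (by rw [← hi, X.edge_edge])
    · exact X.edge_ne _ hi
  have hMe0 : M (X.edge (X.bd b 0)) (Y.edge y) := hMe _ _ hM0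
  have hMe1 : M (X.edge (X.bd b 1)) y := by
    have := hMe _ _ hM1
    rwa [Y.edge_edge] at this
  have hcases : ∀ d, d ∈ I → d = X.bd b 0 ∨ d = X.bd b 1 := by
    intro d h
    obtain ⟨i, rfl⟩ := (hmem d).1 h
    rcases zmod_two_eq i with rfl | rfl
    exacts [Or.inl rfl, Or.inr rfl]
  -- When the walk in `X` steps across the erased bead, the walk in `Y` does not move.
  have arc_forth : ∀ x x₁ z, M x x₁ → X.Arc x z → ∃ w, M z w ∧ Y.Arc x₁ w := by
    intro x x₁ z hx hz
    induction hz with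
    | base => exact ⟨_, hMe _ _ hx, Arc.base⟩
    | @step z _ hz ih =>
      obtain ⟨w, hw, ha⟩ := ih
      by_cases hzI : z ∈ I
      · rcases hcases z hzI with rfl | rfl
        · obtain rfl := hM0' w hw
          exact ⟨w, hMe1, ha⟩
        · obtain rfl := hM1' w hw
          exact ⟨_, hMe0, ha⟩
      · have h2 := hMrot _ _ hzI hw
        refine ⟨_, hMe _ _ h2, Arc.step ha ?_⟩
        by_contra h3
        exact (hcr z w hzI hw).2 h3 hz
  -- One step in `Y` is matched by one step in `X`, or by two if the first ends at the erased bead.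
  have adv : ∀ x u u₁, M u u₁ → X.Arc x (X.edge u) →
      ∃ x', x' ∉ I ∧ M x' (Y.edge u₁) ∧ X.Arc x x' := by
    intro x u u₁ hu ha
    have h1 := hMe _ _ hu
    by_cases hI : X.edge u ∈ I
    · rcases hcases _ hI with h2 | h2
      · rw [h2] at ha h1
        rw [hM0' _ h1]
        exact ⟨_, he1, hMe1, Arc.step ha (rot_rot_inr b 0)⟩
      · rw [h2] at ha h1
        rw [hM1' _ h1]
        exact ⟨_, he0, hMe0, Arc.step ha (rot_rot_inr b 1)⟩
    · exact ⟨_, hI, h1, ha⟩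
  have arc_back : ∀ x x₁ w, M x x₁ → Y.Arc x₁ w → ∃ z, z ∉ I ∧ M z w ∧ X.Arc x z := by
    intro x x₁ w hx hw
    induction hw with
    | base => exact adv x x x₁ hx Arc.base
    | @step w _ hw ih =>
      obtain ⟨z, hz, hzw, ha⟩ := ih
      refine adv x _ _ (hMrot _ _ hz hzw) (Arc.step ha ?_)
      by_contra h3
      exact (hcr z w hz hzw).1 h3 hw
  refine ⟨fun c d => IsCrossingDart c ∧ M c d, ?_⟩
  constructor
  · intro c hc; exact ⟨_, hc, (hMf c (hcI c hc) _).2 rfl⟩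
  · intro d hd
    obtain ⟨c, hc, h⟩ := hsurj d
    exact ⟨c, (hcr c d hc h).2 hd, h⟩
  · rintro c d ⟨h, -⟩; exact h
  · rintro c d ⟨h, h'⟩; exact (hcr c d (hcI c h) h').1 h
  · rintro c d d' ⟨h, h1⟩ ⟨-, h2⟩
    rw [hMf c (hcI c h)] at h1 h2
    exact h1.symm.trans h2
  · rintro c c' d ⟨h, h1⟩ ⟨h', h2⟩
    exact hMinj _ _ _ (hcI c h) (hcI c' h') h1 h2
  · rintro c d ⟨h, h1⟩
    exact ⟨h.rot, hMrot _ _ (hcI c h) h1⟩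
  · rintro c d ⟨h, h1⟩
    rw [hMf c (hcI c h)] at h1
    rw [← h1]
    exact hover ⟨c, hcI c h⟩
  · rintro c d c' d' ⟨-, h1⟩ ⟨-, h2⟩
    exact hMr _ _ _ _ h1 h2
  · rintro c d c' d' ⟨-, h1⟩ ⟨h, h2⟩
    constructor
    · intro ha
      obtain ⟨w, hw, hw'⟩ := arc_forth _ _ _ h1 ha
      rw [hMf c' (hcI c' h)] at h2 hw
      rwa [← h2, hw]
    · intro ha
      obtain ⟨z, hz, hz', ha'⟩ := arc_back _ _ _ h1 ha
      rwa [hMinj _ _ _ (hcI c' h) hz h2 hz']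

lemma IsotopyStep.similar {X Y : LinkDiagram} (h : IsotopyStep X Y) : ∃ r, Similar X Y r := by
  rcases h with h | h | h
  · exact h.similar
  · exact h.similar
  · obtain ⟨r, h⟩ := h.similar
    exact ⟨_, h.symm⟩

lemma finite_dart (X : LinkDiagram) : Finite X.D := by
  have := X.finite_crossing
  have := X.finite_bead
  infer_instance

lemma rot_cr (X : LinkDiagram) (v : X.Crossing) (i : ZMod 4) : rot (X.cr v i) = X.cr v (i + 1) :=
  rfl

lemma isOver_add_one (X : LinkDiagram) (v : X.Crossing) (i : ZMod 4) :
    IsOver (X.cr v (i + 1)) ↔ ¬ IsOver (X.cr v i) := by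
  show (i + 1 = 1 ∨ i + 1 = 3) ↔ ¬ (i = 1 ∨ i = 3)
  revert i; decide

namespace Stuck

variable {X Y : LinkDiagram}

lemma not_omega1Down (h : X.Stuck) : ¬ Omega1Down X Y := by
  rintro ⟨v, i, b, -, h2, -⟩
  have h3 := (h (X.cr v i) (isCrossingDart_inl v i)).1
  have h4 : X.corners (X.cr v i) ≤ ({X.cr v i} : Set X.D).ncard :=
    Set.ncard_le_ncard (fun d hd => h2 d hd.2)
  rw [Set.ncard_singleton] at h4
  omega

/-- The edge from the dart `i + 1` at `v` to the dart `j` at `w` would be over at both ends or under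
at both ends, which is forbidden in a region with at most two corners. -/
lemma not_omega2Down (h : X.Stuck) : ¬ Omega2Down X Y := by
  rintro ⟨v, w, i, j, b, c, -, -, h1, -, h2, h3, -⟩
  have h4 : X.corners (X.cr v i) ≤ ({X.cr v i, X.cr w j} : Set X.D).ncard :=
    Set.ncard_le_ncard (fun d hd => h3 d hd.2) (Set.toFinite _)
  have h5 := Set.ncard_insert_le (X.cr v i) {X.cr w j}
  rw [Set.ncard_singleton] at h5
  refine (h (X.cr v i) (isCrossingDart_inl v i)).2 (by omega) (X.cr w j)
    (isCrossingDart_inl w j) ?_ ?_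
  · have := Arc.base (X := X) (x := X.cr v (i + 1))
    rwa [h1] at this
  · rw [rot_cr, isOver_add_one, h2, isOver_add_one, not_not]

-- In a triangle for a third move, the edge of the over-strand is over at both ends, so the boundary
-- does not alternate.
open Classical in
lemma not_omega3 (h : X.Stuck) : ¬ Omega3 X Y := by
  rintro ⟨v, i, u, j, ⟨-, h1, h2, h3, h4⟩, -⟩
  have h5 : X.corners (X.cr (v 0) (i 0)) ≤
      ((Finset.univ.image fun l => X.cr (v l) (i l) : Finset X.D) : Set X.D).ncard := by
    apply Set.ncard_le_ncard _ (Finset.finite_toSet _)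
    rintro d ⟨-, hd⟩
    obtain ⟨l, rfl⟩ := h2 0 d hd
    simp
  rw [Set.ncard_coe_finset] at h5
  have h6 : (Finset.univ.image fun l => X.cr (v l) (i l) : Finset X.D).card ≤ 3 :=
    Finset.card_image_le
  refine (h (X.cr (v 0) (i 0)) (isCrossingDart_inl _ _)).2 (h5.trans h6) (X.cr (v 1) (i 1))
    (isCrossingDart_inl _ _) ?_ ?_
  · have := Arc.base (X := X) (x := X.cr (v 0) (i 0 + 1))
    rwa [h1] at this
  · exact ⟨fun _ => h4, fun _ => h3⟩

lemma of_isotopyStep (h : X.Stuck) (hs : IsotopyStep X Y) :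
    Y.Stuck ∧ Y.numCrossings = X.numCrossings := by
  obtain ⟨r, hr⟩ := hs.similar
  exact ⟨hr.stuck h, hr.numCrossings_eq.symm⟩

/-- Only isotopies can occur, by induction along the sequence of steps. -/
lemma of_nonincreasing (h : X.Stuck) (hs : Relation.ReflTransGen NonincreasingStep X Y) :
    Y.Stuck ∧ Y.numCrossings = X.numCrossings := by
  induction hs with
  | refl => exact ⟨h, rfl⟩
  | tail _ hs ih =>
    rcases hs with hs | hs | hs | hs
    · have := ih.1.of_isotopyStep hs
      exact ⟨this.1, this.2.trans ih.2⟩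
    · exact absurd hs ih.1.not_omega1Down
    · exact absurd hs ih.1.not_omega2Down
    · exact absurd hs ih.1.not_omega3

lemma isRigidHard (h : X.Stuck) (hr : X.IsReduced) (hc : X.link.crossingNumber < X.numCrossings) :
    X.IsRigidHard := by
  refine ⟨⟨hr, hc, ?_⟩, ?_⟩
  · rintro Y hs ⟨hl, hm⟩
    have h1 := (h.of_nonincreasing hs).2
    rw [IsMinimal, hl] at hm
    omega
  · intro Y Z hs
    exact (h.of_nonincreasing (Relation.ReflTransGen.mono (fun _ _ => Or.inl) _ _ hs)).1.not_omega3

end Stuck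

end LinkDiagram


/-! ### The regions of the tangle with seven crossings -/

/-- The inner regions are three bigons and three quadrilaterals, so alternation matters at the
bigons only. -/
lemma seven_inner (o : ZMod 4) : ∀ (d : (sevenTangle o).D) j, (sevenTangle o).lab d = Sum.inr j →
    2 ≤ (Finset.univ.filter fun d' => (sevenTangle o).lab d' = Sum.inr j).card ∧
    ((Finset.univ.filter fun d' => (sevenTangle o).lab d' = Sum.inr j).card ≤ 3 →
      ∃ d', (sevenTangle o).edge (Sum.inr (rot d)) = Sum.inr d' ∧
        ¬ (IsOver (rot d) ↔ IsOver d')) := by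
  revert o; decide +kernel

/-- The end `0` is excluded because its region receives a single corner of the tangle. This is the
weak corner that the choice of `k` has to distribute. -/
lemma seven_outer (o : ZMod 4) : ∀ e, e ≠ 0 →
    3 ≤ (Finset.univ.filter fun d => (sevenTangle o).lab d = Sum.inl e).card := by
  revert o; decide +kernel

/-- A crossing of the tangle can become nugatory only if the outer regions `1` and `3` coincide,
which is a condition on the surrounding diagram. -/
lemma seven_opposite (o : ZMod 4) : ∀ v i,
    (sevenTangle o).lab ((sevenTangle o).cr v i) ≠
      (sevenTangle o).lab ((sevenTangle o).cr v (i + 2)) ∧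
    ∀ e e', (sevenTangle o).lab ((sevenTangle o).cr v i) = Sum.inl e →
      (sevenTangle o).lab ((sevenTangle o).cr v (i + 2)) = Sum.inl e' →
      (e = 1 ∧ e' = 3) ∨ (e = 3 ∧ e' = 1) := by
  revert o; decide +kernel

lemma seven_two_corners (o : ZMod 4) : ∀ d, (sevenTangle o).lab d ≠ Sum.inl 0 →
    ∃ d', d' ≠ d ∧ (sevenTangle o).lab d' = (sevenTangle o).lab d := by
  revert o; decide +kernel

lemma seven_good_corner (o : ZMod 4) :
    ∀ v, ∃ i, (sevenTangle o).lab ((sevenTangle o).cr v i) ≠ Sum.inl 0 := by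
  revert o; decide +kernel

/-! ### Regions after the insertion of the tangles -/

namespace LinkDiagram

variable {X : LinkDiagram} {k : X.Crossing → ZMod 4} {A : X.Crossing → Tangle 4} {B : Tangle 2}

/-- The darts of the tangle inserted at the crossing `v`. -/
def inserted (X : LinkDiagram) (k : X.Crossing → ZMod 4) (A : X.Crossing → Tangle 4) (B : Tangle 2)
    (v : X.Crossing) (d : (A v).D) : (X.insert k A B).D :=
  Host.put (filling (X := X) (k := k) A B) (Sum.inl v) d

lemma inserted_injective (v : X.Crossing) : Function.Injective (X.inserted k A B v) :=
  Host.put_injective (T := filling (X := X) (k := k) A B) (Sum.inl v)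

lemma inserted_eq {v w : X.Crossing} {d : (A v).D} {d' : (A w).D}
    (h : X.inserted k A B v d = X.inserted k A B w d') : v = w ∧ HEq d d' := by
  have := Host.put_eq_put h
  exact ⟨Sum.inl.inj this.1, this.2⟩

lemma region_inserted {v w : X.Crossing} {d : (A v).D} {d' : (A w).D} {e e' : ZMod 4}
    (h : (A v).lab d = Sum.inl e) (h' : (A w).lab d' = Sum.inl e') :
    (X.insert k A B).region (X.inserted k A B v d) (X.inserted k A B w d') ↔
      X.region (X.cr v (e + k v)) (X.cr w (e' + k w)) := by
  have key : ∀ (v : X.Crossing) (d : (A v).D) (e : ZMod 4), (A v).lab d = Sum.inl e →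
      Host.flab (filling (X := X) (k := k) A B) (X.inserted k A B v d) =
        Sum.inl (Quotient.mk (X.host k).region ⟨Sum.inl v, e⟩) := by
    intro v d e h
    exact (Host.flab_put (T := filling (X := X) (k := k) A B) (Sum.inl v) d).trans
      (congrArg _ h)
  show Host.flab _ _ = Host.flab _ _ ↔ _
  rw [key v d e h, key w d' e' h']
  constructor
  · intro h
    exact Quotient.exact (s := (X.host k).region) (Sum.inl.inj h)
  · intro h
    have h' : (X.host k).region ⟨Sum.inl v, e⟩ ⟨Sum.inl w, e'⟩ := h
    exact congrArg Sum.inl (Quotient.sound h')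

lemma region_inserted_of_lab_eq {v : X.Crossing} {d d' : (A v).D} (h : (A v).lab d = (A v).lab d') :
    (X.insert k A B).region (X.inserted k A B v d) (X.inserted k A B v d') :=
  Host.flab_put_eq (T := filling (X := X) (k := k) A B) (s := Sum.inl v) h

lemma not_region_inserted {v : X.Crossing} {d d' : (A v).D} (h : (A v).lab d ≠ (A v).lab d')
    (hout : ∀ e e', (A v).lab d = Sum.inl e → (A v).lab d' = Sum.inl e' →
      ¬ X.region (X.cr v (e + k v)) (X.cr v (e' + k v))) :
    ¬ (X.insert k A B).region (X.inserted k A B v d) (X.inserted k A B v d') := by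
  intro hr
  rcases h1 : (A v).lab d with e | j
  · rcases h2 : (A v).lab d' with e' | j'
    · exact hout e e' h1 h2 ((region_inserted h1 h2).1 hr)
    · obtain ⟨d₀, h3, h4⟩ := Host.flab_eq_inr (T := filling (X := X) (k := k) A B)
        (s := Sum.inl v) h2 (Eq.symm hr)
      have h5 := Host.put_injective (T := filling (X := X) (k := k) A B) (Sum.inl v) h4
      subst h5
      exact h (h2.trans h3.symm).symm
  · obtain ⟨d₀, h3, h4⟩ := Host.flab_eq_inr (T := filling (X := X) (k := k) A B)
        (s := Sum.inl v) h1 hr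
    have h5 := Host.put_injective (T := filling (X := X) (k := k) A B) (Sum.inl v) h4
    subst h5
    exact h (h1.trans h3.symm)

lemma exists_inserted {c : (X.insert k A B).D} (h : IsCrossingDart c) (hB : B.n = 0) :
    ∃ v w i, c = X.inserted k A B v ((A v).cr w i) := by
  obtain ⟨⟨v | b, w⟩, i, rfl⟩ := h.exists_inl
  · exact ⟨v, w, i, rfl⟩
  · exact (Fin.elim0 (show Fin 0 from hB ▸ (show Fin B.n from w)))

lemma isCrossingDart_inserted {v : X.Crossing} {d : (A v).D} (h : IsCrossingDart d) :
    IsCrossingDart (X.inserted k A B v d) := by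
  obtain ⟨w, i, rfl⟩ := h.exists_inl
  exact isCrossingDart_inl _ _

lemma isCrossingDart_of_no_beads {C : Tangle 4} (h : C.m = 0) (d : C.D) : IsCrossingDart d := by
  rcases d with ⟨w, i⟩ | ⟨w, i⟩
  · exact isCrossingDart_inl _ _
  · exact (Fin.elim0 (h ▸ w))

/-- Every region with a crossing on its boundary has a second corner. -/
def HasTwoCorners (X : LinkDiagram) : Prop :=
  ∀ c, IsCrossingDart c → ∃ d, IsCrossingDart d ∧ d ≠ c ∧ X.region c d

/-- A single insertion, with any rotations, already gives every crossing a corner whose region has a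
second corner, found in the same tangle. A second insertion can turn its weak end to that corner. -/
lemma exists_good_corner (v : (X.insert k (fun v => sevenTangle (k v)) beadTangle).Crossing) :
    ∃ i d, IsCrossingDart d ∧ d ≠ (X.insert k (fun v => sevenTangle (k v)) beadTangle).cr v i ∧
      (X.insert k (fun v => sevenTangle (k v)) beadTangle).region
        ((X.insert k (fun v => sevenTangle (k v)) beadTangle).cr v i) d := by
  obtain ⟨v | b, w⟩ := v
  · obtain ⟨i, hi⟩ := seven_good_corner (k v) w
    obtain ⟨d, hd, hl⟩ := seven_two_corners (k v) _ hi
    refine ⟨i, X.inserted k (fun v => sevenTangle (k v)) beadTangle v d,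
      isCrossingDart_inserted (A := fun v => sevenTangle (k v))
        (isCrossingDart_of_no_beads rfl d), ?_, ?_⟩
    · intro h
      exact hd (inserted_injective (A := fun v => sevenTangle (k v)) v h)
    · exact region_inserted_of_lab_eq (X := X) (k := k) (A := fun v => sevenTangle (k v))
        (B := beadTangle) (v := v) hl.symm
  · exact (Fin.elim0 (show Fin 0 from w))

/-- A region with a label other than the end `0` has two corners within one tangle. The weak corner
at `v` lies in the old region at `X.cr v (k v)`, and any second corner `d` of that region
contributes a corner of the tangle inserted there. -/
lemma hasTwoCorners_insert_seven (h : ∀ v, ∃ d, IsCrossingDart d ∧ d ≠ X.cr v (k v) ∧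
    X.region (X.cr v (k v)) d) :
    (X.insert k (fun v => sevenTangle (k v)) beadTangle).HasTwoCorners := by
  intro c hc
  obtain ⟨v, w, i, rfl⟩ := exists_inserted hc rfl
  by_cases hl : (sevenTangle (k v)).lab ((sevenTangle (k v)).cr w i) = Sum.inl 0
  · obtain ⟨d, hd, hne, hr⟩ := h v
    obtain ⟨v', i', rfl⟩ := hd.exists_inl
    have hl' := (sevenTangle (k v')).lab_out (i' - k v')
    refine ⟨X.inserted k (fun v => sevenTangle (k v)) beadTangle v'
        ((sevenTangle (k v')).out (i' - k v')),
      isCrossingDart_inserted (A := fun v => sevenTangle (k v))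
        (isCrossingDart_of_no_beads rfl _), ?_, ?_⟩
    · intro he
      obtain ⟨rfl, he⟩ := inserted_eq he
      rw [eq_of_heq he, hl] at hl'
      have h1 : (0 : ZMod 4) = i' - k v' := Sum.inl.inj hl'
      exact hne (congrArg (X.cr v') (sub_eq_zero.1 h1.symm))
    · refine (region_inserted (A := fun v => sevenTangle (k v)) hl hl').2 ?_
      rw [zero_add, sub_add_cancel]
      exact hr
  · obtain ⟨d, hd, hl'⟩ := seven_two_corners (k v) _ hl
    exact ⟨X.inserted k (fun v => sevenTangle (k v)) beadTangle v d,
      isCrossingDart_inserted (A := fun v => sevenTangle (k v)) (isCrossingDart_of_no_beads rfl d),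
      fun h => hd (inserted_injective v h),
      region_inserted_of_lab_eq (A := fun v => sevenTangle (k v)) hl'.symm⟩

lemma isReduced_insert_seven (h : ∀ v, ¬ X.region (X.cr v (k v + 1)) (X.cr v (k v + 3))) :
    (X.insert k (fun v => sevenTangle (k v)) beadTangle).IsReduced := by
  rintro ⟨v | b, w⟩ i
  · obtain ⟨h1, h2⟩ := seven_opposite (k v) w i
    refine not_region_inserted (A := fun v => sevenTangle (k v)) (v := v) h1 ?_
    intro e e' he he' hr
    rw [add_comm e, add_comm e'] at hr
    rcases h2 e e' he he' with ⟨rfl, rfl⟩ | ⟨rfl, rfl⟩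
    · exact h v hr
    · exact h v (Setoid.symm' _ hr)
  · exact (Fin.elim0 (show Fin 0 from w))

/-- An arc that meets a crossing at once cannot be continued. -/
lemma Arc.eq_edge {x y : X.D} (h : X.Arc x y) (hx : IsCrossingDart (X.edge x)) : y = X.edge x := by
  induction h with
  | base => rfl
  | step _ hy ih => exact absurd (by rw [← ih]; exact hy) hx

lemma card_le_corners (Y : LinkDiagram) (c : Y.D) (F : Finset Y.D)
    (h : ∀ d ∈ F, IsCrossingDart d ∧ Y.region c d) : F.card ≤ Y.corners c := by
  have := Y.finite_dart
  rw [← Set.ncard_coe_finset]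
  exact Set.ncard_le_ncard (fun d hd => h d hd) (Set.toFinite _)

-- A region that comes from `X` has three corners in the tangle at `v`, where it has a label `e ≠
-- 0`, and one more behind a second corner `d` of the old region, hence at least four. An inner
-- region is settled by `seven_inner`.
open Classical in
lemma stuck_insert_seven
    (h : ∀ c : X.D, IsCrossingDart c → ∃ v e, e ≠ 0 ∧ X.region c (X.cr v (e + k v)) ∧
      ∃ d, IsCrossingDart d ∧ d ≠ X.cr v (e + k v) ∧ X.region c d) :
    (X.insert k (fun v => sevenTangle (k v)) beadTangle).Stuck := by
  intro c hc
  obtain ⟨v, w, i, rfl⟩ := exists_inserted hc rfl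
  set Y := X.insert k (fun v => sevenTangle (k v)) beadTangle with hY
  have hcr : ∀ v (d : (sevenTangle (k v)).D),
      IsCrossingDart (X.inserted k (fun v => sevenTangle (k v)) beadTangle v d) :=
    fun v d => isCrossingDart_inserted (A := fun v => sevenTangle (k v))
      (isCrossingDart_of_no_beads rfl d)
  rcases hl : (sevenTangle (k v)).lab ((sevenTangle (k v)).cr w i) with e | j
  · obtain ⟨v', e', he', hr', d, hd, hne, hr⟩ := h (X.cr v (e + k v)) (isCrossingDart_inl _ _)
    obtain ⟨v'', i', rfl⟩ := hd.exists_inl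
    have hl'' := (sevenTangle (k v'')).lab_out (i' - k v'')
    have h1 := seven_outer (k v') e' he'
    set F := (Finset.univ.filter fun d => (sevenTangle (k v')).lab d = Sum.inl e').map
      ⟨_, inserted_injective (X := X) (k := k) (A := fun v => sevenTangle (k v))
        (B := beadTangle) v'⟩
    set d₁ := X.inserted k (fun v => sevenTangle (k v)) beadTangle v''
      ((sevenTangle (k v'')).out (i' - k v''))
    -- The label of `d₁` records the corner `d`, which differs from the corner counted by `F`.
    have h2 : d₁ ∉ F := by
      intro hF
      obtain ⟨d₂, h3, h4⟩ := Finset.mem_map.1 hF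
      obtain ⟨rfl, h5⟩ := inserted_eq h4
      have h6 := (Finset.mem_filter.1 h3).2
      rw [eq_of_heq h5, hl''] at h6
      have h7 : i' - k v' = e' := Sum.inl.inj h6
      apply hne
      rw [← h7, sub_add_cancel]
      rfl
    have h3 : 4 ≤ Y.corners (X.inserted k (fun v => sevenTangle (k v)) beadTangle v
        ((sevenTangle (k v)).cr w i)) := by
      refine le_trans ?_ (card_le_corners Y _ (Finset.cons d₁ F h2) ?_)
      · rw [Finset.card_cons, Finset.card_map]
        omega
      · intro d hd
        rcases Finset.mem_cons.1 hd with rfl | hd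
        · refine ⟨hcr _ _, (region_inserted (A := fun v => sevenTangle (k v)) hl hl'').2 ?_⟩
          rw [sub_add_cancel]
          exact hr
        · obtain ⟨d₂, h3, rfl⟩ := Finset.mem_map.1 hd
          exact ⟨hcr _ _, (region_inserted (A := fun v => sevenTangle (k v)) hl
            (Finset.mem_filter.1 h3).2).2 hr'⟩
    exact ⟨le_trans (by norm_num) h3, fun h4 => absurd (h3.trans h4) (by norm_num)⟩
  · obtain ⟨h1, h2⟩ := seven_inner (k v) _ j hl
    have h3 := card_le_corners Y (X.inserted k (fun v => sevenTangle (k v)) beadTangle v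
        ((sevenTangle (k v)).cr w i)) ((Finset.univ.filter fun d' =>
          (sevenTangle (k v)).lab d' = Sum.inr j).map ⟨_, inserted_injective (X := X) (k := k)
            (A := fun v => sevenTangle (k v)) (B := beadTangle) v⟩) (by
      intro d hd
      obtain ⟨d₂, h3, rfl⟩ := Finset.mem_map.1 hd
      exact ⟨hcr _ _, region_inserted_of_lab_eq (A := fun v => sevenTangle (k v))
        (hl.trans (Finset.mem_filter.1 h3).2.symm)⟩)
    rw [Finset.card_map] at h3
    refine ⟨h1.trans h3, fun h4 e he ha => ?_⟩
    obtain ⟨d', hd', hov⟩ := h2 (h3.trans h4)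
    have h5 : Y.edge (rot (X.inserted k (fun v => sevenTangle (k v)) beadTangle v
        ((sevenTangle (k v)).cr w i))) =
        X.inserted k (fun v => sevenTangle (k v)) beadTangle v d' :=
      Host.fedge_put_inr (T := filling (X := X) (k := k) (fun v => sevenTangle (k v)) beadTangle)
        (s := Sum.inl v) hd'
    rw [ha.eq_edge (by rw [h5]; exact hcr _ _), h5]
    have h6 := Host.isOver_put
      (T := filling (X := X) (k := k) (fun v => sevenTangle (k v)) beadTangle)
      (Sum.inl v) d'
    intro h7
    exact hov (h7.trans h6)

end LinkDiagram


/-! ### No crossing has two pairs of equal opposite regions -/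

lemma rot_bijective {V B : Type} : Function.Bijective (rot : Dart V B → Dart V B) := by
  constructor
  · rintro (⟨v, i⟩ | ⟨v, i⟩) (⟨w, j⟩ | ⟨w, j⟩) h <;> simp_all [rot]
  · rintro (⟨v, i⟩ | ⟨v, i⟩)
    · exact ⟨Sum.inl (v, i - 1), by simp [rot]⟩
    · exact ⟨Sum.inr (v, i - 1), by simp [rot]⟩

/-- The vertex at which a dart starts. -/
def vertex {V B : Type} : Dart V B → V ⊕ B := Sum.map Prod.fst Prod.fst

lemma vertex_rot {V B : Type} (d : Dart V B) : vertex (rot d) = vertex d := by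
  rcases d with ⟨v, i⟩ | ⟨v, i⟩ <;> rfl

lemma vertex_surjective {V B : Type} : Function.Surjective (vertex : Dart V B → V ⊕ B) := by
  rintro (v | b)
  exacts [⟨Sum.inl (v, 0), rfl⟩, ⟨Sum.inr (b, 0), rfl⟩]

namespace LinkDiagram

open Module

variable (X : LinkDiagram)

/-- The functions on the darts that are constant at every vertex. -/
def vertexSpace : Submodule (ZMod 2) (X.D → ZMod 2) :=
  LinearMap.range (LinearMap.funLeft (ZMod 2) (ZMod 2) (vertex : X.D → X.Crossing ⊕ X.Bead))

/-- The functions on the darts that are constant on every edge. -/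
def edgeSpace : Submodule (ZMod 2) (X.D → ZMod 2) :=
  LinearMap.ker (LinearMap.funLeft (ZMod 2) (ZMod 2) X.edge + LinearMap.id)

variable {X}

lemma mem_vertexSpace_rot {h : X.D → ZMod 2} (hh : h ∈ X.vertexSpace) (d : X.D) :
    h (rot d) = h d := by
  obtain ⟨g, rfl⟩ := hh
  show g (vertex (rot d)) = g (vertex d)
  rw [vertex_rot]

lemma mem_edgeSpace_iff {w : X.D → ZMod 2} : w ∈ X.edgeSpace ↔ ∀ d, w (X.edge d) = w d := by
  rw [edgeSpace, LinearMap.mem_ker]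
  constructor
  · intro h d
    have := congrFun h d
    exact CharTwo.add_eq_zero.1 this
  · intro h
    funext d
    exact CharTwo.add_eq_zero.2 (h d)

/-- Functions constant at vertices and along edges are constant on the components. -/
lemma finrank_inf_le : finrank (ZMod 2) (X.vertexSpace ⊓ X.edgeSpace : Submodule _ _) ≤
    Nat.card (Quotient (componentSetoid X.edge)) := by
  have := X.finite_dart
  have : Fintype (Quotient (componentSetoid X.edge)) := Fintype.ofFinite _
  have h : X.vertexSpace ⊓ X.edgeSpace ≤ LinearMap.range (LinearMap.funLeft (ZMod 2) (ZMod 2)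
      (Quotient.mk (componentSetoid X.edge))) := by
    rintro f ⟨hv, he⟩
    have hv' := mem_vertexSpace_rot hv
    have he' := mem_edgeSpace_iff.1 he
    refine ⟨Quotient.lift f ?_, rfl⟩
    intro a b hab
    have : componentSetoid X.edge ≤ Setoid.ker f := by
      apply Setoid.eqvGen_le
      rintro x y (rfl | rfl)
      exacts [(hv' x).symm, (he' x).symm]
    exact this hab
  refine (Submodule.finrank_mono h).trans ((LinearMap.finrank_range_le _).trans ?_)
  rw [finrank_pi, Nat.card_eq_fintype_card]

lemma mk_edge_rot (d : X.D) :
    (Quotient.mk X.region (X.edge (rot d))) = Quotient.mk X.region d :=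
  Quotient.sound (Setoid.symm' _ (X.region_face d))

section

variable [Fintype X.D]

lemma finrank_vertexSpace (X : LinkDiagram) :
    finrank (ZMod 2) X.vertexSpace = Nat.card X.Crossing + Nat.card X.Bead := by
  have := X.finite_crossing
  have := X.finite_bead
  have : Fintype (X.Crossing ⊕ X.Bead) := Fintype.ofFinite _
  rw [vertexSpace, LinearMap.finrank_range_of_inj
    (LinearMap.funLeft_injective_of_surjective _ _ _ vertex_surjective), finrank_pi,
    ← Nat.card_eq_fintype_card, Nat.card_sum]

lemma card_dart (X : LinkDiagram) :
    Nat.card X.D = 4 * Nat.card X.Crossing + 2 * Nat.card X.Bead := by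
  have := X.finite_crossing
  have := X.finite_bead
  rw [Nat.card_sum, Nat.card_prod, Nat.card_prod, Nat.card_zmod, Nat.card_zmod]
  ring

/-- In characteristic two the map `f ↦ f ∘ edge + f` has square zero, so its kernel has at least
half the dimension. -/
lemma le_finrank_edgeSpace : 2 * Nat.card X.Crossing + Nat.card X.Bead ≤
    finrank (ZMod 2) X.edgeSpace := by
  set s := LinearMap.funLeft (ZMod 2) (ZMod 2) X.edge + LinearMap.id with hs
  have h1 : LinearMap.range s ≤ LinearMap.ker s := by
    rintro _ ⟨f, rfl⟩
    rw [LinearMap.mem_ker]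
    funext d
    show (f (X.edge (X.edge d)) + f (X.edge d)) + (f (X.edge d) + f d) = 0
    rw [X.edge_edge, add_comm (f d), CharTwo.add_self_eq_zero]
  have h2 := Submodule.finrank_mono h1
  have h3 := s.finrank_range_add_finrank_ker
  rw [finrank_pi, ← Nat.card_eq_fintype_card, card_dart] at h3
  show _ ≤ finrank (ZMod 2) (LinearMap.ker s)
  omega

open Classical in
/-- The sum of the two regions on the sides of a dart. -/
noncomputable def sides (X : LinkDiagram) (d : X.D) : Quotient X.region → ZMod 2 :=
  Pi.single (Quotient.mk _ d) 1 + Pi.single (Quotient.mk _ (X.edge d)) 1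

/-- The functions on the darts that are orthogonal to the boundaries of all regions. -/
noncomputable def coboundarySpace (X : LinkDiagram) [Fintype X.D] :
    Submodule (ZMod 2) (X.D → ZMod 2) :=
  LinearMap.ker (Fintype.linearCombination (ZMod 2) X.sides)

lemma add_self_pi {ι : Type*} (f : ι → ZMod 2) : f + f = 0 := by
  funext i
  exact CharTwo.add_self_eq_zero _

open Classical in
lemma edgeSpace_le : X.edgeSpace ≤ X.coboundarySpace := by
  intro w hw
  rw [mem_edgeSpace_iff] at hw
  rw [coboundarySpace, LinearMap.mem_ker, Fintype.linearCombination_apply]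
  refine Finset.sum_involution (fun d _ => X.edge d) ?_ (fun d _ _ => X.edge_ne d)
    (fun d _ => Finset.mem_univ _) (fun d _ => X.edge_edge d)
  intro d _
  rw [hw, sides, sides, X.edge_edge, add_comm (Pi.single _ _)]
  exact add_self_pi _

open Classical in
-- Around a vertex each corner is counted twice, once by the dart to its right and once by the dart
-- to its left.
lemma vertexSpace_le : X.vertexSpace ≤ X.coboundarySpace := by
  intro h hh
  have hh' := mem_vertexSpace_rot hh
  rw [coboundarySpace, LinearMap.mem_ker, Fintype.linearCombination_apply]
  simp only [sides, smul_add, Finset.sum_add_distrib]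
  rw [← rot_bijective.sum_comp (fun d => h d •
    (Pi.single (Quotient.mk X.region (X.edge d)) 1 : Quotient X.region → ZMod 2))]
  simp only [hh', mk_edge_rot]
  exact add_self_pi _

/-- The vectors `sides d` together with one basis vector span the whole space: crossing an edge
leads from one region to the next, and the surface is connected. Thus `sides` has rank at least the
number of regions minus one. -/
lemma finrank_coboundarySpace_le : finrank (ZMod 2) X.coboundarySpace + Nat.card (Quotient X.region)
    ≤ Nat.card X.D + 1 := by
  classical
  have := X.finite_dart
  have : Fintype (Quotient X.region) := Fintype.ofFinite _
  obtain ⟨d₀⟩ := X.nonempty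
  set th := Fintype.linearCombination (ZMod 2) X.sides with hth
  have h1 := th.finrank_range_add_finrank_ker
  rw [finrank_pi, ← Nat.card_eq_fintype_card] at h1
  set S := LinearMap.range th ⊔
    Submodule.span (ZMod 2) {(Pi.single (Quotient.mk X.region d₀) 1 : Quotient X.region → ZMod 2)}
  have hs : ∀ d, X.sides d ∈ S := by
    intro d
    apply Submodule.mem_sup_left
    rw [hth, Fintype.range_linearCombination]
    exact Submodule.subset_span ⟨d, rfl⟩
  have hstep : ∀ d e, (componentSetoid X.edge ⊔ X.region) d e →
      ((Pi.single (Quotient.mk X.region d) 1 : Quotient X.region → ZMod 2) ∈ S ↔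
        Pi.single (Quotient.mk X.region e) 1 ∈ S) := by
    set P : X.D → Prop := fun d =>
      (Pi.single (Quotient.mk X.region d) 1 : Quotient X.region → ZMod 2) ∈ S
    have hedge : ∀ d, P d = P (X.edge d) := by
      intro d
      have h2 := hs d
      apply propext
      constructor
      · intro h3
        exact (Submodule.add_mem_iff_right S h3).1 h2
      · intro h3
        exact (Submodule.add_mem_iff_left S h3).1 h2
    have hreg : X.region ≤ Setoid.ker P := by
      intro a b hab
      show P a = P b
      simp only [P]
      rw [Quotient.sound (s := X.region) hab]
    have hcomp : componentSetoid X.edge ≤ Setoid.ker P := by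
      apply Setoid.eqvGen_le
      rintro a b (rfl | rfl)
      · exact (hreg (X.region_face a)).trans (hedge (rot a)).symm
      · exact hedge a
    intro d e h
    exact iff_of_eq (sup_le hcomp hreg h)
  have hS : S = ⊤ := by
    rw [eq_top_iff]
    intro f _
    rw [pi_eq_sum_univ' f]
    refine Submodule.sum_mem _ fun q _ => Submodule.smul_mem _ _ ?_
    induction q using Quotient.inductionOn with
    | _ d =>
      have := (hstep d₀ d (X.sphere_connected d₀ d)).1
        (Submodule.mem_sup_right (Submodule.mem_span_singleton_self _))
      convert this using 1
  have h2 := Submodule.finrank_add_le_finrank_add_finrank (LinearMap.range th)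
    (Submodule.span (ZMod 2) {(Pi.single (Quotient.mk X.region d₀) 1 : Quotient X.region → ZMod 2)})
  rw [show LinearMap.range th ⊔ Submodule.span (ZMod 2)
    {(Pi.single (Quotient.mk X.region d₀) 1 : Quotient X.region → ZMod 2)} = ⊤ from hS,
    finrank_top, finrank_pi, ← Nat.card_eq_fintype_card] at h2
  have h3 := finrank_span_le_card (R := ZMod 2)
    {(Pi.single (Quotient.mk X.region d₀) 1 : Quotient X.region → ZMod 2)}
  rw [Set.toFinset_singleton, Finset.card_singleton] at h3
  show finrank (ZMod 2) (LinearMap.ker th) + _ ≤ _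
  omega

/-- This is a form of the vanishing of the first cohomology of the sphere modulo 2. One inclusion is
clear, and Euler's formula makes the dimensions agree. -/
lemma vertexSpace_sup_edgeSpace : X.vertexSpace ⊔ X.edgeSpace = X.coboundarySpace := by
  apply Submodule.eq_of_le_of_finrank_le (sup_le vertexSpace_le edgeSpace_le)
  have h1 := Submodule.finrank_sup_add_finrank_inf_eq X.vertexSpace X.edgeSpace
  have h2 := finrank_inf_le (X := X)
  have h3 := le_finrank_edgeSpace (X := X)
  have h4 := finrank_vertexSpace X
  have h5 := finrank_coboundarySpace_le (X := X)
  have h6 := X.euler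
  have h7 := X.card_dart
  omega

end

open Classical in
/-- A function that is constant on every edge, and at every vertex except for the darts `i`, `i + 1`
at the crossing `v`. -/
lemma exists_cut (v : X.Crossing) (i : ZMod 4)
    (h : X.region (X.cr v (i + 1)) (X.cr v (i + 3))) :
    ∃ w : X.D → ZMod 2, (∀ d, w (X.edge d) = w d) ∧
      (∀ d, vertex d ≠ Sum.inl v → w (rot d) = w d) ∧
      w (X.cr v i) = 1 ∧ w (X.cr v (i + 1)) = 1 ∧ w (X.cr v (i + 2)) = 0 ∧
      w (X.cr v (i + 3)) = 0 := by
  have := X.finite_dart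
  have : Fintype X.D := Fintype.ofFinite _
  set phi : X.D → ZMod 2 := Pi.single (X.cr v i) 1 + Pi.single (X.cr v (i + 1)) 1 with hphi
  -- The darts `i` and `i + 1` have the region between them in common, and their outer sides agree
  -- by `h`. Geometrically, `phi` marks the edges at `v` on one side of a closed curve that passes
  -- through `v` and otherwise stays in that region.
  have h1 : phi ∈ X.coboundarySpace := by
    rw [coboundarySpace, LinearMap.mem_ker, hphi, map_add, Fintype.linearCombination_apply_single,
      Fintype.linearCombination_apply_single, one_smul, one_smul, sides, sides]
    have e1 : Quotient.mk X.region (X.edge (X.cr v (i + 1))) = Quotient.mk X.region (X.cr v i) :=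
      mk_edge_rot (X.cr v i)
    have e2 : Quotient.mk X.region (X.edge (X.cr v i)) = Quotient.mk X.region (X.cr v (i + 1)) := by
      have e3 := mk_edge_rot (X.cr v (i + 3))
      rw [rot_cr, add_assoc, show (3 + 1 : ZMod 4) = 0 from rfl, add_zero] at e3
      rw [e3]
      exact Quotient.sound (Setoid.symm' _ h)
    rw [e1, e2, add_comm (Pi.single (Quotient.mk X.region (X.cr v (i + 1))) _)]
    exact add_self_pi _
  rw [← vertexSpace_sup_edgeSpace, Submodule.mem_sup] at h1
  obtain ⟨g, hg, w, hw, hgw⟩ := h1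
  have hg' := mem_vertexSpace_rot hg
  have hw' := mem_edgeSpace_iff.1 hw
  have hwd : ∀ d, w d = phi d + g d := by
    intro d
    rw [← hgw, Pi.add_apply, add_comm (g d), add_assoc, CharTwo.add_self_eq_zero, add_zero]
  have hg1 : ∀ j : ZMod 4, g (X.cr v (j + 1)) = g (X.cr v j) := fun j => hg' (X.cr v j)
  have hg2 : ∀ j : ZMod 4, g (X.cr v (j + 2)) = g (X.cr v j) := by
    intro j
    have := hg1 (j + 1)
    rw [add_assoc] at this
    exact this.trans (hg1 j)
  have hg3 : ∀ j : ZMod 4, g (X.cr v (j + 3)) = g (X.cr v j) := by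
    intro j
    have := hg1 (j + 2)
    rw [add_assoc] at this
    exact this.trans (hg2 j)
  have hne : ∀ a b : ZMod 4, a ≠ b → X.cr v (i + a) ≠ X.cr v (i + b) := by
    intro a b hab h
    exact hab (add_left_cancel (Prod.mk.inj (Sum.inl.inj h)).2)
  have hne' : ∀ a : ZMod 4, a ≠ 0 → X.cr v (i + a) ≠ X.cr v i := by
    intro a ha
    have := hne a 0 ha
    rwa [add_zero] at this
  -- Since `w = phi + g` and `g` is constant at `v`, adding this constant makes the values at `v`
  -- equal to those of `phi`. The result is the indicator of one side of the curve.
  refine ⟨fun d => w d + g (X.cr v i), ?_, ?_, ?_, ?_, ?_, ?_⟩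
  · intro d
    dsimp only
    rw [hw']
  · intro d hd
    dsimp only
    have hz : ∀ d : X.D, vertex d ≠ Sum.inl v → phi d = 0 := by
      intro d hd
      have : ∀ j, d ≠ X.cr v j := fun j hj => hd (by rw [hj]; rfl)
      rw [hphi, Pi.add_apply, Pi.single_eq_of_ne (this _), Pi.single_eq_of_ne (this _), add_zero]
    rw [hwd, hwd, hg', hz d hd, hz _ (by rwa [vertex_rot])]
  · dsimp only
    rw [hwd, add_assoc, CharTwo.add_self_eq_zero, hphi, Pi.add_apply, Pi.single_eq_same,
      Pi.single_eq_of_ne (hne' 1 (by decide)).symm]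
    rfl
  · dsimp only
    rw [hwd, hg1, add_assoc, CharTwo.add_self_eq_zero, hphi, Pi.add_apply, Pi.single_eq_same,
      Pi.single_eq_of_ne (hne' 1 (by decide))]
    rfl
  · dsimp only
    rw [hwd, hg2, add_assoc, CharTwo.add_self_eq_zero, hphi, Pi.add_apply,
      Pi.single_eq_of_ne (hne' 2 (by decide)), Pi.single_eq_of_ne (hne 2 1 (by decide))]
    rfl
  · dsimp only
    rw [hwd, hg3, add_assoc, CharTwo.add_self_eq_zero, hphi, Pi.add_apply,
      Pi.single_eq_of_ne (hne' 3 (by decide)), Pi.single_eq_of_ne (hne 3 1 (by decide))]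
    rfl

/-- The sum over all darts vanishes because the darts of an edge cancel. Every vertex other than `v`
contributes zero, having even valence, so the contribution of `v` is zero too. -/
lemma sum_at_crossing (v : X.Crossing) (p : X.D → ZMod 2) (hp : ∀ d, p (X.edge d) = p d)
    (hv : ∀ d, vertex d ≠ Sum.inl v → p (rot d) = p d) : ∑ i, p (X.cr v i) = 0 := by
  classical
  have := X.finite_crossing
  have := X.finite_bead
  have : Fintype X.Crossing := Fintype.ofFinite _
  have : Fintype X.Bead := Fintype.ofFinite _
  have h1 : ∑ d : X.D, p d = 0 := by
    refine Finset.sum_involution (fun d _ => X.edge d) ?_ (fun d _ _ => X.edge_ne d)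
      (fun d _ => Finset.mem_univ _) (fun d _ => X.edge_edge d)
    intro d _
    rw [hp, CharTwo.add_self_eq_zero]
  have hconst : ∀ (n : ℕ) (q : ZMod 4 → ZMod 2), (∀ i, q (i + 1) = q i) → ∑ i, q i = 0 := by
    intro _ q
    revert q
    decide
  have hconst' : ∀ q : ZMod 2 → ZMod 2, (∀ i, q (i + 1) = q i) → ∑ i, q i = 0 := by decide
  rw [Fintype.sum_sum_type, Fintype.sum_prod_type, Fintype.sum_prod_type,
    Finset.sum_eq_zero (s := (Finset.univ : Finset X.Bead)), add_zero,
    Finset.sum_eq_single v] at h1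
  · exact h1
  · intro u _ hu
    exact hconst 0 (fun i => p (X.cr u i)) fun i => hv (X.cr u i) fun h => hu (Sum.inl.inj h)
  · intro h
    exact absurd (Finset.mem_univ v) h
  · intro b _
    exact hconst' (fun i => p (X.bd b i)) fun i => hv (X.bd b i) fun h => by cases h

/-- At a crossing, at most one pair of opposite corners belongs to the same region. -/
theorem not_region_opposite (v : X.Crossing) :
    ¬ (X.region (X.cr v 0) (X.cr v 2) ∧ X.region (X.cr v 1) (X.cr v 3)) := by
  rintro ⟨h0, h1⟩
  obtain ⟨w, a1, a2, a3, a4, a5, a6⟩ := X.exists_cut v 0 h1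
  obtain ⟨u, b1, b2, b3, b4, b5, b6⟩ := X.exists_cut v 1 (Setoid.symm' _ h0)
  -- The values at `v` are `(1, 1, 0, 0)` for `w` and `(0, 1, 1, 0)` for `u`. Their product has sum
  -- `1`, the parity with which the two curves would cross.
  have h := X.sum_at_crossing v (fun d => w d * u d) (fun d => by rw [a1, b1])
    (fun d hd => by rw [a2 d hd, b2 d hd])
  have h2 : ∑ i, w (X.cr v i) * u (X.cr v i) = w (X.cr v 0) * u (X.cr v 0) +
      w (X.cr v 1) * u (X.cr v 1) + w (X.cr v 2) * u (X.cr v 2) + w (X.cr v 3) * u (X.cr v 3) :=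
    Fin.sum_univ_four (fun i : Fin 4 => w (X.cr v i) * u (X.cr v i))
  rw [h2] at h
  have c1 : w (X.cr v 0) = 1 := a3
  have c2 : w (X.cr v 1) = 1 := a4
  have c3 : w (X.cr v 2) = 0 := a5
  have c4 : w (X.cr v 3) = 0 := a6
  have c5 : u (X.cr v 1) = 1 := b3
  have c6 : u (X.cr v 0) = 0 := b6
  rw [c1, c2, c3, c4, c5, c6, zero_mul, zero_mul, mul_zero, one_mul] at h
  exact absurd h (by decide)

end LinkDiagram


/-! ### Choice of the rotations by Hall's marriage theorem -/

namespace LinkDiagram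

variable {X : LinkDiagram}

/-- The region of a corner at a crossing. -/
def regionAt (X : LinkDiagram) (p : X.Crossing × ZMod 4) : Quotient X.region :=
  Quotient.mk X.region (Sum.inl p)

open Classical in
/-- If every region has at least two corners, and `a` selects a pair of opposite corners at every
crossing, then one can choose one corner of each pair such that no region consists of chosen corners
only. -/
lemma exists_choice (h : X.HasTwoCorners) (a : X.Crossing → ZMod 4) :
    ∃ k : X.Crossing → ZMod 4, (∀ v, k v = a v ∨ k v = a v + 2) ∧
      ∀ p, ∃ v j, j ≠ k v ∧ X.regionAt p = X.regionAt (v, j) := by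
  have := X.finite_crossing
  have : Fintype X.Crossing := Fintype.ofFinite _
  -- The critical regions are those all of whose crossing corners are candidates. Any other region
  -- keeps a corner that can never be chosen.
  let Q := {q : Quotient X.region // (∃ p, X.regionAt p = q) ∧
    ∀ v j, X.regionAt (v, j) = q → j = a v ∨ j = a v + 2}
  let t : Q → Finset X.Crossing := fun q => Finset.univ.filter fun v => ∃ j, X.regionAt (v, j) = q.1
  -- Hall's condition by double counting: each region in `A` has at least two corners, and each
  -- crossing on `A` offers only two candidates.
  have hall : ∀ A : Finset Q, A.card ≤ (A.biUnion t).card := by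
    intro A
    let K : Finset (X.Crossing × ZMod 4) :=
      Finset.univ.filter fun p => X.regionAt p ∈ A.image Subtype.val
    have h1 : K.card ≤ (A.biUnion t).card * 2 := by
      refine (Finset.card_le_card (t := (A.biUnion t).biUnion
        fun v => {(v, a v), (v, a v + 2)}) ?_).trans
        (Finset.card_biUnion_le_card_mul _ _ _ fun v _ => Finset.card_le_two)
      rintro ⟨v, j⟩ hp
      obtain ⟨q, hq, hp⟩ := Finset.mem_image.1 (Finset.mem_filter.1 hp).2
      refine Finset.mem_biUnion.2 ⟨v, Finset.mem_biUnion.2 ⟨q, hq, Finset.mem_filter.2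
        ⟨Finset.mem_univ _, j, hp.symm⟩⟩, ?_⟩
      rcases q.2.2 v j hp.symm with rfl | rfl <;> simp
    have h2 : K.card = ∑ q ∈ A.image Subtype.val, (K.filter fun p => X.regionAt p = q).card :=
      Finset.card_eq_sum_card_fiberwise fun p hp => (Finset.mem_filter.1 hp).2
    have h3 : ∀ q ∈ A.image Subtype.val, 2 ≤ (K.filter fun p => X.regionAt p = q).card := by
      intro q hq
      obtain ⟨q', hq', rfl⟩ := Finset.mem_image.1 hq
      obtain ⟨⟨v, i⟩, hp⟩ := q'.2.1
      obtain ⟨d, hd, hne, hr⟩ := h (X.cr v i) (isCrossingDart_inl v i)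
      obtain ⟨w, j, rfl⟩ := hd.exists_inl
      have hp' : X.regionAt (w, j) = q'.1 := by
        rw [← hp]
        exact Quotient.sound (Setoid.symm' _ hr)
      have hmem : ∀ p, X.regionAt p = q'.1 → p ∈ K.filter fun p => X.regionAt p = q'.1 := by
        intro p hp
        refine Finset.mem_filter.2 ⟨Finset.mem_filter.2 ⟨Finset.mem_univ _, ?_⟩, hp⟩
        rwa [hp]
      rw [← Finset.card_pair (a := (w, j)) (b := (v, i)) (fun h => hne (congrArg Sum.inl h))]
      apply Finset.card_le_card
      intro p hp
      rcases Finset.mem_insert.1 hp with rfl | hp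
      · exact hmem _ hp'
      · rw [Finset.mem_singleton.1 hp]
        exact hmem _ (by assumption)
    have h4 := Finset.card_nsmul_le_sum _ _ 2 h3
    rw [← h2, Finset.card_image_of_injective _ Subtype.val_injective, smul_eq_mul] at h4
    omega
  obtain ⟨g, hg, hgt⟩ := (Finset.all_card_le_biUnion_card_iff_exists_injective t).1 hall
  have hj : ∀ q, ∃ j, X.regionAt (g q, j) = q.1 := fun q => (Finset.mem_filter.1 (hgt q)).2
  choose j hj using hj
  -- At the crossing assigned to a critical region `q`, the candidate opposite to a corner of `q` is
  -- chosen, which leaves that corner free. Injectivity of `g` prevents conflicts.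
  refine ⟨fun v => if h : ∃ q, g q = v then j h.choose + 2 else a v, ?_, ?_⟩
  · intro v
    by_cases hv : ∃ q, g q = v
    · dsimp only
      rw [dif_pos hv]
      have h1 := hv.choose.2.2 _ _ (hj hv.choose)
      rw [hv.choose_spec] at h1
      rcases h1 with h1 | h1
      · right; rw [h1]
      · left; rw [h1, add_assoc, show (2 + 2 : ZMod 4) = 0 from rfl, add_zero]
    · dsimp only
      rw [dif_neg hv]
      exact Or.inl rfl
  · intro p
    by_cases hp : ∀ v i, X.regionAt (v, i) = X.regionAt p → i = a v ∨ i = a v + 2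
    · let q : Q := ⟨X.regionAt p, ⟨p, rfl⟩, hp⟩
      refine ⟨g q, j q, ?_, (hj q).symm⟩
      have hq : ∃ q', g q' = g q := ⟨q, rfl⟩
      dsimp only
      rw [dif_pos hq, hg hq.choose_spec]
      intro h1
      exact absurd (left_eq_add.1 h1) (by decide)
    · push Not at hp
      obtain ⟨v, i, h1, h2, h3⟩ := hp
      refine ⟨v, i, ?_, h1.symm⟩
      dsimp only
      by_cases hv : ∃ q, g q = v
      · rw [dif_pos hv]
        have h4 := hv.choose.2.2 _ _ (hj hv.choose)
        rw [hv.choose_spec] at h4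
        rintro rfl
        rcases h4 with h4 | h4
        · exact h3 (by rw [h4])
        · exact h2 (by rw [h4, add_assoc, show (2 + 2 : ZMod 4) = 0 from rfl, add_zero])
      · rw [dif_neg hv]
        exact h2

/-- Every diagram in which all regions have at least two corners can be made stuck and reduced by
inserting suitably rotated tangles with seven crossings. -/
theorem exists_stuck (h : X.HasTwoCorners) : ∃ k : X.Crossing → ZMod 4,
    (X.insert k (fun v => sevenTangle (k v)) beadTangle).Stuck ∧
    (X.insert k (fun v => sevenTangle (k v)) beadTangle).IsReduced := by
  -- Replacing `a` by `a + 2` exchanges the two corners, so reducedness still leaves two possible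
  -- rotations at every crossing.
  have h1 : ∀ v : X.Crossing, ∃ a : ZMod 4, ¬ X.region (X.cr v (a + 1)) (X.cr v (a + 3)) := by
    intro v
    by_contra! hv
    exact X.not_region_opposite v ⟨Setoid.symm' _ (hv 1), hv 0⟩
  choose a ha using h1
  obtain ⟨k, hk, hk'⟩ := exists_choice h a
  refine ⟨k, stuck_insert_seven ?_, isReduced_insert_seven ?_⟩
  · intro c hc
    obtain ⟨v, i, rfl⟩ := hc.exists_inl
    obtain ⟨w, j, hj, hr⟩ := hk' (v, i)
    have hr' : X.region (X.cr v i) (X.cr w j) := Quotient.exact hr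
    obtain ⟨d, hd, hne, hrd⟩ := h (X.cr w j) (isCrossingDart_inl w j)
    refine ⟨w, j - k w, sub_ne_zero.2 hj, ?_⟩
    rw [sub_add_cancel]
    exact ⟨hr', d, hd, hne, Setoid.trans' _ hr' hrd⟩
  · intro v hv
    rcases hk v with h2 | h2
    · rw [h2] at hv
      exact ha v hv
    · rw [h2, add_assoc, add_assoc, show (2 + 1 : ZMod 4) = 3 from rfl,
        show (2 + 3 : ZMod 4) = 1 from rfl] at hv
      exact ha v (Setoid.symm' _ hv)

end LinkDiagram


namespace LinkDiagram

/-! ### Erasing beads and loops -/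

/-- The diagram with a smaller set of darts, where the corners `iota d` of the diagram `X` are kept,
and where `rho` moves the other darts to darts in the same component. -/
def restrict (X : LinkDiagram) {V B : Type} [Finite V] [Finite B] (edge : Dart V B → Dart V B)
    (iota : Dart V B → X.D) (rho : X.D → Dart V B)
    (edge_edge : ∀ d, edge (edge d) = d) (edge_ne : ∀ d, edge d ≠ d)
    (rho_iota : ∀ d, rho (iota d) = d)
    (iota_rho : ∀ x, componentSetoid X.edge (iota (rho x)) x)
    (region_face : ∀ c, X.region (iota c) (iota (edge (rot c))))
    (comp_iota : ∀ d, componentSetoid X.edge (iota d) (iota (rot d)) ∧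
      componentSetoid X.edge (iota d) (iota (edge d)))
    (comp_rho : ∀ x, componentSetoid edge (rho x) (rho (rot x)) ∧
      componentSetoid edge (rho x) (rho (X.edge x)))
    (region_iota : ∀ x, (∃ c, X.region x (iota c) ∧ componentSetoid edge (rho x) c) ∨
      ∀ y, X.region x y → y = x)
    (card_region : Nat.card (Quotient X.region) + Nat.card V =
      Nat.card (Quotient (Setoid.comap iota X.region)) + Nat.card X.Crossing) : LinkDiagram where
  Crossing := V
  Bead := B
  finite_crossing := inferInstance
  finite_bead := inferInstance
  nonempty := X.nonempty.map rho
  edge := edge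
  edge_edge := edge_edge
  edge_ne := edge_ne
  region := Setoid.comap iota X.region
  region_face := region_face
  sphere_connected c d := by
    set S := componentSetoid edge ⊔ Setoid.comap iota X.region
    have hc : componentSetoid edge ≤ S := le_sup_left
    have hr : Setoid.comap iota X.region ≤ S := le_sup_right
    have h1 : componentSetoid X.edge ≤ Setoid.comap rho S := by
      apply Setoid.eqvGen_le
      rintro x y (rfl | rfl)
      exacts [hc (comp_rho x).1, hc (comp_rho x).2]
    have h2 : X.region ≤ Setoid.comap rho S := by
      intro x y hxy
      show S (rho x) (rho y)
      -- Either a corner of the region survives in the right component, or the region has a single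
      -- corner and imposes no condition.
      rcases region_iota x with ⟨c, h3, h4⟩ | h3
      · rcases region_iota y with ⟨d, h5, h6⟩ | h5
        · have h7 : X.region (iota c) (iota d) :=
            Setoid.trans' _ (Setoid.symm' _ h3) (Setoid.trans' _ hxy h5)
          exact Setoid.trans' _ (hc h4) (Setoid.trans' _ (hr h7) (Setoid.symm' _ (hc h6)))
        · rw [h5 x (Setoid.symm' _ hxy)]
      · rw [h3 y hxy]
    have h3 := sup_le h1 h2 (X.sphere_connected (iota c) (iota d))
    change S (rho (iota c)) (rho (iota d)) at h3
    rwa [rho_iota, rho_iota] at h3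
  euler := by
    have h1 : componentSetoid edge ≤ Setoid.comap iota (componentSetoid X.edge) := by
      apply Setoid.eqvGen_le
      rintro x y (rfl | rfl)
      exacts [(comp_iota x).1, (comp_iota x).2]
    -- The maps `iota` and `rho` induce inverse bijections of components. Euler's formula then
    -- survives because crossings and regions decrease by the same number.
    have h2 : componentSetoid X.edge ≤ Setoid.comap rho (componentSetoid edge) := by
      apply Setoid.eqvGen_le
      rintro x y (rfl | rfl)
      exacts [(comp_rho x).1, (comp_rho x).2]
    have h3 : Nat.card (Quotient (componentSetoid edge)) =
        Nat.card (Quotient (componentSetoid X.edge)) := by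
      refine Nat.card_congr ⟨Quotient.map' iota fun _ _ h => h1 h,
        Quotient.map' rho fun _ _ h => h2 h, ?_, ?_⟩
      · intro q
        induction q using Quotient.inductionOn' with
        | _ d => exact congrArg (Quotient.mk _) (rho_iota d)
      · intro q
        induction q using Quotient.inductionOn' with
        | _ x => exact Quotient.sound' (iota_rho x)
    have h4 := X.euler
    omega

lemma eq_of_card_option {α β : Type} [Finite α] (e : Option α ≃ β) :
    Nat.card β = Nat.card α + 1 := by
  rw [← Nat.card_congr e, Finite.card_option]

open Classical in
/-- A bead can be erased, unless it is the only vertex on a closed curve. -/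
lemma exists_eraseBead (X : LinkDiagram) (b : X.Bead) (hb : X.edge (X.bd b 0) ≠ X.bd b 1) :
    ∃ Y, EraseBead X Y ∧ Y.numCrossings = X.numCrossings ∧
      Nat.card X.Bead = Nat.card Y.Bead + 1 := by
  have := X.finite_crossing
  have := X.finite_bead
  have hb' : X.edge (X.bd b 1) ≠ X.bd b 0 := fun h => hb (by rw [← h, X.edge_edge])
  have h01 : X.bd b 0 ≠ X.bd b 1 := fun h =>
    absurd (Prod.mk.inj (Sum.inr.inj h)).2 (by decide)
  let iota : Dart X.Crossing {c : X.Bead // c ≠ b} → X.D :=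
    Sum.map id (Prod.map Subtype.val id)
  have iota_inj : Function.Injective iota :=
    Sum.map_injective.2 ⟨Function.injective_id,
      Subtype.val_injective.prodMap Function.injective_id⟩
  have iota_ne : ∀ d i, iota d ≠ X.bd b i := by
    rintro (⟨v, j⟩ | ⟨c, j⟩) i h
    · cases h
    · exact c.2 (Prod.mk.inj (Sum.inr.inj h)).1
  have iota_rot : ∀ d, iota (rot d) = rot (iota d) := by rintro (⟨v, j⟩ | ⟨c, j⟩) <;> rfl
  have exists_iota : ∀ x, x ≠ X.bd b 0 → x ≠ X.bd b 1 → ∃ d, iota d = x := by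
    rintro (⟨v, j⟩ | ⟨c, j⟩) h0 h1
    · exact ⟨Sum.inl (v, j), rfl⟩
    · by_cases hc : c = b
      · subst hc
        rcases zmod_two_eq j with rfl | rfl
        exacts [absurd rfl h0, absurd rfl h1]
      · exact ⟨Sum.inr (⟨c, hc⟩, j), rfl⟩
  -- A dart at the bead is moved to the far end of the opposite edge at the bead. Both darts have
  -- the same region on their left, so regions do not change.
  let cut : X.D → X.D := fun x =>
    if x = X.bd b 0 then X.edge (X.bd b 1) else if x = X.bd b 1 then X.edge (X.bd b 0) else x
  have cut0 : cut (X.bd b 0) = X.edge (X.bd b 1) := if_pos rfl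
  have cut1 : cut (X.bd b 1) = X.edge (X.bd b 0) := (if_neg h01.symm).trans (if_pos rfl)
  have cut_of_ne : ∀ x, x ≠ X.bd b 0 → x ≠ X.bd b 1 → cut x = x :=
    fun x h0 h1 => (if_neg h0).trans (if_neg h1)
  have cut_iota : ∀ d, cut (iota d) = iota d := fun d => cut_of_ne _ (iota_ne d 0) (iota_ne d 1)
  have cut_cases : ∀ x (P : X.D → Prop), P (X.bd b 0) → P (X.bd b 1) →
      (x ≠ X.bd b 0 → x ≠ X.bd b 1 → P x) → P x := by
    intro x P h0 h1 h2
    by_cases h : x = X.bd b 0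
    · rwa [h]
    · by_cases h' : x = X.bd b 1
      · rwa [h']
      · exact h2 h h'
  have exists_rho : ∀ x, ∃ d, iota d = cut x := by
    intro x
    refine cut_cases x (fun x => ∃ d, iota d = cut x) ?_ ?_ ?_
    · rw [cut0]; exact exists_iota _ hb' (X.edge_ne _)
    · rw [cut1]; exact exists_iota _ (X.edge_ne _) hb
    · intro h0 h1
      rw [cut_of_ne x h0 h1]; exact exists_iota _ h0 h1
  choose rho hrho using exists_rho
  have rho_iota : ∀ d, rho (iota d) = d := fun d => iota_inj (by rw [hrho, cut_iota])
  let edge : Dart X.Crossing {c : X.Bead // c ≠ b} → Dart X.Crossing {c : X.Bead // c ≠ b} :=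
    fun d => rho (X.edge (iota d))
  have iota_edge : ∀ d, iota (edge d) = cut (X.edge (iota d)) := fun d => hrho _
  have edge_eq_bd : ∀ x i, X.edge x = X.bd b i → x = X.edge (X.bd b i) := by
    intro x i h
    rw [← h, X.edge_edge]
  have edge_edge : ∀ d, edge (edge d) = d := by
    intro d
    apply iota_inj
    rw [iota_edge, iota_edge]
    by_cases h0 : X.edge (iota d) = X.bd b 0
    · rw [h0, cut0, X.edge_edge, cut1, ← edge_eq_bd _ _ h0]
    · by_cases h1 : X.edge (iota d) = X.bd b 1
      · rw [h1, cut1, X.edge_edge, cut0, ← edge_eq_bd _ _ h1]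
      · rw [cut_of_ne _ h0 h1, X.edge_edge, cut_iota]
  have edge_inj : Function.Injective X.edge := fun x y h => by
    rw [← X.edge_edge x, h, X.edge_edge]
  have edge_ne : ∀ d, edge d ≠ d := by
    intro d h
    have h2 := congrArg iota h
    rw [iota_edge] at h2
    by_cases h0 : X.edge (iota d) = X.bd b 0
    · rw [h0, cut0, edge_eq_bd _ _ h0] at h2
      exact h01 (edge_inj h2).symm
    · by_cases h1 : X.edge (iota d) = X.bd b 1
      · rw [h1, cut1, edge_eq_bd _ _ h1] at h2
        exact h01 (edge_inj h2)
      · rw [cut_of_ne _ h0 h1] at h2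
        exact X.edge_ne _ h2
  have region_cut : ∀ x, X.region x (cut x) := by
    intro x
    refine cut_cases x (fun x => X.region x (cut x)) ?_ ?_ ?_
    · rw [cut0]; exact X.region_face (X.bd b 0)
    · rw [cut1]; exact X.region_face (X.bd b 1)
    · intro h0 h1
      rw [cut_of_ne x h0 h1]
  have comp_edge : ∀ x, componentSetoid X.edge x (X.edge x) :=
    fun x => Relation.EqvGen.rel _ _ (Or.inr rfl)
  have comp_cut : ∀ x, componentSetoid X.edge x (cut x) := by
    intro x
    refine cut_cases x (fun x => componentSetoid X.edge x (cut x)) ?_ ?_ ?_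
    · rw [cut0]; exact Setoid.trans' _ (X.componentSetoid_bd b 0 1) (comp_edge _)
    · rw [cut1]; exact Setoid.trans' _ (X.componentSetoid_bd b 1 0) (comp_edge _)
    · intro h0 h1
      rw [cut_of_ne x h0 h1]
  have hedge : ∀ d, componentSetoid edge d (edge d) :=
    fun d => Relation.EqvGen.rel _ _ (Or.inr rfl)
  have edge_rho0 : edge (rho (X.bd b 0)) = rho (X.bd b 1) := by
    apply iota_inj
    rw [iota_edge, hrho, cut0, X.edge_edge, hrho]
  have comp_bd : componentSetoid edge (rho (X.bd b 0)) (rho (X.bd b 1)) := by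
    rw [← edge_rho0]
    exact hedge _
  have rho_edge0 : rho (X.edge (X.bd b 0)) = rho (X.bd b 1) := by
    apply iota_inj
    rw [hrho, hrho, cut1, cut_of_ne _ (X.edge_ne _) hb]
  have rho_edge1 : rho (X.edge (X.bd b 1)) = rho (X.bd b 0) := by
    apply iota_inj
    rw [hrho, hrho, cut0, cut_of_ne _ hb' (X.edge_ne _)]
  let Y : LinkDiagram := X.restrict edge iota rho edge_edge edge_ne rho_iota
    (fun x => by rw [hrho]; exact Setoid.symm' _ (comp_cut x))
    (fun c => by
      rw [iota_edge, iota_rot]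
      exact Setoid.trans' _ (X.region_face _) (region_cut _))
    (fun d => ⟨by rw [iota_rot]; exact componentSetoid_of_rot _,
      by rw [iota_edge]; exact Setoid.trans' _ (comp_edge _) (comp_cut _)⟩)
    (fun x => by
      refine cut_cases x (fun x => componentSetoid edge (rho x) (rho (rot x)) ∧
        componentSetoid edge (rho x) (rho (X.edge x))) ?_ ?_ ?_
      · rw [rho_edge0]
        exact ⟨comp_bd, comp_bd⟩
      · rw [rho_edge1]
        exact ⟨Setoid.symm' _ comp_bd, Setoid.symm' _ comp_bd⟩
      · intro h0 h1
        obtain ⟨d, rfl⟩ := exists_iota x h0 h1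
        rw [rho_iota, ← iota_rot, rho_iota]
        exact ⟨componentSetoid_of_rot _, hedge d⟩)
    (fun x => Or.inl ⟨rho x, by rw [hrho]; exact region_cut x, Setoid.refl' _ _⟩)
    (by
      refine congrArg (· + Nat.card X.Crossing) (Nat.card_congr
        ⟨Quotient.map' rho fun x y h => ?_, Quotient.map' iota fun _ _ h => h, ?_, ?_⟩)
      · show X.region (iota (rho x)) (iota (rho y))
        rw [hrho, hrho]
        exact Setoid.trans' _ (Setoid.symm' _ (region_cut x)) (Setoid.trans' _ h (region_cut y))
      · intro q
        induction q using Quotient.inductionOn' with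
        | _ x =>
          apply Quotient.sound'
          rw [hrho]
          exact Setoid.symm' _ (region_cut x)
      · intro q
        induction q using Quotient.inductionOn' with
        | _ d => exact congrArg (Quotient.mk _) (rho_iota d))
  refine ⟨Y, ⟨b, rho (X.bd b 0), hb, ?_⟩, rfl,
    eq_of_card_option (α := {c : X.Bead // c ≠ b}) (Equiv.optionSubtypeNe b)⟩
  have hmem : ∀ x : X.D, x ∉ {d : X.D | ∃ i, d = X.bd b i} → x ≠ X.bd b 0 ∧ x ≠ X.bd b 1 :=
    fun x h => ⟨fun h0 => h ⟨0, h0⟩, fun h1 => h ⟨1, h1⟩⟩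
  have iota_rho : ∀ x : X.D, x ∉ {d : X.D | ∃ i, d = X.bd b i} → iota (rho x) = x := by
    intro x hx
    rw [hrho, cut_of_ne x (hmem x hx).1 (hmem x hx).2]
  refine ⟨⟨fun x => ⟨rho x.1, id⟩, fun d => ⟨iota d.1, fun ⟨i, h⟩ => iota_ne _ i h⟩, ?_, ?_⟩,
    ?_, ?_, fun x d => cut x = iota d, ?_, ?_, ?_⟩
  · intro x
    exact Subtype.ext (iota_rho x.1 x.2)
  · intro d
    exact Subtype.ext (rho_iota d.1)
  · rintro ⟨x, hx⟩ ⟨x', hx'⟩ h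
    apply iota_inj
    show iota (rot (rho x)) = iota (rho x')
    rw [iota_rot, iota_rho x hx, iota_rho x' hx', h]
  · rintro ⟨x, hx⟩
    obtain ⟨d, rfl⟩ := exists_iota x (hmem x hx).1 (hmem x hx).2
    show IsOver (iota d) ↔ IsOver (rho (iota d))
    rw [rho_iota]
    rcases d with ⟨v, j⟩ | ⟨c, j⟩ <;> exact Iff.rfl
  · intro x d
    constructor
    · intro h
      by_cases hx : x ∈ {d : X.D | ∃ i, d = X.bd b i}
      · right
        obtain ⟨i, rfl⟩ := hx
        rcases zmod_two_eq i with rfl | rfl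
        · exact ⟨0, rfl, iota_inj (by rw [← h]; exact hrho _)⟩
        · exact ⟨1, rfl, iota_inj (by
            rw [← h]
            exact (congrArg iota edge_rho0).trans (hrho _))⟩
      · left
        refine ⟨hx, iota_inj ?_⟩
        rw [← h]
        exact hrho x
    · rintro (⟨hx, h⟩ | ⟨i, h, h'⟩)
      · rw [← h]
        exact (hrho x).symm
      · fin_cases i
        · rw [← h, ← h']
          exact (hrho _).symm
        · rw [← h, ← h']
          exact ((congrArg iota edge_rho0).trans (hrho _)).symm
  · intro x d h
    show cut (X.edge x) = iota (edge d)
    refine Eq.trans ?_ (iota_edge d).symm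
    rw [← show cut x = iota d from h]
    refine cut_cases x (fun x => cut (X.edge x) = cut (X.edge (cut x))) ?_ ?_ ?_
    · rw [cut0, X.edge_edge, cut1, cut_of_ne _ (X.edge_ne _) hb]
    · rw [cut1, X.edge_edge, cut0, cut_of_ne _ hb' (X.edge_ne _)]
    · intro h0 h1
      rw [cut_of_ne x h0 h1]
  · intro c c₁ d d₁ hc hd
    show _ ↔ X.region (iota c₁) (iota d₁)
    rw [← hc, ← hd]
    exact ⟨fun h => Setoid.trans' _ (Setoid.symm' _ (region_cut c))
      (Setoid.trans' _ h (region_cut d)), fun h => Setoid.trans' _ (region_cut c)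
      (Setoid.trans' _ h (Setoid.symm' _ (region_cut d)))⟩

end LinkDiagram


namespace LinkDiagram

open Classical in
/-- A loop that bounds a region can be removed by a first Reidemeister move. -/
lemma exists_omega1Down (X : LinkDiagram) (v : X.Crossing) (i : ZMod 4)
    (hv : X.edge (X.cr v (i + 1)) = X.cr v i)
    (hr : ∀ d, X.region (X.cr v i) d → d = X.cr v i) :
    ∃ Y, Omega1Down X Y ∧ X.numCrossings = Y.numCrossings + 1 := by
  have := X.finite_crossing
  have := X.finite_bead
  have hv' : X.edge (X.cr v i) = X.cr v (i + 1) := by rw [← hv, X.edge_edge]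
  -- The new bead inherits the darts `i + 2` and `i + 3` of `v`. Only the two darts of the loop are
  -- lost, and all other edges stay as they are.
  let iota : Dart {w : X.Crossing // w ≠ v} (X.Bead ⊕ Unit) → X.D
    | Sum.inl (w, j) => X.cr w.1 j
    | Sum.inr (Sum.inl b, j) => X.bd b j
    | Sum.inr (Sum.inr _, j) => X.cr v (if j = 0 then i + 2 else i + 3)
  let bead : ZMod 2 → Dart {w : X.Crossing // w ≠ v} (X.Bead ⊕ Unit) :=
    fun j => Sum.inr (Sum.inr (), j)
  have iota_bead0 : iota (bead 0) = X.cr v (i + 2) := rfl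
  have iota_bead1 : iota (bead 1) = X.cr v (i + 3) := rfl
  have cr_inj : ∀ j j' : ZMod 4, X.cr v j = X.cr v j' → j = j' :=
    fun j j' h => (Prod.mk.inj (Sum.inl.inj h)).2
  have cr_ne : ∀ a b : ZMod 4, a ≠ b → X.cr v (i + a) ≠ X.cr v (i + b) :=
    fun a b hab h => hab (add_left_cancel (cr_inj _ _ h))
  have cr_ne' : ∀ a : ZMod 4, a ≠ 0 → X.cr v (i + a) ≠ X.cr v i := by
    intro a ha
    have := cr_ne a 0 ha
    rwa [add_zero] at this
  have iota_cases : ∀ d (P : Dart {w : X.Crossing // w ≠ v} (X.Bead ⊕ Unit) → Prop),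
      P (bead 0) → P (bead 1) → ((∀ j, iota d ≠ X.cr v j) → P d) → P d := by
    rintro (⟨w, j⟩ | ⟨b | _, j⟩) P h0 h1 h2
    · exact h2 fun j h => w.2 (Prod.mk.inj (Sum.inl.inj h)).1
    · exact h2 fun j h => by cases h
    · rcases zmod_two_eq j with rfl | rfl
      exacts [h0, h1]
  have iota_ne0 : ∀ d, iota d ≠ X.cr v i := fun d =>
    iota_cases d (fun d => iota d ≠ X.cr v i)
      (cr_ne' 2 (by decide)) (cr_ne' 3 (by decide)) fun h => h _
  have iota_ne1 : ∀ d, iota d ≠ X.cr v (i + 1) := fun d =>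
    iota_cases d (fun d => iota d ≠ X.cr v (i + 1))
      (cr_ne 2 1 (by decide)) (cr_ne 3 1 (by decide)) fun h => h _
  have iota_inj : Function.Injective iota := by
    rintro (⟨w, j⟩ | ⟨b | _, j⟩) (⟨w', j'⟩ | ⟨b' | _, j'⟩) h
    · have h1 := Prod.mk.inj (Sum.inl.inj h)
      exact congrArg Sum.inl (Prod.ext (Subtype.ext h1.1) h1.2)
    · cases h
    · exact absurd (Prod.mk.inj (Sum.inl.inj h)).1 w.2
    · cases h
    · have h1 := Prod.mk.inj (Sum.inr.inj h)
      exact congrArg Sum.inr (Prod.ext (congrArg Sum.inl h1.1) h1.2)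
    · cases h
    · exact absurd (Prod.mk.inj (Sum.inl.inj h)).1.symm w'.2
    · cases h
    · rcases zmod_two_eq j with rfl | rfl <;> rcases zmod_two_eq j' with rfl | rfl
      · rfl
      · exact absurd h (cr_ne 2 3 (by decide))
      · exact absurd h (cr_ne 3 2 (by decide))
      · rfl
  have exists_iota : ∀ x, x ≠ X.cr v i → x ≠ X.cr v (i + 1) → ∃ d, iota d = x := by
    rintro (⟨w, j⟩ | ⟨b, j⟩) h0 h1
    · by_cases hw : w = v
      · subst hw
        rcases zmod_four_eq i j with rfl | rfl | rfl | rfl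
        exacts [absurd rfl h0, absurd rfl h1, ⟨bead 0, rfl⟩, ⟨bead 1, rfl⟩]
      · exact ⟨Sum.inl (⟨w, hw⟩, j), rfl⟩
    · exact ⟨Sum.inr (Sum.inl b, j), rfl⟩
  have dart_cases : ∀ x (P : X.D → Prop), P (X.cr v i) → P (X.cr v (i + 1)) →
      (∀ d, P (iota d)) → P x := by
    intro x P h0 h1 h2
    by_cases h : x = X.cr v i
    · rwa [h]
    · by_cases h' : x = X.cr v (i + 1)
      · rwa [h']
      · obtain ⟨d, rfl⟩ := exists_iota x h h'
        exact h2 d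
  have exists_edge : ∀ d, ∃ e, iota e = X.edge (iota d) := by
    intro d
    apply exists_iota
    · intro h
      exact iota_ne1 d (by rw [← hv', ← h, X.edge_edge])
    · intro h
      exact iota_ne0 d (by rw [← hv, ← h, X.edge_edge])
  choose edge hedge using exists_edge
  have exists_rho : ∀ x, ∃ d, iota d = x ∨ (d = bead 0 ∧ (x = X.cr v i ∨ x = X.cr v (i + 1))) :=
    fun x => dart_cases x
      (fun x => ∃ d, iota d = x ∨ (d = bead 0 ∧ (x = X.cr v i ∨ x = X.cr v (i + 1))))
      ⟨bead 0, Or.inr ⟨rfl, Or.inl rfl⟩⟩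
      ⟨bead 0, Or.inr ⟨rfl, Or.inr rfl⟩⟩
      fun d => ⟨d, Or.inl rfl⟩
  choose rho hrho using exists_rho
  have rho_iota : ∀ d, rho (iota d) = d := by
    intro d
    rcases hrho (iota d) with h | ⟨-, h | h⟩
    exacts [iota_inj h, absurd h (iota_ne0 d), absurd h (iota_ne1 d)]
  have rho0 : rho (X.cr v i) = bead 0 := by
    rcases hrho (X.cr v i) with h | ⟨h, -⟩
    exacts [absurd h (iota_ne0 _), h]
  have rho1 : rho (X.cr v (i + 1)) = bead 0 := by
    rcases hrho (X.cr v (i + 1)) with h | ⟨h, -⟩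
    exacts [absurd h (iota_ne1 _), h]
  have edge_edge : ∀ d, edge (edge d) = d := fun d => iota_inj (by rw [hedge, hedge, X.edge_edge])
  have edge_ne : ∀ d, edge d ≠ d := fun d h => X.edge_ne (iota d) (by rw [← hedge, h])
  have iota_rot : ∀ d, (∀ j, iota d ≠ X.cr v j) → iota (rot d) = rot (iota d) := by
    rintro (⟨w, j⟩ | ⟨b | _, j⟩) h
    · rfl
    · rfl
    · exact absurd rfl (h _)
  have comp_edge : ∀ d, componentSetoid edge d (edge d) :=
    fun d => Relation.EqvGen.rel _ _ (Or.inr rfl)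
  have comp_bead : ∀ j j', componentSetoid edge (bead j) (bead j') := by
    intro j j'
    rcases zmod_two_eq' j j' with rfl | rfl
    exacts [Setoid.refl' _ _, componentSetoid_of_rot _]
  -- The lost corner `i + 1` lies in a region that has a surviving corner.
  have face1 : X.region (X.cr v (i + 1)) (iota (edge (bead 0))) := by
    have := X.region_face (X.cr v (i + 1))
    rwa [rot_cr, add_assoc, show (1 + 1 : ZMod 4) = 2 from rfl, ← iota_bead0,
      ← hedge (bead 0)] at this
  have rot3 : rot (X.cr v (i + 3)) = X.cr v i := by
    rw [rot_cr, add_assoc, show (3 + 1 : ZMod 4) = 0 from rfl, add_zero]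
  have rot2 : rot (X.cr v (i + 2)) = X.cr v (i + 3) := by
    rw [rot_cr, add_assoc]
    rfl
  have rot1 : rot (X.cr v (i + 1)) = X.cr v (i + 2) := by
    rw [rot_cr, add_assoc]
    rfl
  have card_crossing : Nat.card X.Crossing = Nat.card {w : X.Crossing // w ≠ v} + 1 :=
    eq_of_card_option (Equiv.optionSubtypeNe v)
  -- The only region without a surviving corner is the inside of the loop.
  have card_region : Nat.card (Quotient X.region) =
      Nat.card (Quotient (Setoid.comap iota X.region)) + 1 := by
    have hD := X.finite_dart
    have : Finite (Dart {w : X.Crossing // w ≠ v} (X.Bead ⊕ Unit)) := inferInstance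
    let f : Option (Quotient (Setoid.comap iota X.region)) → Quotient X.region := fun q =>
      q.elim (Quotient.mk _ (X.cr v i)) (Quotient.map' iota fun _ _ h => h)
    refine eq_of_card_option (Equiv.ofBijective f ⟨?_, ?_⟩)
    · rintro (_ | q) (_ | q') h
      · rfl
      · induction q' using Quotient.inductionOn' with
        | _ d => exact absurd (hr _ (Quotient.exact h)) (iota_ne0 d)
      · induction q using Quotient.inductionOn' with
        | _ d => exact absurd (hr _ (Setoid.symm' _ (Quotient.exact h))) (iota_ne0 d)
      · induction q using Quotient.inductionOn' with
        | _ d =>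
          induction q' using Quotient.inductionOn' with
          | _ d' =>
            have h' : X.region (iota d) (iota d') := Quotient.exact h
            exact congrArg some (Quotient.sound (s := Setoid.comap iota X.region) h')
    · intro q
      induction q using Quotient.inductionOn' with
      | _ x =>
        refine dart_cases x (fun x => ∃ a, f a = Quotient.mk _ x) ⟨none, rfl⟩ ?_ ?_
        · exact ⟨some (Quotient.mk _ (edge (bead 0))), Quotient.sound (Setoid.symm' _ face1)⟩
        · intro d
          exact ⟨some (Quotient.mk _ d), rfl⟩
  let Y : LinkDiagram := X.restrict edge iota rho edge_edge edge_ne rho_iota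
    (fun x => by
      rcases hrho x with h | ⟨h, rfl | rfl⟩
      · rw [h]
      · rw [h]; exact X.componentSetoid_cr v _ _
      · rw [h]; exact X.componentSetoid_cr v _ _)
    (fun c => by
      refine iota_cases c (fun c => X.region (iota c) (iota (edge (rot c)))) ?_ ?_ ?_
      · show X.region _ (iota (edge (bead 1)))
        have := X.region_face (X.cr v (i + 2))
        rwa [rot2, ← iota_bead1, ← hedge (bead 1)] at this
      · show X.region _ (iota (edge (bead 0)))
        have := X.region_face (X.cr v (i + 3))
        rw [rot3, hv'] at this
        exact Setoid.trans' _ this face1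
      · intro h
        rw [hedge, iota_rot c h]
        exact X.region_face _)
    (fun d => ⟨by
      refine iota_cases d (fun d => componentSetoid X.edge (iota d) (iota (rot d))) ?_ ?_ ?_
      · exact X.componentSetoid_cr v _ _
      · exact X.componentSetoid_cr v _ _
      · intro h
        rw [iota_rot d h]
        exact componentSetoid_of_rot _, by
      rw [hedge]
      exact Relation.EqvGen.rel _ _ (Or.inr rfl)⟩)
    (fun x => by
      refine dart_cases x (fun x => componentSetoid edge (rho x) (rho (rot x)) ∧
        componentSetoid edge (rho x) (rho (X.edge x))) ?_ ?_ ?_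
      · rw [hv', rot_cr, rho0, rho1]
        exact ⟨Setoid.refl' _ _, Setoid.refl' _ _⟩
      · rw [hv, rot1, rho0, rho1, ← iota_bead0, rho_iota (bead 0)]
        exact ⟨Setoid.refl' _ _, Setoid.refl' _ _⟩
      · intro d
        refine ⟨?_, ?_⟩
        · rw [rho_iota]
          refine iota_cases d (fun d => componentSetoid edge d (rho (rot (iota d)))) ?_ ?_ ?_
          · rw [iota_bead0, rot2, ← iota_bead1, rho_iota (bead 1)]
            exact comp_bead 0 1
          · rw [iota_bead1, rot3, rho0]
            exact comp_bead 1 0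
          · intro h
            rw [← iota_rot d h, rho_iota]
            exact componentSetoid_of_rot _
        · rw [rho_iota, ← hedge, rho_iota]
          exact comp_edge d)
    (fun x => by
      refine dart_cases x (fun x => (∃ c, X.region x (iota c) ∧ componentSetoid edge (rho x) c) ∨
        ∀ y, X.region x y → y = x) (Or.inr hr) (Or.inl ⟨_, face1, ?_⟩) ?_
      · rw [rho1]
        exact comp_edge _
      · intro d
        exact Or.inl ⟨d, Setoid.refl' _ _, by rw [rho_iota]⟩)
    (by omega)
  refine ⟨Y, ⟨v, i, Sum.inr (), hv, hr, ?_⟩, card_crossing⟩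
  have hmem : ∀ d, (∃ j, iota d = X.cr v j) ↔ ∃ j, d = bead j := by
    intro d
    constructor
    · rintro ⟨j, h⟩
      exact iota_cases d (fun d => ∃ j, d = bead j) ⟨0, rfl⟩ ⟨1, rfl⟩ fun h' => absurd h (h' j)
    · rintro ⟨j, rfl⟩
      exact ⟨_, rfl⟩
  have iota_rho : ∀ x : X.D, (¬ ∃ j, x = X.cr v j) → iota (rho x) = x := by
    intro x hx
    rcases hrho x with h | ⟨-, h | h⟩
    exacts [h, absurd ⟨_, h⟩ hx, absurd ⟨_, h⟩ hx]
  refine ⟨⟨fun x => ⟨rho x.1, fun h => x.2 ?_⟩, fun d => ⟨iota d.1, fun h => d.2 ((hmem _).1 h)⟩,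
    ?_, ?_⟩, ?_, ?_, fun x d => x = iota d, ?_, ?_, ?_⟩
  · obtain ⟨j, h⟩ := (hmem _).2 h
    rw [iota_rho x.1 x.2] at h
    exact ⟨j, h⟩
  · intro x
    exact Subtype.ext (iota_rho x.1 x.2)
  · intro d
    exact Subtype.ext (rho_iota d.1)
  · rintro ⟨x, hx⟩ ⟨x', hx'⟩ h
    apply iota_inj
    show iota (rot (rho x)) = iota (rho x')
    rw [iota_rot _ (by rw [iota_rho x hx]; exact fun j hj => hx ⟨j, hj⟩), iota_rho x hx,
      iota_rho x' hx', h]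
  · rintro ⟨x, hx⟩
    show IsOver x ↔ IsOver (rho x)
    have h1 := iota_rho x hx
    rcases h2 : rho x with ⟨w, j⟩ | ⟨b | _, j⟩
    · rw [h2] at h1
      rw [← h1]
      exact Iff.rfl
    · rw [h2] at h1
      rw [← h1]
      exact Iff.rfl
    · rw [h2] at h1
      exact absurd ⟨_, h1.symm⟩ hx
  · intro x d
    constructor
    · rintro rfl
      by_cases hd : ∃ j, iota d = X.cr v j
      · obtain ⟨j, rfl⟩ := (hmem d).1 hd
        right
        rcases zmod_two_eq j with rfl | rfl
        exacts [⟨0, rfl, rfl⟩, ⟨1, rfl, rfl⟩]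
      · exact Or.inl ⟨hd, rho_iota d⟩
    · rintro (⟨hx, h⟩ | ⟨j, h, h'⟩)
      · rw [← h]
        exact (iota_rho x hx).symm
      · fin_cases j
        · rw [← h, ← h']
          rfl
        · rw [← h, ← h']
          rfl
  · rintro x d rfl
    exact (hedge d).symm
  · rintro c c₁ d d₁ rfl rfl
    exact Iff.rfl

end LinkDiagram


/-! ### Starting diagrams with two corners in every region -/

namespace LinkDiagram

lemma EraseBead.link_eq {X Y : LinkDiagram} (h : EraseBead X Y) : X.link = Y.link :=
  Quotient.sound (Relation.EqvGen.rel _ _ (Or.inl (Or.inr (Or.inl h))))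

lemma Omega1Down.link_eq {X Y : LinkDiagram} (h : Omega1Down X Y) : X.link = Y.link :=
  Quotient.sound (Relation.EqvGen.rel _ _ (Or.inr (Or.inl h)))

lemma crossingNumber_le (X : LinkDiagram) : X.link.crossingNumber ≤ X.numCrossings :=
  Nat.sInf_le ⟨X, rfl, rfl⟩

/-- A bead of a connected diagram with crossings is not the only vertex on a closed curve. -/
lemma IsConnected.edge_bd_ne {X : LinkDiagram} (h : X.IsConnected) (v : X.Crossing) (b : X.Bead) :
    X.edge (X.bd b 0) ≠ X.bd b 1 := by
  intro hb
  have h1 : ∀ i : ZMod 2, X.edge (X.bd b i) = X.bd b (i + 1) := by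
    intro i
    rcases zmod_two_eq i with rfl | rfl
    · exact hb
    · rw [← hb, X.edge_edge]
      rfl
  have h2 : componentSetoid X.edge ≤ Setoid.ker fun x => ∃ i, x = X.bd b i := by
    apply Setoid.eqvGen_le
    rintro x y (rfl | rfl)
    · apply propext
      constructor
      · rintro ⟨i, rfl⟩
        exact ⟨i + 1, rfl⟩
      · rintro ⟨i, hi⟩
        exact ⟨i - 1, rot_bijective.1 (hi.trans (congrArg (X.bd b) (sub_add_cancel i 1).symm))⟩
    · apply propext
      constructor
      · rintro ⟨i, rfl⟩
        exact ⟨i + 1, h1 i⟩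
      · rintro ⟨i, hi⟩
        exact ⟨i + 1, by rw [← h1, ← hi, X.edge_edge]⟩
  have h3 : (∃ i, X.cr v 0 = X.bd b i) = ∃ i, X.bd b 0 = X.bd b i := h2 (h (X.cr v 0) (X.bd b 0))
  obtain ⟨i, hi⟩ := h3.mpr ⟨0, rfl⟩
  cases hi

/-- In a diagram with the least number of crossings and without beads all regions have at least two
corners. -/
lemma IsMinimal.hasTwoCorners {X : LinkDiagram} (h : X.IsMinimal) (hb : IsEmpty X.Bead) :
    X.HasTwoCorners := by
  intro c hc
  by_contra! hd
  obtain ⟨v, i, rfl⟩ := hc.exists_inl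
  -- Without beads a lone crossing corner is the only dart of its region, so `region_face` forces
  -- the edge to be a loop that a first move removes.
  have hr : ∀ d, X.region (X.cr v i) d → d = X.cr v i := by
    rintro (⟨w, j⟩ | ⟨b, j⟩) hd'
    · by_contra hne
      exact hd _ (isCrossingDart_inl w j) hne hd'
    · exact hb.elim b
  obtain ⟨Y, hY, hn⟩ := X.exists_omega1Down v i (hr _ (X.region_face _)) hr
  have h1 := Y.crossingNumber_le
  rw [← hY.link_eq, ← show X.numCrossings = _ from h] at h1
  omega

end LinkDiagram

namespace Link

open LinkDiagram

lemma exists_isMinimal (L : Link) :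
    ∃ X : LinkDiagram, X.link = L ∧ X.numCrossings = L.crossingNumber := by
  obtain ⟨X, rfl⟩ := Quotient.exists_rep L
  exact Nat.sInf_mem (s := {n : ℕ | ∃ Y : LinkDiagram, Y.link = X.link ∧ Y.numCrossings = n})
    ⟨_, X, rfl, rfl⟩

/-- A link that is neither split nor trivial has a minimal diagram in which all regions have at
least two corners. -/
lemma exists_isMinimal_hasTwoCorners {L : Link} (hs : ¬ L.IsSplit) (ht : ¬ L.IsTrivial) :
    ∃ X : LinkDiagram, X.link = L ∧ X.numCrossings = L.crossingNumber ∧ 0 < X.numCrossings ∧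
      X.HasTwoCorners := by
  classical
  -- Among the minimal diagrams one with the fewest beads is taken. It is connected and has a
  -- crossing, so any bead could still be erased; hence there is none.
  have hex : ∃ n, ∃ X : LinkDiagram, X.link = L ∧ X.numCrossings = L.crossingNumber ∧
      Nat.card X.Bead = n := by
    obtain ⟨X, h1, h2⟩ := L.exists_isMinimal
    exact ⟨_, X, h1, h2, rfl⟩
  obtain ⟨X, h1, h2, h3⟩ := Nat.find_spec hex
  have hpos : 0 < X.numCrossings := Nat.pos_of_ne_zero fun h => ht ⟨X, h1, h⟩
  have hcon : X.IsConnected := by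
    by_contra h
    exact hs ⟨X, h1, h⟩
  refine ⟨X, h1, h2, hpos, IsMinimal.hasTwoCorners (h2.trans (by rw [h1])) ⟨fun b => ?_⟩⟩
  have := X.finite_crossing
  obtain ⟨v⟩ : Nonempty X.Crossing := (Nat.card_pos_iff.1 hpos).1
  obtain ⟨Y, hY, hn, hbd⟩ := X.exists_eraseBead b (hcon.edge_bd_ne v b)
  exact Nat.find_min hex (m := Nat.card Y.Bead) (by omega) ⟨Y, hY.link_eq.symm.trans h1,
    hn.trans h2, rfl⟩

/-- One insertion of the tangle gives every crossing a good corner. A second one, with its weak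
corners turned to the good corners, gives two corners to every region that has a crossing on its
boundary. -/
lemma exists_hasTwoCorners (L : Link) :
    ∃ X : LinkDiagram, X.link = L ∧ 0 < X.numCrossings ∧ X.HasTwoCorners := by
  obtain ⟨X₀, rfl⟩ := Quotient.exists_rep L
  -- The kinks at the beads guarantee at least one crossing, even for a diagram of a trivial link.
  let X₁ := X₀.insert 0 (fun _ => crossingTangle 0) kinkTangle
  let X₂ := X₁.insert 0 (fun _ => sevenTangle 0) beadTangle
  have h := exists_good_corner (X := X₁) (k := 0)
  choose k hk using h
  refine ⟨X₂.insert k (fun v => sevenTangle (k v)) beadTangle, ?_, ?_,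
    hasTwoCorners_insert_seven hk⟩
  · exact link_insert_seven.trans ((link_insert_seven (X := X₁) (k := 0)).trans
      (link_insert_kink (X := X₀) (k := 0)))
  · have e1 := numCrossings_insert (X := X₀) (k := 0) (fun _ => crossingTangle 0) kinkTangle 1
      fun _ => rfl
    have e2 := numCrossings_insert (X := X₁) (k := 0) (fun _ => sevenTangle 0) beadTangle 7
      fun _ => rfl
    have e3 := numCrossings_insert (X := X₂) (k := k) (fun v => sevenTangle (k v)) beadTangle 7
      fun _ => rfl
    have h1 : 0 < Nat.card X₀.Crossing + Nat.card X₀.Bead := by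
      have := X₀.finite_crossing
      have := X₀.finite_bead
      rw [← Nat.card_sum]
      exact Nat.card_pos_iff.2 ⟨X₀.nonempty.map vertex, inferInstance⟩
    have h2 : kinkTangle.n = 1 := rfl
    have h3 : beadTangle.n = 0 := rfl
    have h4 : X₁.numCrossings = Nat.card X₁.Crossing := rfl
    have h5 : X₂.numCrossings = Nat.card X₂.Crossing := rfl
    rw [h2] at e1
    rw [h3, zero_mul, add_zero] at e2 e3
    rw [e3, ← h5, show X₂.numCrossings = _ from e2, ← h4, show X₁.numCrossings = _ from e1]
    omega

end Link

/-! ### Conclusion -/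

namespace LinkDiagram

/-- A diagram in which all regions have at least two corners gives rise to a rigid hard diagram of
the same link with seven times as many crossings. -/
lemma HasTwoCorners.exists_isRigidHard {X : LinkDiagram} (h : X.HasTwoCorners)
    (hn : 0 < X.numCrossings) :
    ∃ Y : LinkDiagram, Y.link = X.link ∧ Y.IsRigidHard ∧ Y.numCrossings = 7 * X.numCrossings := by
  obtain ⟨k, h1, h2⟩ := exists_stuck h
  have h3 := numCrossings_insert (X := X) (k := k) (fun v => sevenTangle (k v)) beadTangle 7
    fun _ => rfl
  rw [show beadTangle.n = 0 from rfl, zero_mul, add_zero] at h3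
  have h4 : X.numCrossings = Nat.card X.Crossing := rfl
  have h5 := X.crossingNumber_le
  refine ⟨_, link_insert_seven, h1.isRigidHard h2 ?_, h3⟩
  -- With `n` crossings in `X`, one has `c(L) ≤ n < 7 * n`, where the strict inequality uses `0 <
  -- n`.
  rw [link_insert_seven, h3]
  omega

end LinkDiagram

end KnotTheory

theorem mainTheorem2 (L : KnotTheory.Link) :
    ∃ X : KnotTheory.LinkDiagram, X.link = L ∧ X.IsRigidHard ∧
      (¬ L.IsSplit → ¬ L.IsTrivial → X.numCrossings ≤ 8 * L.crossingNumber) := by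
  by_cases h : L.IsSplit ∨ L.IsTrivial
  -- For a split or trivial link the bound is vacuous, so the size of the starting diagram is
  -- irrelevant.
  · obtain ⟨X, rfl, hn, h2⟩ := L.exists_hasTwoCorners
    obtain ⟨Y, h3, h4, -⟩ := h2.exists_isRigidHard hn
    exact ⟨Y, h3, h4, fun hs ht => absurd h (not_or.2 ⟨hs, ht⟩)⟩
  · rw [not_or] at h
    obtain ⟨X, rfl, hc, hn, h2⟩ := KnotTheory.Link.exists_isMinimal_hasTwoCorners h.1 h.2
    obtain ⟨Y, h3, h4, h5⟩ := h2.exists_isRigidHard hn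
    -- The construction yields exactly `7 * c(L)` crossings, which is better than required.
    exact ⟨Y, h3, h4, fun _ _ => by omega⟩
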